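/- Let $p$ be an odd prime and $n\ge0$ an integer. Let $F_n$ be the free pro-$p$-group on $n$ generators. All subgroups of pro-$p$-groups are closed, all homomorphisms are continuous, and $d(G)$ denotes the minimal number of generators of $G$. **Definitions.** For a normal subgroup $N$ of a pro-$p$-group $G$ let $N^*$ be the subgroup generated by all $x^p$ and all commutators $[g,x]$ with $x\in N$, $g\in G$. Put $P_0(G)=G$ and $P_{j+1}(G)=P_j(G)^*$. For a characteristic subgroup $E$ of $F_n$ and a pro-$p$-group $G$ with $d(G)\le n$, let $E(G)\subset G$ be the image of $E$ under a surjection $F_n\to G$ (it does not depend on the surjection). If $G\cong F_n/N$ with $d(G)=n$ and $E(G)=1$, put $r_E(G)=\dim_{\mathbb F_p} N/EN^*$. For a finite $p$-group $H\cong F_n/M$ with $d(H)=n$, the $p$-cover is $H^*=F_n/M^*$ and the $p$-multiplicator rank is $\mu(H)=\dim_{\mathbb F_p}M/M^*$. In a group with an action of a group $\{1,\sigma\}$ of order two, an element $a$ is called odd if ${}^\sigma a=a^{-1}$. A weak Schur $\sigma$-group is a pro-$p$-group $G$ with such an action, for which $\dim H^2(G,\mathbb F_p)\le\dim H^1(G,\mathbb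 F_p)<\infty$ and $\sigma$ acts by $-1$ on both spaces. For an open characteristic subgroup $E\subset F_n$, a finite $p$-group $H$ is called a Schur $E$-quotient if $H\cong G/E(G)$ for some weak Schur $\sigma$-group $G$ with $d(G)=n$. **Proposition.** (1) Let $E\subset D$ be open proper characteristic subgroups of $F_n$ with $D^*\subset E$. Let $H$ be a Schur $D$-quotient with $r_D(H)=n$, and let $K$ be a finite $p$-group with $d(K)=n$ and $K/D(K)\cong H$. Then $M/M^*$ (where $H\cong F_n/M$) and $E(H^*)$ are finite dimensional $\mathbb F_p$-vector spaces, and so is $\mathrm{Ker}(K\to H)$ if $E(K)=1$. Moreover, $K$ is a Schur $E$-quotient if and only if the following conditions hold: (a) $E(K)=1$; (b) $K$ possesses an action of a group $\{1,\sigma\}$ of order two for which $K$ is generated by odd elements; (c$'$) $\mu(H)=\dim_{\mathbb F_p}\mathrm{Ker}(K\to H)+n+\dim_{\mathbb F_p}E(H^*)$. (2) Let $j\ge1$. Let $H$ be a Schur $P_j(F_n)$-quotient with $r_{P_j(F_n)}(H)=n$, and let $K$ be a finite $p$-group with $d(K)=n$ and $K/P_j(K)\cong H$. Put $E=P_{j+1}(F_n)$.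 Then $E(H^*)=1$, the space $M/M^*$ is finite dimensional over $\mathbb F_p$, and so is $\mathrm{Ker}(K\to H)$ if $P_{j+1}(K)=1$. Moreover, $K$ is a Schur $P_{j+1}(F_n)$-quotient if and only if $P_{j+1}(K)=1$, condition (b) holds, and (c$''$) $\mu(H)=\dim_{\mathbb F_p}\mathrm{Ker}(K\to H)+n$. -/

import Mathlib

/-! ### Subgroups of topological groups -/

/-- The closed subgroup generated by the `p`-th powers of elements of `N` and the commutators
`[g, x]` with `g ∈ G`, `x ∈ N`. For a normal subgroup `N` this is `N^*`. -/
def relFrattini (p : ℕ) {G : Type*} [Group G] [TopologicalSpace G] [IsTopologicalGroup G]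
    (N : Subgroup G) : Subgroup G :=
  (Subgroup.closure {a | ∃ x ∈ N, a = x ^ p} ⊔ ⁅(⊤ : Subgroup G), N⁆).topologicalClosure

instance relFrattini_normal (p : ℕ) {G : Type*} [Group G] [TopologicalSpace G]
    [IsTopologicalGroup G] (N : Subgroup G) [hN : N.Normal] : (relFrattini p N).Normal := by
  have h : (Subgroup.closure {a | ∃ x ∈ N, a = x ^ p}).Normal := by
    rw [Subgroup.normal_iff_map_conj_eq]
    have key : ∀ g : G, (Subgroup.closure {a | ∃ x ∈ N, a = x ^ p}).map (MulAut.conj g) ≤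
        Subgroup.closure {a | ∃ x ∈ N, a = x ^ p} := by
      intro g
      rw [Subgroup.map_le_iff_le_comap, Subgroup.closure_le]
      rintro a ⟨x, hx, rfl⟩
      apply Subgroup.subset_closure
      exact ⟨g * x * g⁻¹, hN.conj_mem x hx g, by simp⟩
    intro g
    refine le_antisymm (key g) fun a ha => ?_
    have h2 : MulAut.conj g⁻¹ a ∈ Subgroup.closure {a | ∃ x ∈ N, a = x ^ p} :=
      key g⁻¹ ⟨a, ha, rfl⟩
    exact ⟨_, h2, by simp [mul_assoc]⟩
  have h3 : (Subgroup.closure {a | ∃ x ∈ N, a = x ^ p} ⊔ ⁅(⊤ : Subgroup G), N⁆).Normal :=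
    inferInstance
  exact Subgroup.is_normal_topologicalClosure _

/-- The lower `p`-central series, with `P_0(G) = G` and `P_{j+1}(G) = P_j(G)^*`. -/
def lowerPCentral (p : ℕ) (G : Type*) [Group G] [TopologicalSpace G] [IsTopologicalGroup G] :
    ℕ → Subgroup G
  | 0 => ⊤
  | j + 1 => relFrattini p (lowerPCentral p G j)

/-- A subgroup that is invariant under all topological automorphisms. -/
def IsTopCharacteristic {G : Type*} [Group G] [TopologicalSpace G] (E : Subgroup G) : Prop :=
  ∀ φ : G ≃ₜ* G, E.map (φ : G →* G) = E

/-- The minimal number `d(G)` of topological generators. -/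
noncomputable def genRank (G : Type*) [Group G] [TopologicalSpace G] : ℕ∞ :=
  ⨅ S : {S : Set G // Dense (Subgroup.closure S : Set G)}, S.1.encard

/-- For subgroups `A`, `B` of `G`: `A ⊆ B`, the subgroup `A` is normal in `B`, and `B / A` is an
`𝔽_p`-vector space of dimension `d` (in other words, `B / A ≅ 𝔽_p ^ d`). -/
def HasQuotientDim (p : ℕ) {G : Type*} [Group G] (B A : Subgroup G) (d : ℕ) : Prop :=
  A ≤ B ∧ ∃ ψ : B →* Multiplicative (Fin d → ZMod p),
    Function.Surjective ψ ∧ ψ.ker = A.subgroupOf B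

/-- The subgroup `B` is an `𝔽_p`-vector space of dimension `d`. -/
def HasDim (p : ℕ) {G : Type*} [Group G] (B : Subgroup G) (d : ℕ) : Prop :=
  HasQuotientDim p B ⊥ d

/-! ### Free pro-`p`-groups -/

/-- The normal subgroups of `p`-power index in the free group on `n` generators. -/
def PIndexSubgroup (p n : ℕ) : Type :=
  {N : Subgroup (FreeGroup (Fin n)) // N.Normal ∧ ∃ k : ℕ, N.index = p ^ k}

instance (p n : ℕ) (N : PIndexSubgroup p n) : N.1.Normal := N.2.1

/-- The finite quotient of the free group by `N`, with the discrete topology. -/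
def PIndexQuotient (p n : ℕ) (N : PIndexSubgroup p n) : Type := FreeGroup (Fin n) ⧸ N.1

instance (p n : ℕ) (N : PIndexSubgroup p n) : Group (PIndexQuotient p n N) :=
  inferInstanceAs (Group (FreeGroup (Fin n) ⧸ N.1))

instance (p n : ℕ) (N : PIndexSubgroup p n) : TopologicalSpace (PIndexQuotient p n N) := ⊥

instance (p n : ℕ) (N : PIndexSubgroup p n) : DiscreteTopology (PIndexQuotient p n N) := ⟨rfl⟩

/-- The transition map between the quotients by `N ≤ M`. -/
def PIndexQuotient.transition {p n : ℕ} {N M : PIndexSubgroup p n} (h : N.1 ≤ M.1) :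
    PIndexQuotient p n N →* PIndexQuotient p n M :=
  QuotientGroup.map N.1 M.1 (MonoidHom.id _) h

/-- The free pro-`p`-group `F_n` as the inverse limit of the quotients of the free group on `n`
generators by its normal subgroups of `p`-power index, as a subgroup of their product. -/
def freeProPSubgroup (p n : ℕ) : Subgroup (∀ N : PIndexSubgroup p n, PIndexQuotient p n N) where
  carrier := {x | ∀ (N M : PIndexSubgroup p n) (h : N.1 ≤ M.1),
    PIndexQuotient.transition h (x N) = x M}
  mul_mem' hx hy N M h := by
    rw [Pi.mul_apply, Pi.mul_apply, map_mul, hx N M h, hy N M h]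
  one_mem' N M h := by
    rw [Pi.one_apply, Pi.one_apply, map_one]
  inv_mem' hx N M h := by
    rw [Pi.inv_apply, Pi.inv_apply, map_inv, hx N M h]

/-- The free pro-`p`-group `F_n`, a topological group with the topology induced from the product. -/
abbrev FreeProP (p n : ℕ) : Type := freeProPSubgroup p n

/-! ### Constructions with quotients of `F_n` -/

section Presentation

variable (p n : ℕ) (G : Type*) [Group G] [TopologicalSpace G]

open Classical in
/-- A chosen surjective continuous homomorphism `F_n → G`, where one exists. -/
noncomputable def presentation : FreeProP p n →* G :=
  if h : ∃ φ : FreeProP p n →ₜ* G, Function.Surjective φ then (h.choose : FreeProP p n →* G) else 1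

/-- The kernel `N` of the chosen presentation `F_n / N ≅ G`. -/
noncomputable def relSubgroup : Subgroup (FreeProP p n) := (presentation p n G).ker

instance relSubgroup_normal : (relSubgroup p n G).Normal :=
  inferInstanceAs (presentation p n G).ker.Normal

variable {p n} in
/-- The subgroup `E(G)` of `G` that is associated to a characteristic subgroup `E` of `F_n`, for a
pro-`p`-group `G` with `d(G) ≤ n`: the image of `E` under a surjection `F_n → G`. -/
noncomputable def charSubgroup (E : Subgroup (FreeProP p n)) : Subgroup G :=
  E.map (presentation p n G)

variable {p n} in
/-- The minimal number `r_E(G)` of relations of `G ≅ F_n / N` as a quotient of `F_n / E`, that is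
the dimension of `Rel_E(G) = N / E N^*`, is equal to `r`. (Includes `E ⊆ N`, or `E(G) = 1`.) -/
def HasRelRank (E : Subgroup (FreeProP p n)) (r : ℕ) : Prop :=
  HasQuotientDim p (relSubgroup p n G) (E ⊔ relFrattini p (relSubgroup p n G)) r

/-- The `p`-multiplicator rank `μ(G)`, that is the dimension of `N / N^*` for `G ≅ F_n / N` with
`n = d(G)`, is equal to `m`. -/
def HasMultiplicatorRank (m : ℕ) : Prop :=
  HasQuotientDim p (relSubgroup p n G) (relFrattini p (relSubgroup p n G)) m

/-- The `p`-cover `G^* = F_n / N^*` of a finite `p`-group `G ≅ F_n / N` with `n = d(G)`. -/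
abbrev PCover : Type := FreeProP p n ⧸ relFrattini p (relSubgroup p n G)

end Presentation

/-! ### Weak Schur `σ`-groups -/

/-- Pro-`p`-groups. -/
structure IsProPGroup (p : ℕ) (G : Type*) [Group G] [TopologicalSpace G]
    [IsTopologicalGroup G] : Prop where
  compactSpace : CompactSpace G
  totallyDisconnectedSpace : TotallyDisconnectedSpace G
  index_eq : ∀ N : Subgroup G, N.Normal → IsOpen (N : Set G) → ∃ k : ℕ, N.index = p ^ k

section Cohomology

variable (p : ℕ) (G : Type) [Group G] [TopologicalSpace G] [IsTopologicalGroup G]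

/-- `𝔽_p` with the trivial action of `G`. -/
noncomputable abbrev trivialFp : TopRep (ZMod p) G :=
  TopRep.of (ContRepresentation.trivial (ZMod p) G (ZMod p))

/-- The continuous cohomology group `H^i(G, 𝔽_p)`. -/
noncomputable abbrev CohomFp (i : ℕ) : Type :=
  (continuousCohomology i (trivialFp p G) : TopModuleCat (ZMod p))

variable {G} in
/-- The identity of `𝔽_p`, as an equivariant map along a homomorphism `G → G`. -/
noncomputable def trivialFpRes (φ : G →ₜ* G) :
    TopRep.res (φ : G →* G) (trivialFp p G) ⟶ trivialFp p G :=
  TopRep.ofHom ⟨ContinuousLinearMap.id (ZMod p) (ZMod p), fun _ => rfl⟩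

variable {G} in
/-- The action on `H^i(G, 𝔽_p)` induced by an automorphism of `G`. -/
noncomputable def cohomFpAction (σ : G ≃ₜ* G) (i : ℕ) : CohomFp p G i → CohomFp p G i :=
  ContinuousCohomology.map (σ : G →ₜ* G) (trivialFpRes p (σ : G →ₜ* G)) i

end Cohomology

/-- A weak Schur `σ`-group: a pro-`p`-group `G` with an action of the group `{1, σ}` of order two
such that `dim H^2(G, 𝔽_p) ≤ dim H^1(G, 𝔽_p) < ∞` and `σ` acts by `-1` on both spaces. -/
structure IsWeakSchurSigmaGroup (p : ℕ) (G : Type) [Group G] [TopologicalSpace G]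
    [IsTopologicalGroup G] (σ : G ≃ₜ* G) : Prop where
  isProPGroup : IsProPGroup p G
  involutive : Function.Involutive σ
  finite_H1 : Module.Finite (ZMod p) (CohomFp p G 1)
  rank_H2_le : Module.rank (ZMod p) (CohomFp p G 2) ≤ Module.rank (ZMod p) (CohomFp p G 1)
  odd_H1 : ∀ c : CohomFp p G 1, cohomFpAction p σ 1 c = -c
  odd_H2 : ∀ c : CohomFp p G 2, cohomFpAction p σ 2 c = -c

/-- Schur `E`-quotients: `H ≅ G / E(G)` for some weak Schur `σ`-group `G` with `d(G) = n`. -/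
def IsSchurQuotient {p n : ℕ} (E : Subgroup (FreeProP p n)) (H : Type*) [Group H] : Prop :=
  ∃ (G : Type) (_ : Group G) (_ : TopologicalSpace G) (_ : IsTopologicalGroup G) (σ : G ≃ₜ* G),
    IsWeakSchurSigmaGroup p G σ ∧ genRank G = n ∧
      ∃ π : G →* H, Function.Surjective π ∧ π.ker = charSubgroup G E

/-- `K` has an action of a group `{1, σ}` of order two for which `K` is generated by odd elements,
that is by elements `a` with `σ a = a⁻¹`. -/
def HasOddGeneration (K : Type*) [Group K] : Prop :=
  ∃ σ : K ≃* K, Function.Involutive σ ∧ Subgroup.closure {a : K | σ a = a⁻¹} = ⊤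

/-! Write `F` for the free pro-`p`-group, and let `L` be the kernel of a surjection `θ : F → K`, so
that `M = D L` is the kernel of `F → H`. If `E(K) = 1`, then `E ⊆ L`, and `D^* ⊆ E` gives `M^* ⊆ L
D^* = L`. The steps of the chain `M^* ⊆ E M^* ⊆ L ⊆ M` have dimensions `dim E(H^*)`, `dim L / E M^*`
and `dim Ker(K → H)`, with sum `μ(H)`. Hence (c') says exactly that `dim L / E M^* = n`
(`dimensions_of_presentation`). The hypothesis on `r_D(H)` says `dim M / D M^* = n`, and `L / E M^*`
maps onto `M / D M^*` because `M = D L`.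

The link with cohomology is transgression. Let `G = F / R` with `R` in the Frattini subgroup. A
continuous function on `F` that is additive along `R` defines a class in `H^2(G, 𝔽_p)`. The class
vanishes if and only if the function vanishes on `R` (`transgression_eq_zero`,
`transgression_eq_zero_of_ker`), and all classes arise because continuous 2-cocycles of `F` split
(`freeProP_cocycle_split`). This is compatible with automorphisms. Since `p` is odd, a weak Schur
`σ`-group has a presentation in which `σ` lifts to the automorphism `invAut` inverting the free
generators (`exists_equivariant_presentation`).

Necessity: if `K = G / E(G)`, then `L = E R`, and the functionals on `L / E M^*` transgress
injectively, so `dim L / E M^* ≤ dim H^2 ≤ dim H^1 = n`; the surjection onto `M / D M^*` gives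
equality. The images of the free generators are odd generators of `K`.

Sufficiency: by (b) one may take `θ` equivariant. The inversion acts by `-1` on `M / D M^*`: this
holds for the presentation coming from a weak Schur group above `H`, and the two presentations of
`H` differ by an automorphism of `F`. Conjugating the inversion by it changes it by an automorphism
trivial modulo the Frattini subgroup, which acts unipotently and so cannot invert a nontrivial
element of a finite `p`-quotient (`mem_of_apply_mul_mem`,
`IsWeakSchurSigmaGroup.invAut_mul_mem_sup`). By (c') the map `L / E M^* → M / D M^*` is bijective,
so the action on `L / E M^*` is also by `-1`, and `L / E M^*` is generated by `n` odd elements of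
`F` (`exists_odd_relations`). With `N` their closed normal closure, `F / N` is a weak Schur
`σ`-group (`exists_weakSchurSigmaGroup`), and a Nakayama argument gives `L = N E`, that is `K = G /
E(G)` for `G = F / N` (`isSchurQuotient_of_relIndex`). -/

/-! ### Cocycles and homology classes of complexes of topological modules -/

section CocycleClass

open CategoryTheory

variable {k : Type*} [Ring k] [TopologicalSpace k]

lemma TopModuleCat.surjective_of_epi {M N : TopModuleCat k} (f : M ⟶ N) [Epi f] :
    Function.Surjective f.hom :=
  (ModuleCat.epi_iff_surjective ((forget₂ (TopModuleCat k) (ModuleCat k)).map f)).1 inferInstance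

lemma TopModuleCat.injective_of_mono {M N : TopModuleCat k} (f : M ⟶ N) [Mono f] :
    Function.Injective f.hom :=
  (ModuleCat.mono_iff_injective ((forget₂ (TopModuleCat k) (ModuleCat k)).map f)).1 inferInstance

/-- The map from the kernel of a differential to the homology of a complex of topological
modules. -/
noncomputable def cocycleClass (K : CochainComplex (TopModuleCat k) ℕ) (i : ℕ) :
    TopModuleCat.ker (K.d i (i + 1)) ⟶ K.homology i :=
  K.liftCycles (TopModuleCat.kerι (K.d i (i + 1))) (i + 1) (by simp) (by simp) ≫ K.homologyπ i

lemma cocycleClass_surjective (K : CochainComplex (TopModuleCat k) ℕ) (i : ℕ) :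
    Function.Surjective (cocycleClass K i).hom := by
  intro c
  obtain ⟨z, rfl⟩ := TopModuleCat.surjective_of_epi (K.homologyπ i) c
  have hz : (K.iCycles i).hom z ∈ (K.d i (i + 1)).hom.ker := by
    change (K.iCycles i ≫ K.d i (i + 1)).hom z = 0
    simp
  refine ⟨⟨_, hz⟩, ?_⟩
  have : (K.liftCycles (TopModuleCat.kerι (K.d i (i + 1))) (i + 1) (by simp) (by simp)).hom
      ⟨_, hz⟩ = z := by
    apply TopModuleCat.injective_of_mono (K.iCycles i)
    exact congr($(K.liftCycles_i (TopModuleCat.kerι (K.d i (i + 1))) (i + 1) (by simp)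
      (by simp)).hom ⟨_, hz⟩)
  exact congr((K.homologyπ i).hom $this)

/-- Homology is a cokernel of `toCycles` in the abstract sense; comparing it with the concrete
quotient module turns vanishing of a class into membership in a range. -/
lemma cocycleClass_eq_zero_iff (K : CochainComplex (TopModuleCat k) ℕ) (i : ℕ)
    (z : (K.d (i + 1) (i + 1 + 1)).hom.ker) :
    (cocycleClass K (i + 1)).hom z = 0 ↔ ∃ y : K.X i, (K.d i (i + 1)).hom y = z.1 := by
  set l := K.liftCycles (TopModuleCat.kerι (K.d (i + 1) (i + 1 + 1))) (i + 1 + 1) (by simp)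
    (by simp) with hl
  have hli : ∀ w, (K.iCycles (i + 1)).hom (l.hom w) = w.1 := fun w =>
    congr($(K.liftCycles_i (TopModuleCat.kerι (K.d (i + 1) (i + 1 + 1))) (i + 1 + 1) (by simp)
      (by simp)).hom w)
  have hti : ∀ y, (K.iCycles (i + 1)).hom ((K.toCycles i (i + 1)).hom y) =
      (K.d i (i + 1)).hom y := fun y => congr($(K.toCycles_i i (i + 1)).hom y)
  constructor
  · intro h
    let e := (K.homologyIsCokernel i (i + 1) (by simp)).desc
      (Limits.CokernelCofork.ofπ (TopModuleCat.cokerπ (K.toCycles i (i + 1)))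
        (TopModuleCat.comp_cokerπ _))
    have he : K.homologyπ (i + 1) ≫ e = TopModuleCat.cokerπ (K.toCycles i (i + 1)) :=
      (K.homologyIsCokernel i (i + 1) (by simp)).fac _ Limits.WalkingParallelPair.one
    have h2 : (TopModuleCat.cokerπ (K.toCycles i (i + 1))).hom (l.hom z) = 0 := by
      rw [← he]
      change e.hom ((cocycleClass K (i + 1)).hom z) = 0
      rw [h, map_zero]
    rw [TopModuleCat.hom_cokerπ, Submodule.mkQ_apply, Submodule.Quotient.mk_eq_zero] at h2
    obtain ⟨y, hy⟩ := h2
    refine ⟨y, ?_⟩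
    rw [← hti, ← hli]
    exact congr((K.iCycles (i + 1)).hom $hy)
  · rintro ⟨y, hy⟩
    have h2 : l.hom z = (K.toCycles i (i + 1)).hom y := by
      apply TopModuleCat.injective_of_mono (K.iCycles (i + 1))
      rw [hti, hli, hy]
    change (K.homologyπ (i + 1)).hom (l.hom z) = 0
    rw [h2]
    exact congr($(K.toCycles_comp_homologyπ i (i + 1)).hom y)

/-- This is what allows the action of an automorphism on cohomology to be computed on explicit
cocycles. -/
lemma homologyMap_cocycleClass {K L : CochainComplex (TopModuleCat k) ℕ} (f : K ⟶ L) (i : ℕ)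
    (z : (K.d i (i + 1)).hom.ker) (w : (L.d i (i + 1)).hom.ker) (h : (f.f i).hom z.1 = w.1) :
    (HomologicalComplex.homologyMap f i).hom ((cocycleClass K i).hom z) =
      (cocycleClass L i).hom w := by
  have h1 : ∀ x, (HomologicalComplex.homologyMap f i).hom ((K.homologyπ i).hom x) =
      (L.homologyπ i).hom ((HomologicalComplex.cyclesMap f i).hom x) := fun x =>
    congr($(HomologicalComplex.homologyπ_naturality f i).hom x)
  refine (h1 _).trans (congrArg (L.homologyπ i).hom ?_)
  apply TopModuleCat.injective_of_mono (L.iCycles i)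
  refine (congr($(HomologicalComplex.cyclesMap_i f i).hom _)).trans ?_
  refine Eq.trans ?_ (congr($(L.liftCycles_i (TopModuleCat.kerι (L.d i (i + 1))) (i + 1) (by simp)
      (by simp)).hom w)).symm
  refine Eq.trans ?_ h
  exact congrArg (f.f i).hom (congr($(K.liftCycles_i (TopModuleCat.kerι (K.d i (i + 1))) (i + 1)
    (by simp) (by simp)).hom z))

end CocycleClass

/-! ### Homogeneous cochains with trivial coefficients -/

section TrivialCoefficients

open CategoryTheory

open TopRep

variable (p : ℕ) {G : Type} [Group G] [TopologicalSpace G] [IsTopologicalGroup G]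

/-- The index of `resolutionX` counts variables, so it is one more than the cohomological degree of
the homogeneous cochain. -/
lemma mem_invariants_one_iff {f : C(G, ZMod p)} :
    f ∈ (resolutionX (trivialFp p G) 1).ρ.invariants ↔ ∀ g a, f (g * a) = f a := by
  constructor
  · intro hf g a
    have h := DFunLike.congr_fun (hf g) (g * a)
    simp at h
    exact h.symm
  · intro h g
    ext a
    exact (h g⁻¹ a)

lemma mem_invariants_two_iff {f : C(G, C(G, ZMod p))} :
    f ∈ (resolutionX (trivialFp p G) 2).ρ.invariants ↔
      ∀ g a b, f (g * a) (g * b) = f a b := by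
  constructor
  · intro hf g a b
    have h := DFunLike.congr_fun (DFunLike.congr_fun (hf g) (g * a)) (g * b)
    simp at h
    exact h.symm
  · intro h g
    ext a b
    exact (h g⁻¹ a b)

lemma mem_invariants_three_iff {f : C(G, C(G, C(G, ZMod p)))} :
    f ∈ (resolutionX (trivialFp p G) 3).ρ.invariants ↔
      ∀ g a b c, f (g * a) (g * b) (g * c) = f a b c := by
  constructor
  · intro hf g a b c
    have h := DFunLike.congr_fun (DFunLike.congr_fun (DFunLike.congr_fun (hf g) (g * a))
      (g * b)) (g * c)
    simp at h
    exact h.symm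
  · intro h g
    ext a b c
    exact (h g⁻¹ a b c)

lemma resolution_d_one_apply (f : C(G, ZMod p)) (a b : G) :
    ((d (trivialFp p G) 1).hom f : C(G, C(G, ZMod p))) a b = f b - f a := rfl

end TrivialCoefficients

/-! ### Degree one: continuous homomorphisms to `𝔽_p` -/

section LowDegree

open CategoryTheory

open TopRep

variable (p : ℕ) {G : Type} [Group G] [TopologicalSpace G] [IsTopologicalGroup G]

/-- The continuous homomorphisms `G → 𝔽_p`. -/
def contHom (G : Type*) [Group G] [TopologicalSpace G] : Submodule (ZMod p) C(G, ZMod p) where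
  carrier := {f | ∀ x y, f (x * y) = f x + f y}
  add_mem' {f g} hf hg x y := by
    simp only [ContinuousMap.add_apply, hf x y, hg x y]; abel
  zero_mem' x y := by simp
  smul_mem' c f hf x y := by simp only [ContinuousMap.smul_apply, hf x y, smul_add]

variable {p} in
lemma contHom_one {G : Type*} [Group G] [TopologicalSpace G] {f : C(G, ZMod p)}
    (hf : f ∈ contHom p G) : f 1 = 0 := by
  simpa using hf 1 1

variable {p} in
lemma contHom_inv {G : Type*} [Group G] [TopologicalSpace G] {f : C(G, ZMod p)}
    (hf : f ∈ contHom p G) (x : G) : f x⁻¹ = - f x := by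
  have := hf x x⁻¹
  rw [mul_inv_cancel, contHom_one hf] at this
  exact (neg_eq_of_add_eq_zero_right this.symm).symm

/-- The kernel of the differential on homogeneous cochains of degree `i`. -/
noncomputable abbrev cocycleKer (G : Type) [Group G] [TopologicalSpace G] [IsTopologicalGroup G]
    (i : ℕ) :=
  ((homogeneousCochains (trivialFp p G)).d i (i + 1)).hom.ker

/-- The homogeneous `1`-cochain of a function. -/
def cochainOne (f : C(G, ZMod p)) : C(G, C(G, ZMod p)) :=
  ContinuousMap.curry ⟨fun q : G × G => f (q.1⁻¹ * q.2), by fun_prop⟩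

@[simp] lemma cochainOne_apply (f : C(G, ZMod p)) (a b : G) :
    cochainOne p f a b = f (a⁻¹ * b) := rfl

lemma mem_cocycleKer_one (z : (homogeneousCochains (trivialFp p G)).X 1) :
    z ∈ cocycleKer p G 1 ↔ ∀ a b c : G, (z.1 : C(G, C(G, ZMod p))) b c -
      ((z.1 : C(G, C(G, ZMod p))) a c - (z.1 : C(G, C(G, ZMod p))) a b) = 0 := by
  constructor
  · intro h a b c
    have h1 := (homogeneousCochains.d_apply _ 1 z).symm.trans (congrArg Subtype.val h)
    exact DFunLike.congr_fun (DFunLike.congr_fun (DFunLike.congr_fun h1 a) b) c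
  · intro h
    refine Subtype.ext ((homogeneousCochains.d_apply _ 1 z).trans ?_)
    exact ContinuousMap.ext fun a => ContinuousMap.ext fun b => ContinuousMap.ext fun c => h a b c

lemma mem_cocycleKer_two (z : (homogeneousCochains (trivialFp p G)).X 2) :
    z ∈ cocycleKer p G 2 ↔ ∀ a b c e : G, (z.1 : C(G, C(G, C(G, ZMod p)))) b c e -
      ((z.1 : C(G, C(G, C(G, ZMod p)))) a c e -
      ((z.1 : C(G, C(G, C(G, ZMod p)))) a b e - (z.1 : C(G, C(G, C(G, ZMod p)))) a b c)) = 0 := by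
  constructor
  · intro h a b c e
    have h1 := (homogeneousCochains.d_apply _ 2 z).symm.trans (congrArg Subtype.val h)
    exact DFunLike.congr_fun (DFunLike.congr_fun (DFunLike.congr_fun
      (DFunLike.congr_fun h1 a) b) c) e
  · intro h
    refine Subtype.ext ((homogeneousCochains.d_apply _ 2 z).trans ?_)
    exact ContinuousMap.ext fun a => ContinuousMap.ext fun b => ContinuousMap.ext fun c =>
      ContinuousMap.ext fun e => h a b c e

/-- The `1`-cocycle of a homomorphism to `𝔽_p`. -/
def homCocycle : contHom p G →ₗ[ZMod p] cocycleKer p G 1 where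
  toFun f := ⟨⟨cochainOne p f.1, (mem_invariants_two_iff p).2 fun g a b => by
    simp only [cochainOne_apply, mul_inv_rev, mul_inv_mul_mul_cancel]⟩,
    (mem_cocycleKer_one p _).2 fun a b c => by
    change f.1 (b⁻¹ * c) - (f.1 (a⁻¹ * c) - f.1 (a⁻¹ * b)) = 0
    have h : (a⁻¹ * c : G) = (a⁻¹ * b) * (b⁻¹ * c) := by group
    rw [h, f.2 (a⁻¹ * b)]
    ring⟩
  map_add' _ _ := rfl
  map_smul' _ _ := rfl

/-- The isomorphism `Hom(G, 𝔽_p) ≅ H^1(G, 𝔽_p)`. -/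
noncomputable def homEquivH1 : contHom p G ≃ₗ[ZMod p] CohomFp p G 1 :=
  LinearEquiv.ofBijective
    ((cocycleClass (homogeneousCochains (trivialFp p G)) 1).hom.toLinearMap ∘ₗ homCocycle p) <| by
  constructor
  · rw [← LinearMap.ker_eq_bot, LinearMap.ker_eq_bot']
    intro f hf
    obtain ⟨y, hy⟩ := (cocycleClass_eq_zero_iff _ 0 _).1 hf
    ext x
    -- An invariant cochain of degree zero is constant, so its coboundary vanishes.
    have h1 : (y.1 : C(G, ZMod p)) x = (y.1 : C(G, ZMod p)) 1 := by
      simpa using (mem_invariants_one_iff p).1 y.2 x 1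
    have h2 := DFunLike.congr_fun (DFunLike.congr_fun (congrArg Subtype.val hy) (1 : G)) x
    rw [homogeneousCochains.d_apply] at h2
    have h3 := (resolution_d_one_apply p y.1 1 x).symm.trans h2
    rw [h1, sub_self] at h3
    have h4 : (0 : ZMod p) = f.1 (1⁻¹ * x) := h3
    rw [inv_one, one_mul] at h4
    exact h4.symm
  · intro c
    obtain ⟨z, rfl⟩ := cocycleClass_surjective _ _ c
    have hz := (mem_cocycleKer_one p z.1).1 z.2
    have hi := (mem_invariants_two_iff p).1 z.1.2
    -- Dehomogenization: fixing the first argument at `1` turns the cocycle condition into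
    -- additivity.
    refine ⟨⟨(z.1.1 : C(G, C(G, ZMod p))) 1, fun x y => ?_⟩, ?_⟩
    · have h := hz 1 x (x * y)
      have h2 := hi x 1 y
      rw [mul_one] at h2
      rw [h2] at h
      linear_combination -h
    · refine congrArg (cocycleClass (homogeneousCochains (trivialFp p G)) 1).hom
        (Subtype.ext (Subtype.ext (ContinuousMap.ext fun a =>
        ContinuousMap.ext fun b => ?_)))
      have := hi a⁻¹ a b
      rw [inv_mul_cancel] at this
      exact this

lemma cohomFpAction_homEquivH1 (σ : G ≃ₜ* G) (f f' : contHom p G)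
    (h : ∀ x, f.1 (σ x) = f'.1 x) :
    cohomFpAction p σ 1 (homEquivH1 p f) = homEquivH1 p f' := by
  refine homologyMap_cocycleClass _ _ _ _ ?_
  refine Subtype.ext (ContinuousMap.ext fun a => ContinuousMap.ext fun b => ?_)
  change f.1 ((σ a)⁻¹ * σ b) = f'.1 (a⁻¹ * b)
  rw [← h, map_mul σ, map_inv σ]

end LowDegree

/-! ### Degree two: transgression along a surjection `F → G` -/

section Transgression

open CategoryTheory

set_option linter.unusedSectionVars false

open TopRep

variable (p : ℕ) {F G : Type} [Group F] [TopologicalSpace F] [IsTopologicalGroup F]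
  [Group G] [TopologicalSpace G] [IsTopologicalGroup G]

/-- The continuous functions on `F` that are additive with respect to multiplication by elements
of the kernel of `φ : F → G`, from either side. -/
def kerAdditive (φ : F →ₜ* G) : Submodule (ZMod p) C(F, ZMod p) where
  carrier := {b | ∀ x r, φ r = 1 → b (x * r) = b x + b r ∧ b (r * x) = b r + b x}
  add_mem' {b c} hb hc x r hr := by
    simp only [ContinuousMap.add_apply, (hb x r hr).1, (hc x r hr).1, (hb x r hr).2,
      (hc x r hr).2]
    constructor <;> abel
  zero_mem' x r hr := by simp
  smul_mem' a b hb x r hr := by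
    simp only [ContinuousMap.smul_apply, (hb x r hr).1, (hb x r hr).2, smul_add, and_self]

variable {p}

lemma kerAdditive_one {φ : F →ₜ* G} {b : C(F, ZMod p)} (hb : b ∈ kerAdditive p φ) : b 1 = 0 := by
  simpa using (hb 1 1 (map_one φ)).1

lemma kerAdditive_inv {φ : F →ₜ* G} {b : C(F, ZMod p)} (hb : b ∈ kerAdditive p φ) {r : F}
    (hr : φ r = 1) : b r⁻¹ = - b r := by
  have := (hb r⁻¹ r hr).1
  rw [inv_mul_cancel, kerAdditive_one hb] at this
  exact (neg_eq_of_add_eq_zero_left this.symm).symm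

/-- The triples of elements of `F`, mapped to triples of elements of `G`. -/
def tripleMap (φ : F →ₜ* G) : C((F × F) × F, (G × G) × G) :=
  ⟨Prod.map (Prod.map φ φ) φ, by fun_prop⟩

/-- The homogeneous `2`-coboundary of a function on `F`. -/
def coboundaryTriple (b : C(F, ZMod p)) : C((F × F) × F, ZMod p) :=
  ⟨fun t => b (t.1.2⁻¹ * t.2) - b (t.1.1⁻¹ * t.2) + b (t.1.1⁻¹ * t.1.2), by fun_prop⟩

/-- Changing the three arguments by kernel elements `u`, `v`, `w` changes each term by a difference
of two of `b u`, `b v`, `b w`, and the alternating sum of these cancels. Hence the coboundary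
descends to `G` although `b` does not. -/
lemma coboundaryTriple_eq {φ : F →ₜ* G} {b : C(F, ZMod p)} (hb : b ∈ kerAdditive p φ)
    {s t : (F × F) × F} (h : tripleMap φ s = tripleMap φ t) :
    coboundaryTriple b s = coboundaryTriple b t := by
  obtain ⟨⟨x, y⟩, z⟩ := s
  obtain ⟨⟨x', y'⟩, z'⟩ := t
  simp only [tripleMap, ContinuousMap.coe_mk, Prod.map_apply, Prod.mk.injEq] at h
  obtain ⟨⟨hx, hy⟩, hz⟩ := h
  obtain ⟨u, hu, rfl⟩ : ∃ u, φ u = 1 ∧ x' = x * u := ⟨x⁻¹ * x', by simp [hx], by simp⟩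
  obtain ⟨v, hv, rfl⟩ : ∃ u, φ u = 1 ∧ y' = y * u := ⟨y⁻¹ * y', by simp [hy], by simp⟩
  obtain ⟨w, hw, rfl⟩ : ∃ u, φ u = 1 ∧ z' = z * u := ⟨z⁻¹ * z', by simp [hz], by simp⟩
  have hu' : φ u⁻¹ = 1 := by simp [hu]
  have hv' : φ v⁻¹ = 1 := by simp [hv]
  have key : ∀ a c d e : F, φ d = 1 → φ e = 1 →
      b ((a * d)⁻¹ * (c * e)) = b (a⁻¹ * c) - b d + b e := by
    intro a c d e hd he
    have h1 : (a * d)⁻¹ * (c * e) = d⁻¹ * (a⁻¹ * c * e) := by group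
    rw [h1, (hb _ d⁻¹ (by simp [hd])).2, (hb _ e he).1, kerAdditive_inv hb hd]
    ring
  simp only [coboundaryTriple, ContinuousMap.coe_mk]
  rw [key _ _ _ _ hv hw, key _ _ _ _ hu hw, key _ _ _ _ hu hv]
  ring

variable (φ : F →ₜ* G) (hφ : Topology.IsQuotientMap (tripleMap φ))

include hφ in
lemma surjective_of_tripleMap : Function.Surjective φ := fun g => by
  obtain ⟨t, ht⟩ := hφ.surjective ((g, g), g)
  exact ⟨t.2, congrArg Prod.snd ht⟩

/-- The `2`-cochain on `G` with the given inflation to `F`. -/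
noncomputable def transgressionFun (b : kerAdditive p φ) : C(G, C(G, C(G, ZMod p))) :=
  (hφ.lift (coboundaryTriple b.1) fun _ _ h => coboundaryTriple_eq b.2 h).curry.curry

lemma transgressionFun_apply (b : kerAdditive p φ) (x y z : F) :
    transgressionFun φ hφ b (φ x) (φ y) (φ z) =
      b.1 (y⁻¹ * z) - b.1 (x⁻¹ * z) + b.1 (x⁻¹ * y) :=
  congr($(hφ.lift_comp (coboundaryTriple b.1) fun _ _ h => coboundaryTriple_eq b.2 h)
    ((x, y), z))

include hφ in
lemma cochain_ext_of_surjective {Y Z : C(G, C(G, C(G, ZMod p)))}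
    (h : ∀ x y z, Y (φ x) (φ y) (φ z) = Z (φ x) (φ y) (φ z)) : Y = Z := by
  refine ContinuousMap.ext fun x => ContinuousMap.ext fun y => ContinuousMap.ext fun z => ?_
  obtain ⟨x, rfl⟩ := surjective_of_tripleMap φ hφ x
  obtain ⟨y, rfl⟩ := surjective_of_tripleMap φ hφ y
  obtain ⟨z, rfl⟩ := surjective_of_tripleMap φ hφ z
  exact h x y z

/-- The `2`-cochains on `G` that become coboundaries on `F`, as a linear map. -/
noncomputable def transgressionCochain : kerAdditive p φ →ₗ[ZMod p] C(G, C(G, C(G, ZMod p))) where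
  toFun := transgressionFun φ hφ
  map_add' b b' := cochain_ext_of_surjective φ hφ fun x y z => by
    simp only [ContinuousMap.add_apply, transgressionFun_apply, Submodule.coe_add]
    ring
  map_smul' a b := cochain_ext_of_surjective φ hφ fun x y z => by
    simp only [ContinuousMap.smul_apply, transgressionFun_apply, Submodule.coe_smul,
      RingHom.id_apply, smul_eq_mul]
    ring

lemma transgressionCochain_apply (b : kerAdditive p φ) (x y z : F) :
    transgressionCochain φ hφ b (φ x) (φ y) (φ z) =
      b.1 (y⁻¹ * z) - b.1 (x⁻¹ * z) + b.1 (x⁻¹ * y) :=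
  transgressionFun_apply φ hφ b x y z

lemma transgressionCochain_mem_invariants (b : kerAdditive p φ) :
    transgressionCochain φ hφ b ∈ (resolutionX (trivialFp p G) 3).ρ.invariants := by
  refine (mem_invariants_three_iff p).2 fun g a b' c => ?_
  obtain ⟨g, rfl⟩ := surjective_of_tripleMap φ hφ g
  obtain ⟨a, rfl⟩ := surjective_of_tripleMap φ hφ a
  obtain ⟨b', rfl⟩ := surjective_of_tripleMap φ hφ b'
  obtain ⟨c, rfl⟩ := surjective_of_tripleMap φ hφ c
  rw [← map_mul φ, ← map_mul φ, ← map_mul φ, transgressionCochain_apply,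
    transgressionCochain_apply]
  simp only [mul_inv_rev, mul_inv_mul_mul_cancel]

lemma transgressionCochain_mem_cocycleKer (b : kerAdditive p φ) :
    (⟨transgressionCochain φ hφ b, transgressionCochain_mem_invariants φ hφ b⟩ :
      (homogeneousCochains (trivialFp p G)).X 2) ∈ cocycleKer p G 2 := by
  refine (mem_cocycleKer_two p _).2 fun a b' c e => ?_
  obtain ⟨a, rfl⟩ := surjective_of_tripleMap φ hφ a
  obtain ⟨b', rfl⟩ := surjective_of_tripleMap φ hφ b'
  obtain ⟨c, rfl⟩ := surjective_of_tripleMap φ hφ c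
  obtain ⟨e, rfl⟩ := surjective_of_tripleMap φ hφ e
  change transgressionCochain φ hφ b (φ b') (φ c) (φ e) -
    (transgressionCochain φ hφ b (φ a) (φ c) (φ e) -
    (transgressionCochain φ hφ b (φ a) (φ b') (φ e) -
      transgressionCochain φ hφ b (φ a) (φ b') (φ c))) = 0
  simp only [transgressionCochain_apply]
  ring

/-- The `2`-cocycle on `G` of a function on `F`. -/
noncomputable def transgressionCocycle : kerAdditive p φ →ₗ[ZMod p] cocycleKer p G 2 where
  toFun b := ⟨⟨transgressionCochain φ hφ b, transgressionCochain_mem_invariants φ hφ b⟩,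
    transgressionCochain_mem_cocycleKer φ hφ b⟩
  map_add' b b' := Subtype.ext (Subtype.ext (map_add (transgressionCochain φ hφ) b b'))
  map_smul' a b := Subtype.ext (Subtype.ext (map_smul (transgressionCochain φ hφ) a b))

/-- The class in `H^2(G, 𝔽_p)` of a function on `F`. -/
noncomputable def transgression : kerAdditive p φ →ₗ[ZMod p] CohomFp p G 2 :=
  (cocycleClass (homogeneousCochains (trivialFp p G)) 2).hom.toLinearMap ∘ₗ
    transgressionCocycle φ hφ

/-- If the class is the coboundary of `Y`, then `b` minus the inflation of `Y 1` is a homomorphism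
on `F`. It vanishes on the kernel by `hker`, where the inflated function takes the constant value `Y
1 1 = 0`; so `b` vanishes there as well. -/
lemma transgression_eq_zero (hker : ∀ f ∈ contHom p F, ∀ r, φ r = 1 → f r = 0)
    {b : kerAdditive p φ} (hb : transgression φ hφ b = 0) {r : F} (hr : φ r = 1) : b.1 r = 0 := by
  obtain ⟨y, hy⟩ := (cocycleClass_eq_zero_iff _ 1 _).1 hb
  let Y : C(G, C(G, ZMod p)) := y.1
  have hi : ∀ g a b, Y (g * a) (g * b) = Y a b := (mem_invariants_two_iff p).1 y.2
  have h1 := (homogeneousCochains.d_apply _ 1 y).symm.trans (congrArg Subtype.val hy)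
  have h2 : ∀ u v w : F, Y (φ v) (φ w) - (Y (φ u) (φ w) - Y (φ u) (φ v)) =
      b.1 (v⁻¹ * w) - b.1 (u⁻¹ * w) + b.1 (u⁻¹ * v) := fun u v w =>
    (DFunLike.congr_fun (DFunLike.congr_fun (DFunLike.congr_fun h1 (φ u)) (φ v)) (φ w)).trans
      (transgressionCochain_apply φ hφ b u v w)
  let f : C(F, ZMod p) := b.1 - (Y 1).comp ⟨φ, φ.continuous⟩
  have hfa : ∀ x, f x = b.1 x - Y 1 (φ x) := fun x => rfl
  have hf : f ∈ contHom p F := fun u v => by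
    have h3 := h2 1 u (u * v)
    have h4 := hi (φ u) 1 (φ v)
    rw [mul_one, ← map_mul φ] at h4
    rw [h4, map_one φ] at h3
    simp only [inv_one, one_mul, inv_mul_cancel_left] at h3
    rw [hfa, hfa, hfa]
    linear_combination h3
  have h5 := hker f hf r hr
  have h6 := contHom_one hf
  rw [hfa, hr] at h5
  rw [hfa, map_one φ, kerAdditive_one b.2] at h6
  linear_combination h5 - h6

/-- A 2-cocycle on `G` inflates to one on `F`, which splits by `hsplit`. The splitting function is
additive along the kernel because the normalized inflated cocycle is zero when one argument lies in
the kernel. -/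
lemma transgression_surjective [LocallyCompactSpace G]
    (hsplit : ∀ c : C(F × F, ZMod p), (∀ x, c (x, 1) = 0) → (∀ x, c (1, x) = 0) →
      (∀ x y z, c (x, y) + c (x * y, z) = c (y, z) + c (x, y * z)) →
      ∃ b : C(F, ZMod p), ∀ x y, b (x * y) = b x + b y + c (x, y)) :
    Function.Surjective (transgression (p := p) φ hφ) := by
  intro t
  obtain ⟨z, rfl⟩ := cocycleClass_surjective _ _ t
  let Z : C(G, C(G, C(G, ZMod p))) := z.1.1
  have hz : ∀ a b c e, Z b c e - (Z a c e - (Z a b e - Z a b c)) = 0 :=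
    (mem_cocycleKer_two p z.1).1 z.2
  have hi : ∀ g a b c, Z (g * a) (g * b) (g * c) = Z a b c :=
    (mem_invariants_three_iff p).1 z.1.2
  -- The inhomogeneous cocycle of `-Z`, shifted by `Z 1 1 1` so that it vanishes when one argument
  -- is trivial.
  let c : C(F × F, ZMod p) :=
    ⟨fun q => Z 1 1 1 - Z 1 (φ q.1) (φ (q.1 * q.2)), by
      have h := ((Z 1).uncurry.continuous.comp (g := fun q : G × G => (Z 1).uncurry q)
        (f := fun q : F × F => (φ q.1, φ (q.1 * q.2))) (by fun_prop))
      exact continuous_const.sub h⟩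
  have hc : ∀ x y, c (x, y) = Z 1 1 1 - Z 1 (φ x) (φ x * φ y) := fun x y => by
    rw [← map_mul φ]
    rfl
  have e1 : ∀ a b, Z a b b = Z 1 1 1 := fun a b => by
    have h1 := hz a b b b
    have h2 := hi b 1 1 1
    rw [mul_one] at h2
    rw [← h2]
    linear_combination -h1
  have e2 : ∀ a b, Z a a b = Z 1 1 1 := fun a b => by
    have h1 := hz a a a b
    have h2 := hi a 1 1 1
    rw [mul_one] at h2
    rw [← h2]
    linear_combination h1
  obtain ⟨b, hb⟩ := hsplit c (fun x => by rw [hc, map_one φ, mul_one, e1 1 (φ x), sub_self])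
    (fun x => by rw [hc, map_one φ, one_mul, e2 1 (φ x), sub_self]) (fun x y w => by
      have h1 := hz 1 (φ x) (φ x * φ y) (φ x * φ y * φ w)
      have h2 := hi (φ x) 1 (φ y) (φ y * φ w)
      rw [mul_one, ← mul_assoc] at h2
      rw [h2] at h1
      simp only [hc, map_mul φ, mul_assoc] at h1 ⊢
      linear_combination h1)
  have hbk : b ∈ kerAdditive p φ := fun x r hr => by
    constructor
    · rw [hb, hc, hr, mul_one, e1 1 (φ x), sub_self, add_zero]
    · rw [hb, hc, hr, one_mul, e2 1 (φ x), sub_self, add_zero]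
  refine ⟨⟨b, hbk⟩, ?_⟩
  rw [← sub_eq_zero]
  refine ((cocycleClass (homogeneousCochains (trivialFp p G)) 2).hom.map_sub _ _).symm.trans ?_
  refine (cocycleClass_eq_zero_iff (homogeneousCochains (trivialFp p G)) 1 _).2 ?_
  -- The shift by `Z 1 1 1` in the definition of `c` is the coboundary of a constant cochain.
  refine ⟨⟨ContinuousMap.const G (ContinuousMap.const G (-(Z 1 1 1))),
    (mem_invariants_two_iff p).2 fun _ _ _ => rfl⟩, ?_⟩
  refine Subtype.ext ((homogeneousCochains.d_apply _ 1 _).trans ?_)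
  refine ContinuousMap.ext fun u => ContinuousMap.ext fun v => ContinuousMap.ext fun w => ?_
  obtain ⟨u, rfl⟩ := surjective_of_tripleMap φ hφ u
  obtain ⟨v, rfl⟩ := surjective_of_tripleMap φ hφ v
  obtain ⟨w, rfl⟩ := surjective_of_tripleMap φ hφ w
  change -(Z 1 1 1) - (-(Z 1 1 1) - -(Z 1 1 1)) =
    transgressionCochain φ hφ ⟨b, hbk⟩ (φ u) (φ v) (φ w) - Z (φ u) (φ v) (φ w)
  rw [transgressionCochain_apply]
  have h1 := hb (u⁻¹ * v) (v⁻¹ * w)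
  rw [hc] at h1
  have h2 : u⁻¹ * v * (v⁻¹ * w) = u⁻¹ * w := by group
  have h3 := hi (φ u) 1 (φ (u⁻¹ * v)) (φ (u⁻¹ * v) * φ (v⁻¹ * w))
  have h4 : φ u * φ (u⁻¹ * v) = φ v := by rw [← map_mul φ]; group
  have h5 : φ u * (φ (u⁻¹ * v) * φ (v⁻¹ * w)) = φ w := by rw [← map_mul φ, ← map_mul φ]; group
  rw [mul_one, h4, h5] at h3
  rw [h2, ← h3] at h1
  change _ = b (v⁻¹ * w) - b (u⁻¹ * w) + b (u⁻¹ * v) - _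
  linear_combination h1

lemma cohomFpAction_transgression (σ : G ≃ₜ* G) (τ : F ≃ₜ* F) (hσ : ∀ x, φ (τ x) = σ (φ x))
    (b b' : kerAdditive p φ) (h : ∀ x, b.1 (τ x) = b'.1 x) :
    cohomFpAction p σ 2 (transgression φ hφ b) = transgression φ hφ b' := by
  refine homologyMap_cocycleClass _ _ _ _ ?_
  refine Subtype.ext (ContinuousMap.ext fun u => ContinuousMap.ext fun v =>
    ContinuousMap.ext fun w => ?_)
  obtain ⟨u, rfl⟩ := surjective_of_tripleMap φ hφ u
  obtain ⟨v, rfl⟩ := surjective_of_tripleMap φ hφ v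
  obtain ⟨w, rfl⟩ := surjective_of_tripleMap φ hφ w
  change transgressionCochain φ hφ b (σ (φ u)) (σ (φ v)) (σ (φ w)) =
    transgressionCochain φ hφ b' (φ u) (φ v) (φ w)
  rw [← hσ, ← hσ, ← hσ, transgressionCochain_apply, transgressionCochain_apply]
  simp only [← h, map_mul τ, map_inv τ]

/-- Precomposition with an automorphism. -/
def kerAdditiveComp (σ : G ≃ₜ* G) (τ : F ≃ₜ* F) (hσ : ∀ x, φ (τ x) = σ (φ x))
    (b : kerAdditive p φ) : kerAdditive p φ :=
  ⟨b.1.comp ⟨τ, τ.continuous⟩, fun x r hr => by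
    have h : φ (τ r) = 1 := by rw [hσ, hr, map_one]
    simpa using b.2 (τ x) (τ r) h⟩

end Transgression

/-! ### The operation `N ↦ N^*` and the lower `p`-central series -/

section RelFrattini

open scoped commutatorElement
set_option linter.unusedSectionVars false

variable {p : ℕ} {G : Type*} [Group G] [TopologicalSpace G] [IsTopologicalGroup G]

lemma pow_mem_relFrattini {N : Subgroup G} {x : G} (hx : x ∈ N) : x ^ p ∈ relFrattini p N :=
  Subgroup.le_topologicalClosure _ (Subgroup.mem_sup_left (Subgroup.subset_closure ⟨x, hx, rfl⟩))

lemma commutator_mem_relFrattini {N : Subgroup G} (g : G) {x : G} (hx : x ∈ N) :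
    ⁅g, x⁆ ∈ relFrattini p N :=
  Subgroup.le_topologicalClosure _ (Subgroup.mem_sup_right
    (Subgroup.commutator_mem_commutator (Subgroup.mem_top g) hx))

lemma isClosed_relFrattini (N : Subgroup G) : IsClosed (relFrattini p N : Set G) :=
  Subgroup.isClosed_topologicalClosure _

lemma relFrattini_le {N C : Subgroup G} (hC : IsClosed (C : Set G)) (h1 : ∀ x ∈ N, x ^ p ∈ C)
    (h2 : ∀ g : G, ∀ x ∈ N, ⁅g, x⁆ ∈ C) : relFrattini p N ≤ C := by
  refine Subgroup.topologicalClosure_minimal _ (sup_le ?_ ?_) hC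
  · rw [Subgroup.closure_le]
    rintro _ ⟨x, hx, rfl⟩
    exact h1 x hx
  · rw [Subgroup.commutator_le]
    exact fun g _ x hx => h2 g x hx

lemma relFrattini_mono {N M : Subgroup G} (h : N ≤ M) : relFrattini p N ≤ relFrattini p M :=
  relFrattini_le (isClosed_relFrattini M) (fun _ hx => pow_mem_relFrattini (h hx))
    fun g _ hx => commutator_mem_relFrattini g (h hx)

lemma commutator_mem_of_normal {N : Subgroup G} [hN : N.Normal] (g : G) {x : G} (hx : x ∈ N) :
    ⁅g, x⁆ ∈ N := by
  rw [commutatorElement_def]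
  exact N.mul_mem (hN.conj_mem x hx g) (N.inv_mem hx)

lemma relFrattini_le_self {N : Subgroup G} [hN : N.Normal] (hc : IsClosed (N : Set G)) :
    relFrattini p N ≤ N :=
  relFrattini_le hc (fun _ hx => N.pow_mem hx p) fun g _ hx => commutator_mem_of_normal g hx

/-- By compactness the image of the closed subgroup `N^*` is already closed, so taking closures
commutes with the surjection. -/
lemma map_relFrattini [CompactSpace G] {A : Type*} [Group A] [TopologicalSpace A]
    [IsTopologicalGroup A] [T2Space A] (φ : G →* A) (hφ : Continuous φ)
    (hs : Function.Surjective φ) (N : Subgroup G) :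
    (relFrattini p N).map φ = relFrattini p (N.map φ) := by
  apply le_antisymm
  · rw [Subgroup.map_le_iff_le_comap]
    refine relFrattini_le ((isClosed_relFrattini _).preimage hφ) (fun x hx => ?_) fun g x hx => ?_
    · rw [Subgroup.mem_comap, map_pow]
      exact pow_mem_relFrattini (Subgroup.mem_map_of_mem φ hx)
    · rw [Subgroup.mem_comap, map_commutatorElement]
      exact commutator_mem_relFrattini _ (Subgroup.mem_map_of_mem φ hx)
  · refine relFrattini_le ?_ ?_ ?_
    · exact ((isClosed_relFrattini N).isCompact.image hφ).isClosed
    · rintro _ ⟨x, hx, rfl⟩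
      rw [← map_pow]
      exact Subgroup.mem_map_of_mem φ (pow_mem_relFrattini hx)
    · rintro g _ ⟨x, hx, rfl⟩
      obtain ⟨g, rfl⟩ := hs g
      rw [← map_commutatorElement]
      exact Subgroup.mem_map_of_mem φ (commutator_mem_relFrattini _ hx)

lemma map_lowerPCentral [CompactSpace G] {A : Type*} [Group A] [TopologicalSpace A]
    [IsTopologicalGroup A] [T2Space A] (φ : G →* A) (hφ : Continuous φ)
    (hs : Function.Surjective φ) (j : ℕ) :
    (lowerPCentral p G j).map φ = lowerPCentral p A j := by
  induction j with
  | zero => exact Subgroup.map_top_of_surjective φ hs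
  | succ j ih => rw [lowerPCentral, map_relFrattini φ hφ hs, ih, lowerPCentral]

/-- Inner automorphisms are homeomorphisms. -/
lemma IsTopCharacteristic.normal {E : Subgroup G} (hE : IsTopCharacteristic E) : E.Normal := by
  constructor
  intro x hx g
  let φ : G ≃ₜ* G :=
    { MulAut.conj g with
      continuous_toFun := by
        change Continuous fun x => g * x * g⁻¹
        fun_prop
      continuous_invFun := by
        change Continuous fun x => g⁻¹ * x * g
        fun_prop }
  rw [← hE φ]
  exact ⟨x, hx, rfl⟩

lemma isTopCharacteristic_lowerPCentral [CompactSpace G] [T2Space G] (j : ℕ) :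
    IsTopCharacteristic (lowerPCentral p G j) := fun φ =>
  map_lowerPCentral _ φ.continuous φ.surjective j

lemma IsTopCharacteristic.apply_mem {E : Subgroup G} (hE : IsTopCharacteristic E) (φ : G ≃ₜ* G)
    {x : G} (hx : x ∈ E) : φ x ∈ E := by
  rw [← hE φ]
  exact ⟨x, hx, rfl⟩

/-- If `M` is the product of `X` and `D`, then `M^*` is contained in the product of `X` and
`D^*`. -/
lemma relFrattini_le_of_le_sup {M X D : Subgroup G} [hX : X.Normal] (hc : IsClosed (X : Set G))
    (hM : M ≤ X ⊔ D) (hD : relFrattini p D ≤ X) : relFrattini p M ≤ X := by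
  -- Modulo `X` each element of `M` agrees with an element of `D`, hence so do the `p`-th powers and
  -- commutators generating `M^*`.
  have key : ∀ m ∈ M, ∃ d ∈ D, (QuotientGroup.mk' X) m = (QuotientGroup.mk' X) d := by
    intro m hm
    obtain ⟨x, hx, d, hd, rfl⟩ := Subgroup.mem_sup_of_normal_left.1 (hM hm)
    refine ⟨d, hd, ?_⟩
    rw [map_mul, (QuotientGroup.eq_one_iff x).2 hx |> fun h : QuotientGroup.mk' X x = 1 => h,
      one_mul]
  have hq : ∀ a, a ∈ X ↔ (QuotientGroup.mk' X) a = 1 := fun a =>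
    (QuotientGroup.eq_one_iff a).symm
  refine relFrattini_le hc (fun m hm => ?_) fun g m hm => ?_
  · obtain ⟨d, hd, h⟩ := key m hm
    rw [hq, map_pow, h, ← map_pow, ← hq]
    exact hD (pow_mem_relFrattini hd)
  · obtain ⟨d, hd, h⟩ := key m hm
    rw [hq, map_commutatorElement, h, ← map_commutatorElement, ← hq]
    exact hD (commutator_mem_relFrattini g hd)

end RelFrattini

/-! ### Elementary abelian quotients and their indices -/

section QuotientDim

open scoped commutatorElement

variable {p : ℕ} [hp : Fact p.Prime] {G : Type*} [Group G]

lemma HasQuotientDim.relIndex_eq {B A : Subgroup G} {d : ℕ} (h : HasQuotientDim p B A d) :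
    A.relIndex B = p ^ d := by
  obtain ⟨-, ψ, hs, hk⟩ := h
  rw [Subgroup.relIndex, ← hk, Subgroup.index_ker, MonoidHom.range_eq_top.2 hs,
    Subgroup.card_top, Nat.card_congr Multiplicative.toAdd]
  simp

lemma exists_hasQuotientDim {B A : Subgroup G} (hAB : A ≤ B) (h1 : ∀ x ∈ B, x ^ p ∈ A)
    (h2 : ∀ g ∈ B, ∀ x ∈ B, ⁅g, x⁆ ∈ A) (hfin : A.relIndex B ≠ 0) :
    ∃ d, HasQuotientDim p B A d := by
  have hcomm : ∀ a b : B, ⁅a, b⁆ ∈ A.subgroupOf B := fun a b => h2 a a.2 b b.2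
  have hn : (A.subgroupOf B).Normal := by
    constructor
    intro x hx g
    have h := (A.subgroupOf B).mul_mem (hcomm g x) hx
    rwa [commutatorElement_def, inv_mul_cancel_right] at h
  let Q := B ⧸ A.subgroupOf B
  let _ : CommGroup Q :=
    { (inferInstance : Group Q) with
      mul_comm := by
        intro a b
        obtain ⟨a, rfl⟩ := QuotientGroup.mk_surjective a
        obtain ⟨b, rfl⟩ := QuotientGroup.mk_surjective b
        have := (QuotientGroup.eq_one_iff (N := A.subgroupOf B) ⁅a, b⁆).2 (hcomm a b)
        rw [commutatorElement_def] at this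
        simp only [QuotientGroup.mk_mul, QuotientGroup.mk_inv] at this
        exact commutatorElement_eq_one_iff_mul_comm.1 this }
  have hpow : ∀ a : Q, a ^ p = 1 := by
    intro a
    obtain ⟨a, rfl⟩ := QuotientGroup.mk_surjective a
    exact (QuotientGroup.eq_one_iff (N := A.subgroupOf B) (a ^ p)).2 (h1 a a.2)
  let _ : Module (ZMod p) (Additive Q) := AddCommGroup.zmodModule (n := p) fun x => hpow x.toMul
  have : Finite Q := Nat.finite_of_card_ne_zero hfin
  have : Finite (Additive Q) := this
  let e := (Module.finBasis (ZMod p) (Additive Q)).equivFun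
  refine ⟨Module.finrank (ZMod p) (Additive Q), hAB,
    (AddMonoidHom.toMultiplicativeRight (e : Additive Q →+ _)).comp (QuotientGroup.mk' _), ?_, ?_⟩
  · intro y
    obtain ⟨q, hq⟩ := e.surjective y.toAdd
    obtain ⟨b, hb⟩ := QuotientGroup.mk_surjective q.toMul
    refine ⟨b, ?_⟩
    change Multiplicative.ofAdd (e (Additive.ofMul (b : Q))) = y
    rw [hb]
    exact congrArg Multiplicative.ofAdd hq
  · ext b
    rw [MonoidHom.mem_ker]
    change Multiplicative.ofAdd (e (Additive.ofMul (b : Q))) = 1 ↔ _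
    rw [← QuotientGroup.eq_one_iff (N := A.subgroupOf B)]
    refine (Multiplicative.ofAdd.injective.eq_iff (b := 0)).trans ?_
    rw [e.map_eq_zero_iff]
    rfl

/-- The order of an elementary abelian quotient determines its dimension. This reduces all later
dimension counts to products of indices in `F_n`. -/
lemma hasQuotientDim_of_relIndex {B A : Subgroup G} {d : ℕ} (hAB : A ≤ B)
    (h1 : ∀ x ∈ B, x ^ p ∈ A) (h2 : ∀ g ∈ B, ∀ x ∈ B, ⁅g, x⁆ ∈ A) (h : A.relIndex B = p ^ d) :
    HasQuotientDim p B A d := by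
  obtain ⟨e, he⟩ := exists_hasQuotientDim hAB h1 h2
    (by rw [h]; exact pow_ne_zero _ hp.out.ne_zero)
  have := he.relIndex_eq
  rw [h] at this
  rwa [Nat.pow_right_injective hp.out.two_le this]

end QuotientDim

/-! ### Pro-`p`-groups and their quotients -/

section ProP

variable {p : ℕ} {G : Type*} [Group G] [TopologicalSpace G] [IsTopologicalGroup G]

lemma IsProPGroup.eq_one (hG : IsProPGroup p G) {g : G}
    (h : ∀ U : Subgroup G, U.Normal → IsOpen (U : Set G) → g ∈ U) : g = 1 := by
  have := hG.compactSpace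
  have := hG.totallyDisconnectedSpace
  by_contra hg
  obtain ⟨U, hU⟩ := ProfiniteGrp.exist_openNormalSubgroup_sub_open_nhds_of_one
    (U := ({g}ᶜ : Set G)) isOpen_compl_singleton (fun h => hg h.symm)
  exact hU (h U.toSubgroup U.isNormal' U.isOpen') rfl

lemma isProPGroup_of_finite [Finite G] [DiscreteTopology G] [Fact p.Prime] (h : IsPGroup p G) :
    IsProPGroup p G :=
  ⟨inferInstance, inferInstance, fun N _ _ => h.index N⟩

/-- Translates of images of open normal subgroups form a clopen basis of `G ⧸ N`, and closedness of
`N` gives separation; indices are computed after pulling back to `G`. -/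
lemma IsProPGroup.quotient (hG : IsProPGroup p G) (N : Subgroup G) [N.Normal]
    (hN : IsClosed (N : Set G)) : IsProPGroup p (G ⧸ N) := by
  have := hG.compactSpace
  have := hG.totallyDisconnectedSpace
  refine ⟨inferInstance, ?_, fun U hU hO => ?_⟩
  · have : TotallySeparatedSpace (G ⧸ N) := by
      refine totallySeparatedSpace_of_t0_of_basis_clopen ?_
      refine TopologicalSpace.isTopologicalBasis_of_isOpen_of_nhds (fun u hu => hu.2) ?_
      intro a O ha hO
      obtain ⟨x, rfl⟩ := QuotientGroup.mk_surjective a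
      obtain ⟨U, hU⟩ := ProfiniteGrp.exist_openNormalSubgroup_sub_open_nhds_of_one
        (U := (fun y : G => (x : G ⧸ N) * (y : G ⧸ N)) ⁻¹' O)
        (hO.preimage (by fun_prop)) (by simpa using ha)
      let V : Subgroup (G ⧸ N) := U.toSubgroup.map (QuotientGroup.mk' N)
      have hV : IsOpen (V : Set (G ⧸ N)) :=
        QuotientGroup.isOpenMap_coe _ U.isOpen'
      refine ⟨(fun y => (x : G ⧸ N)⁻¹ * y) ⁻¹' V,
        ⟨(Subgroup.isClosed_of_isOpen V hV).preimage (by fun_prop), hV.preimage (by fun_prop)⟩,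
        ?_, ?_⟩
      · simp
      · rintro b ⟨u, hu, hb⟩
        have h := hU hu
        have hb' : b = (x : G ⧸ N) * (u : G ⧸ N) := by
          have hb2 : (u : G ⧸ N) = (x : G ⧸ N)⁻¹ * b := hb
          rw [hb2]
          simp
        rw [hb']
        exact h
    infer_instance
  · rw [← U.index_comap_of_surjective (QuotientGroup.mk'_surjective N)]
    exact hG.index_eq _ inferInstance (hO.preimage continuous_quot_mk)

omit [TopologicalSpace G] [IsTopologicalGroup G] in
lemma exists_index_eq_pow_of_dvd [hp : Fact p.Prime] {U : Subgroup G} {k : ℕ}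
    (h : U.index ∣ p ^ k) : ∃ k, U.index = p ^ k := by
  obtain ⟨l, -, hl⟩ := (Nat.dvd_prime_pow hp.out).1 h
  exact ⟨l, hl⟩

end ProP

/-! ### The free pro-`p`-group and its universal property -/

section FreeProPBasics

variable {p n : ℕ} [hp : Fact p.Prime]

instance (N : PIndexSubgroup p n) : Finite (PIndexQuotient p n N) := by
  obtain ⟨k, hk⟩ := N.2.2
  refine Nat.finite_of_card_ne_zero (α := FreeGroup (Fin n) ⧸ N.1) ?_
  change N.1.index ≠ 0
  rw [hk]
  exact pow_ne_zero _ hp.out.ne_zero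

lemma isClosed_freeProPSubgroup : IsClosed (freeProPSubgroup p n :
    Set (∀ N : PIndexSubgroup p n, PIndexQuotient p n N)) := by
  have : (freeProPSubgroup p n : Set (∀ N : PIndexSubgroup p n, PIndexQuotient p n N)) =
      ⋂ (N : PIndexSubgroup p n) (M : PIndexSubgroup p n) (h : N.1 ≤ M.1),
        {x | PIndexQuotient.transition h (x N) = x M} := by
    ext x
    simp [freeProPSubgroup]
  rw [this]
  refine isClosed_iInter fun N => isClosed_iInter fun M => isClosed_iInter fun h =>
    isClosed_eq ?_ (continuous_apply M)
  exact (continuous_of_discreteTopology (f := PIndexQuotient.transition h)).comp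
    (continuous_apply N)

instance : CompactSpace (FreeProP p n) :=
  isCompact_iff_compactSpace.1 isClosed_freeProPSubgroup.isCompact

instance : TotallyDisconnectedSpace (FreeProP p n) := inferInstance

/-- The homomorphism from the free group to the free pro-`p`-group. -/
def ofFreeGroup (p n : ℕ) : FreeGroup (Fin n) →* FreeProP p n where
  toFun w := ⟨fun N => (QuotientGroup.mk' N.1 w : FreeGroup (Fin n) ⧸ N.1), fun _ _ _ => rfl⟩
  map_one' := rfl
  map_mul' _ _ := rfl

/-- The free generators. -/
def freeGen (p : ℕ) {n : ℕ} (i : Fin n) : FreeProP p n := ofFreeGroup p n (FreeGroup.of i)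

/-- The projection from the free pro-`p`-group to one of its defining quotients. -/
def pIndexProj (N : PIndexSubgroup p n) : FreeProP p n →* PIndexQuotient p n N :=
  (Pi.evalMonoidHom _ N).comp (freeProPSubgroup p n).subtype

omit hp in
lemma continuous_pIndexProj (N : PIndexSubgroup p n) : Continuous (pIndexProj N) :=
  (continuous_apply N).comp continuous_subtype_val

lemma exists_pIndexSubgroup_le (I : Finset (PIndexSubgroup p n)) :
    ∃ M : PIndexSubgroup p n, ∀ N ∈ I, M.1 ≤ N.1 := by
  classical
  induction I using Finset.induction_on with
  | empty => exact ⟨⟨⊤, inferInstance, 0, by simp⟩, by simp⟩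
  | insert N I _ ih =>
    obtain ⟨M, hM⟩ := ih
    obtain ⟨k, hk⟩ := N.2.2
    obtain ⟨l, hl⟩ := M.2.2
    refine ⟨⟨N.1 ⊓ M.1, inferInstance, ?_⟩, ?_⟩
    · have h : (N.1 ⊓ M.1).index ∣ p ^ (k + l) := by
        rw [← Subgroup.relIndex_mul_index (inf_le_right : N.1 ⊓ M.1 ≤ M.1),
          Subgroup.inf_relIndex_right, pow_add, ← hk, ← hl]
        exact mul_dvd_mul (Subgroup.relIndex_dvd_index_of_normal _ _) dvd_rfl
      obtain ⟨j, -, hj⟩ := (Nat.dvd_prime_pow hp.out).1 h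
      exact ⟨j, hj⟩
    · intro N' hN'
      rcases Finset.mem_insert.1 hN' with rfl | h
      · exact inf_le_left
      · exact inf_le_right.trans (hM _ h)

lemma exists_pIndexProj_fiber_subset {O : Set (FreeProP p n)} (hO : IsOpen O) {x : FreeProP p n}
    (hx : x ∈ O) : ∃ N : PIndexSubgroup p n, ∀ y, pIndexProj N y = pIndexProj N x → y ∈ O := by
  obtain ⟨s, hs, rfl⟩ := isOpen_induced_iff.1 hO
  obtain ⟨I, u, hu, hI⟩ := isOpen_pi_iff.1 hs x.1 hx
  obtain ⟨M, hM⟩ := exists_pIndexSubgroup_le I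
  refine ⟨M, fun y hy => hI fun N hN => ?_⟩
  have h : y.1 N = x.1 N := by
    rw [← y.2 M N (hM N hN), ← x.2 M N (hM N hN)]
    exact congrArg _ hy
  change y.1 N ∈ u N
  rw [h]
  exact (hu N hN).2

lemma denseRange_ofFreeGroup : DenseRange (ofFreeGroup p n) := by
  intro x
  rw [mem_closure_iff]
  intro O hO hx
  obtain ⟨N, hN⟩ := exists_pIndexProj_fiber_subset hO hx
  obtain ⟨w, hw⟩ := QuotientGroup.mk_surjective (s := N.1) (pIndexProj N x)
  exact ⟨ofFreeGroup p n w, hN _ hw, w, rfl⟩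

omit hp in
lemma pIndexProj_surjective (N : PIndexSubgroup p n) : Function.Surjective (pIndexProj N) := by
  intro x
  obtain ⟨w, hw⟩ := QuotientGroup.mk_surjective (s := N.1) x
  exact ⟨ofFreeGroup p n w, hw⟩

lemma isProPGroup_freeProP : IsProPGroup p (FreeProP p n) := by
  refine ⟨inferInstance, inferInstance, fun U _ hO => ?_⟩
  obtain ⟨N, hN⟩ := exists_pIndexProj_fiber_subset hO U.one_mem
  obtain ⟨k, hk⟩ := N.2.2
  have h : (pIndexProj N).ker ≤ U := fun y hy => hN y (by rw [hy, map_one])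
  refine exists_index_eq_pow_of_dvd (k := k) ?_
  refine (Subgroup.index_dvd_of_le h).trans ?_
  rw [Subgroup.index_ker, MonoidHom.range_eq_top.2 (pIndexProj_surjective N), Subgroup.card_top,
    ← hk]
  exact dvd_rfl

lemma freeProP_hom_ext {G : Type*} [Group G] [TopologicalSpace G] [T2Space G]
    {φ ψ : FreeProP p n →* G} (hφ : Continuous φ) (hψ : Continuous ψ)
    (h : ∀ i, φ (freeGen p i) = ψ (freeGen p i)) : φ = ψ := by
  have h1 : φ.comp (ofFreeGroup p n) = ψ.comp (ofFreeGroup p n) := FreeGroup.ext_hom _ _ h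
  exact DFunLike.coe_injective (denseRange_ofFreeGroup.equalizer hφ hψ
    (funext fun w => DFunLike.congr_fun h1 w))

/-- The closure `T` of the graph of the abstract homomorphism on the free group is the graph of the
extension. Its projection to `F_n` is onto because the image is compact and dense. It is injective
because an open normal subgroup of `G` pulls back to one of the subgroups of `p`-power index
defining `F_n`. Compactness makes the inverse continuous. -/
lemma exists_freeProP_lift {G : Type*} [Group G] [TopologicalSpace G] [IsTopologicalGroup G]
    (hG : IsProPGroup p G) (f : Fin n → G) :
    ∃ φ : FreeProP p n →ₜ* G, ∀ i, φ (freeGen p i) = f i := by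
  have := hG.compactSpace
  have := hG.totallyDisconnectedSpace
  let g : FreeGroup (Fin n) →* G := FreeGroup.lift f
  let T : Subgroup (FreeProP p n × G) := ((ofFreeGroup p n).prod g).range.topologicalClosure
  have hT : IsClosed (T : Set (FreeProP p n × G)) := Subgroup.isClosed_topologicalClosure _
  have hTc : CompactSpace T := isCompact_iff_compactSpace.1 hT.isCompact
  let q : T →* FreeProP p n := (MonoidHom.fst _ _).comp T.subtype
  have hq : Continuous q := continuous_fst.comp continuous_subtype_val
  have hinj : Function.Injective q := by
    rw [injective_iff_map_eq_one]
    rintro ⟨⟨x, y⟩, hxy⟩ (rfl : x = 1)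
    have hy : y = 1 := by
      refine hG.eq_one fun U hU hO => ?_
      have hind : ∃ k, (U.comap g).index = p ^ k := by
        obtain ⟨k, hk⟩ := hG.index_eq U hU hO
        have h : (U.comap g).index ∣ p ^ k := by
          rw [Subgroup.index_comap, ← hk]
          exact Subgroup.relIndex_dvd_index_of_normal _ _
        obtain ⟨j, -, hj⟩ := (Nat.dvd_prime_pow hp.out).1 h
        exact ⟨j, hj⟩
      let N : PIndexSubgroup p n := ⟨U.comap g, inferInstance, hind⟩
      let r : PIndexQuotient p n N →* G ⧸ U := QuotientGroup.map _ U g le_rfl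
      have : DiscreteTopology (G ⧸ U) := QuotientGroup.discreteTopology hO
      have hcl : IsClosed {z : FreeProP p n × G | r (pIndexProj N z.1) = (z.2 : G ⧸ U)} :=
        isClosed_eq ((continuous_of_discreteTopology (f := r)).comp
          ((continuous_pIndexProj N).comp continuous_fst)) (by fun_prop)
      have hsub : (T : Set (FreeProP p n × G)) ⊆
          {z : FreeProP p n × G | r (pIndexProj N z.1) = (z.2 : G ⧸ U)} := by
        refine closure_minimal ?_ hcl
        rintro _ ⟨w, rfl⟩
        rfl
      have h := hsub hxy
      change r (pIndexProj N 1) = (y : G ⧸ U) at h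
      rw [map_one, map_one] at h
      exact (QuotientGroup.eq_one_iff y).1 h.symm
    subst hy
    rfl
  have hsurj : Function.Surjective q := by
    have hc : IsClosed (Set.range q) := (isCompact_range hq).isClosed
    have hd : DenseRange q := denseRange_ofFreeGroup.mono (by
      rintro _ ⟨w, rfl⟩
      exact ⟨⟨(ofFreeGroup p n w, g w), Subgroup.le_topologicalClosure _ ⟨w, rfl⟩⟩, rfl⟩)
    rw [← Set.range_eq_univ, ← hc.closure_eq, hd.closure_range]
  let e : T ≃* FreeProP p n := MulEquiv.ofBijective q ⟨hinj, hsurj⟩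
  have he : Continuous e.symm :=
    (Continuous.homeoOfEquivCompactToT2 (f := e.toEquiv) hq).symm.continuous
  refine ⟨⟨(MonoidHom.snd _ _).comp (T.subtype.comp e.symm.toMonoidHom),
    continuous_snd.comp (continuous_subtype_val.comp he)⟩, fun i => ?_⟩
  have h1 : e.symm (freeGen p i) = ⟨(ofFreeGroup p n (FreeGroup.of i), g (FreeGroup.of i)),
      Subgroup.le_topologicalClosure _ ⟨FreeGroup.of i, rfl⟩⟩ := by
    rw [MulEquiv.symm_apply_eq]
    rfl
  change (e.symm (freeGen p i)).1.2 = f i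
  rw [h1]
  exact FreeGroup.lift_apply_of

/-- A closed subgroup that contains the free generators is everything. -/
lemma eq_top_of_freeGen_mem {S : Subgroup (FreeProP p n)} (hS : IsClosed (S : Set (FreeProP p n)))
    (h : ∀ i, freeGen p i ∈ S) : S = ⊤ := by
  have h1 : (ofFreeGroup p n).range ≤ S := by
    rw [MonoidHom.range_eq_map, ← FreeGroup.closure_range_of, MonoidHom.map_closure,
      Subgroup.closure_le]
    rintro _ ⟨_, ⟨i, rfl⟩, rfl⟩
    exact h i
  rw [eq_top_iff]
  intro x _
  exact closure_minimal (fun y hy => h1 hy) hS (denseRange_ofFreeGroup x)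

end FreeProPBasics

/-! ### Nakayama's lemma for finite `p`-groups and for pro-`p`-groups -/

section FiniteNakayama

open scoped commutatorElement

/-- A normal subgroup `Q` of a finite `p`-group that is contained in `Q^*` is trivial. -/
lemma IsPGroup.eq_bot_of_le_star {p : ℕ} [hp : Fact p.Prime] (c : ℕ) :
    ∀ {P : Type*} [Group P] [Finite P], IsPGroup p P → Nat.card P = c → ∀ Q : Subgroup P,
      (∀ C : Subgroup P, C.Normal → (∀ x ∈ Q, x ^ p ∈ C) → (∀ g : P, ∀ x ∈ Q, ⁅g, x⁆ ∈ C) →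
        Q ≤ C) → Q = ⊥ := by
  induction c using Nat.strong_induction_on with
  | _ c ih =>
  intro P _ _ hP hc Q hQ
  rcases subsingleton_or_nontrivial P with h | h
  · exact Subsingleton.elim _ _
  have hz := hP.center_nontrivial
  have hdvd : p ∣ Nat.card (Subgroup.center P) := by
    obtain ⟨k, hk, hk'⟩ := (hP.to_subgroup (Subgroup.center P)).nontrivial_iff_card.1 hz
    rw [hk']
    exact dvd_pow_self p hk.ne'
  -- Dividing by a central subgroup `Z` of order `p` and using induction gives `Q ≤ Z`. Since `Z` is
  -- central of exponent `p`, the trivial subgroup is then an admissible choice of `C`.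
  obtain ⟨z, hzp⟩ := exists_prime_orderOf_dvd_card' p hdvd
  have hzc : ∀ k : ℤ, (z : P) ^ k ∈ Subgroup.center P := fun k => Subgroup.zpow_mem _ z.2 k
  let Z : Subgroup P := Subgroup.zpowers (z : P)
  have hZ : Z.Normal := by
    refine ⟨fun x hx g => ?_⟩
    obtain ⟨k, rfl⟩ := Subgroup.mem_zpowers_iff.1 hx
    rw [Subgroup.mem_center_iff.1 (hzc k) g, mul_inv_cancel_right]
    exact hx
  have hzo : orderOf (z : P) = p := by rw [← hzp, Subgroup.orderOf_coe]
  have hQZ : Q ≤ Z := by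
    have h1 : Q.map (QuotientGroup.mk' Z) = ⊥ := by
      refine ih (Nat.card (P ⧸ Z)) ?_ (hP.to_quotient Z) rfl _ ?_
      · rw [← hc, Subgroup.card_eq_card_quotient_mul_card_subgroup Z, Nat.card_zpowers, hzo]
        exact lt_mul_of_one_lt_right Nat.card_pos hp.out.one_lt
      · intro C hC h1 h2
        rw [Subgroup.map_le_iff_le_comap]
        refine hQ _ (hC.comap _) (fun x hx => ?_) fun g x hx => ?_
        · exact h1 _ (Subgroup.mem_map_of_mem _ hx)
        · rw [Subgroup.mem_comap, map_commutatorElement]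
          exact h2 _ _ (Subgroup.mem_map_of_mem _ hx)
    rwa [Subgroup.map_eq_bot_iff, QuotientGroup.ker_mk'] at h1
  rw [eq_bot_iff]
  refine hQ ⊥ inferInstance (fun x hx => ?_) fun g x hx => ?_
  · obtain ⟨k, rfl⟩ := Subgroup.mem_zpowers_iff.1 (hQZ hx)
    rw [Subgroup.mem_bot, ← zpow_natCast, ← zpow_mul, mul_comm, zpow_mul, zpow_natCast]
    have hz1 : (z : P) ^ p = 1 := by rw [← hzo]; exact pow_orderOf_eq_one _
    rw [hz1, one_zpow]
  · obtain ⟨k, rfl⟩ := Subgroup.mem_zpowers_iff.1 (hQZ hx)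
    rw [Subgroup.mem_bot, commutatorElement_eq_one_iff_mul_comm]
    exact Subgroup.mem_center_iff.1 (hzc k) g

/-- A finitely generated abelian torsion group is finite. -/
lemma relIndex_ne_zero_of_fg {p : ℕ} [hp : Fact p.Prime] {G : Type*} [Group G] {B A : Subgroup G}
    (h1 : ∀ x ∈ B, x ^ p ∈ A) (h2 : ∀ g ∈ B, ∀ x ∈ B, ⁅g, x⁆ ∈ A) (hfg : Group.FG B) :
    A.relIndex B ≠ 0 := by
  have hcomm : ∀ a b : B, ⁅a, b⁆ ∈ A.subgroupOf B := fun a b => h2 a a.2 b b.2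
  have hn : (A.subgroupOf B).Normal := by
    constructor
    intro x hx g
    have h := (A.subgroupOf B).mul_mem (hcomm g x) hx
    rwa [commutatorElement_def, inv_mul_cancel_right] at h
  let Q := B ⧸ A.subgroupOf B
  let _ : CommGroup Q :=
    { (inferInstance : Group Q) with
      mul_comm := by
        intro a b
        obtain ⟨a, rfl⟩ := QuotientGroup.mk_surjective a
        obtain ⟨b, rfl⟩ := QuotientGroup.mk_surjective b
        have := (QuotientGroup.eq_one_iff (N := A.subgroupOf B) ⁅a, b⁆).2 (hcomm a b)
        rw [commutatorElement_def] at this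
        simp only [QuotientGroup.mk_mul, QuotientGroup.mk_inv] at this
        exact commutatorElement_eq_one_iff_mul_comm.1 this }
  have hpow : ∀ a : Q, a ^ p = 1 := by
    intro a
    obtain ⟨a, rfl⟩ := QuotientGroup.mk_surjective a
    exact (QuotientGroup.eq_one_iff (N := A.subgroupOf B) (a ^ p)).2 (h1 a a.2)
  have hfg' : Group.FG Q := QuotientGroup.fg _
  have hfin : Finite Q := CommGroup.finite_of_fg_isMulTorsion Q
    (fun a => isOfFinOrder_iff_pow_eq_one.2 ⟨p, hp.out.pos, hpow a⟩)
  change Nat.card Q ≠ 0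
  exact Nat.card_pos.ne'

end FiniteNakayama

section ProPNakayama

open scoped commutatorElement

variable {p : ℕ} [hp : Fact p.Prime] {G : Type*} [Group G] [TopologicalSpace G]
  [IsTopologicalGroup G]

omit hp in
lemma IsProPGroup.isPGroup_quotient (hG : IsProPGroup p G) {X : Subgroup G} [X.Normal]
    (hX : IsOpen (X : Set G)) : IsPGroup p (G ⧸ X) := by
  obtain ⟨k, hk⟩ := hG.index_eq X inferInstance hX
  exact IsPGroup.of_card hk

/-- In the finite `p`-group `G ⧸ X` the image of `M` is contained in its own star, so it is trivial.
-/
lemma IsProPGroup.le_of_le_sup_relFrattini (hG : IsProPGroup p G) {M X : Subgroup G} [X.Normal]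
    (hX : IsOpen (X : Set G)) (h : M ≤ X ⊔ relFrattini p M) : M ≤ X := by
  have := hG.compactSpace
  have : Finite (G ⧸ X) := Subgroup.quotient_finite_of_isOpen X hX
  have h1 : M.map (QuotientGroup.mk' X) = ⊥ := by
    refine IsPGroup.eq_bot_of_le_star _ (hG.isPGroup_quotient hX) rfl _ fun C hC h1 h2 => ?_
    have hXC : X ≤ C.comap (QuotientGroup.mk' X) := fun x hx => by
      rw [Subgroup.mem_comap, QuotientGroup.mk'_apply, (QuotientGroup.eq_one_iff x).2 hx]
      exact C.one_mem
    have hC' : IsOpen (C.comap (QuotientGroup.mk' X) : Set G) := Subgroup.isOpen_mono hXC hX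
    rw [Subgroup.map_le_iff_le_comap]
    refine h.trans (sup_le hXC (relFrattini_le (Subgroup.isClosed_of_isOpen _ hC')
      (fun x hx => ?_) fun g x hx => ?_))
    · exact h1 _ (Subgroup.mem_map_of_mem _ hx)
    · rw [Subgroup.mem_comap, map_commutatorElement]
      exact h2 _ _ (Subgroup.mem_map_of_mem _ hx)
  rwa [Subgroup.map_eq_bot_iff, QuotientGroup.ker_mk'] at h1

/-- A proper open subgroup of a pro-`p`-group is contained in a proper open normal subgroup. -/
lemma IsProPGroup.exists_normal_ge (hG : IsProPGroup p G) {V : Subgroup G}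
    (hV : IsOpen (V : Set G)) (hne : V ≠ ⊤) :
    ∃ X : Subgroup G, X.Normal ∧ IsOpen (X : Set G) ∧ V ≤ X ∧ X ≠ ⊤ := by
  have := hG.compactSpace
  have : Finite (G ⧸ V) := Subgroup.quotient_finite_of_isOpen V hV
  have hfi : V.FiniteIndex := Subgroup.finiteIndex_of_finite_quotient
  let N := V.normalCore
  have hN : IsOpen (N : Set G) := Subgroup.isOpen_of_isClosed_of_finiteIndex _
    (V.normalCore_isClosed (Subgroup.isClosed_of_isOpen V hV))
  have : Finite (G ⧸ N) := Subgroup.quotient_finite_of_isOpen N hN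
  have hs := QuotientGroup.mk'_surjective N
  have hVN : (V.map (QuotientGroup.mk' N)).comap (QuotientGroup.mk' N) = V := by
    rw [Subgroup.comap_map_eq, QuotientGroup.ker_mk', sup_eq_left]
    exact V.normalCore_le
  have hne' : V.map (QuotientGroup.mk' N) ≠ ⊤ := fun h => hne (by
    rw [← hVN, h, Subgroup.comap_top])
  obtain ⟨C, hC, hVC⟩ := (eq_top_or_exists_le_coatom (V.map (QuotientGroup.mk' N))).resolve_left
    hne'
  -- Maximal subgroups of a finite `p`-group are normal, by the normalizer condition.
  have hnil : Group.IsNilpotent (G ⧸ N) := (hG.isPGroup_quotient hN).isNilpotent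
  have hCn : C.Normal :=
    Subgroup.NormalizerCondition.normal_of_coatom C Group.normalizerCondition_of_isNilpotent hC
  have hle : V ≤ C.comap (QuotientGroup.mk' N) := Subgroup.map_le_iff_le_comap.1 hVC
  refine ⟨C.comap (QuotientGroup.mk' N), hCn.comap _, Subgroup.isOpen_mono hle hV, hle, fun h => ?_⟩
  refine hC.1 ?_
  rw [← Subgroup.map_comap_eq_self_of_surjective hs C, h, Subgroup.map_top_of_surjective _ hs]

/-- A closed subgroup is the intersection of the open subgroups containing it. A proper one among
these lies in a proper open normal subgroup, to which the Nakayama lemma applies. -/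
lemma IsProPGroup.eq_top_of_sup_relFrattini (hG : IsProPGroup p G) {S : Subgroup G}
    (hS : IsClosed (S : Set G)) (h : S ⊔ relFrattini p ⊤ = ⊤) : S = ⊤ := by
  have := hG.compactSpace
  have := hG.totallyDisconnectedSpace
  have h1 := ProfiniteGrp.closedSubgroup_eq_sInf_open (⟨S, hS⟩ : ClosedSubgroup G)
  change S = _ at h1
  rw [h1, sInf_eq_top]
  rintro V ⟨hV, hSV⟩
  by_contra hne
  obtain ⟨X, hX, hXo, hVX, hXne⟩ := hG.exists_normal_ge hV hne
  refine hXne (top_le_iff.1 (hG.le_of_le_sup_relFrattini hXo ?_))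
  exact h.ge.trans (sup_le_sup_right (le_trans hSV hVX) _)

/-- The preimage `N'` of `M` in the abstract free group has finite index, so it is finitely
generated, and `N'^*` again has `p`-power index. The corresponding projection has open kernel, and
density of the free group puts this kernel inside the closed subgroup `M^*`. -/
lemma isOpen_relFrattini_freeProP {n : ℕ} {M : Subgroup (FreeProP p n)} [M.Normal]
    (hM : IsOpen (M : Set (FreeProP p n))) :
    IsOpen (relFrattini p M : Set (FreeProP p n)) := by
  obtain ⟨k, hk⟩ := isProPGroup_freeProP.index_eq M inferInstance hM
  -- In the discrete topology the closure in `relFrattini` has no effect, so it yields the abstract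
  -- `N'^*`.
  let _ : TopologicalSpace (FreeGroup (Fin n)) := ⊥
  have : DiscreteTopology (FreeGroup (Fin n)) := ⟨rfl⟩
  let N' : Subgroup (FreeGroup (Fin n)) := M.comap (ofFreeGroup p n)
  have hNi : ∃ l, N'.index = p ^ l := by
    refine exists_index_eq_pow_of_dvd (k := k) ?_
    rw [Subgroup.index_comap, ← hk]
    exact Subgroup.relIndex_dvd_index_of_normal _ _
  obtain ⟨l, hl⟩ := hNi
  have hfi : N'.FiniteIndex := ⟨by rw [hl]; exact pow_ne_zero _ hp.out.ne_zero⟩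
  have hfg : Group.FG N' := Subgroup.fg_of_index_ne_zero N'
  let A : Subgroup (FreeGroup (Fin n)) := relFrattini p N'
  have hAN : A ≤ N' := relFrattini_le_self (isClosed_discrete _)
  have h1 : ∀ x ∈ N', x ^ p ∈ A := fun x hx => pow_mem_relFrattini hx
  have h2 : ∀ g ∈ N', ∀ x ∈ N', ⁅g, x⁆ ∈ A := fun g _ x hx => commutator_mem_relFrattini g hx
  obtain ⟨d, hd⟩ := exists_hasQuotientDim hAN h1 h2 (relIndex_ne_zero_of_fg h1 h2 hfg)
  let N : PIndexSubgroup p n := ⟨A, inferInstance, d + l, by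
    rw [← Subgroup.relIndex_mul_index hAN, hd.relIndex_eq, hl, pow_add]⟩
  have hker : IsOpen ((pIndexProj N).ker : Set (FreeProP p n)) := by
    have : ((pIndexProj N).ker : Set (FreeProP p n)) = pIndexProj N ⁻¹' {1} := rfl
    rw [this]
    exact (isOpen_discrete _).preimage (continuous_pIndexProj N)
  refine Subgroup.isOpen_mono (fun x hx => ?_) hker
  by_contra hxM
  obtain ⟨y, ⟨hy1, hy2⟩, w, rfl⟩ := denseRange_ofFreeGroup.inter_open_nonempty
    (((pIndexProj N).ker : Set (FreeProP p n)) ∩ (relFrattini p M : Set (FreeProP p n))ᶜ)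
    (hker.inter (isClosed_relFrattini M).isOpen_compl) ⟨x, hx, hxM⟩
  refine hy2 ?_
  have hw : w ∈ A := (QuotientGroup.eq_one_iff (N := A) w).1 hy1
  have hle : A ≤ (relFrattini p M).comap (ofFreeGroup p n) := by
    refine relFrattini_le (isClosed_discrete _) (fun x hx => ?_) fun g x hx => ?_
    · rw [Subgroup.mem_comap, map_pow]
      exact pow_mem_relFrattini hx
    · rw [Subgroup.mem_comap, map_commutatorElement]
      exact commutator_mem_relFrattini _ hx
  exact hle hw

lemma isOpen_lowerPCentral_freeProP {n : ℕ} (j : ℕ) :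
    IsOpen (lowerPCentral p (FreeProP p n) j : Set (FreeProP p n)) := by
  induction j with
  | zero => exact isOpen_univ
  | succ j ih =>
    have := (isTopCharacteristic_lowerPCentral (p := p) (G := FreeProP p n) j).normal
    exact isOpen_relFrattini_freeProP ih

end ProPNakayama

/-! ### Continuity and factorization of homomorphisms -/

section Helpers

lemma continuous_of_isOpen_ker {G A : Type*} [Group G] [TopologicalSpace G] [IsTopologicalGroup G]
    [Group A] [TopologicalSpace A] [IsTopologicalGroup A] (f : G →* A)
    (h : IsOpen (f.ker : Set G)) : Continuous f := by
  refine continuous_of_continuousAt_one f ?_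
  rw [ContinuousAt, map_one]
  intro U hU
  refine Filter.mem_map.2 (Filter.mem_of_superset (h.mem_nhds f.ker.one_mem) fun x hx => ?_)
  change f x ∈ U
  rw [(MonoidHom.mem_ker).1 hx]
  exact mem_of_mem_nhds hU

lemma isQuotientMap_of_compact {G A : Type*} [TopologicalSpace G] [CompactSpace G]
    [TopologicalSpace A] [T2Space A] {f : G → A} (hf : Continuous f) (hs : Function.Surjective f) :
    Topology.IsQuotientMap f :=
  hf.isClosedMap.isQuotientMap hf hs

/-- Homomorphisms that vanish on the kernel of a surjection factor through it. -/
lemma exists_factor {G A B : Type*} [Group G] [TopologicalSpace G] [CompactSpace G]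
    [Group A] [TopologicalSpace A] [T2Space A] [Group B] [TopologicalSpace B]
    (φ : G →* A) (hφ : Continuous φ) (hs : Function.Surjective φ) (f : G →* B)
    (hf : Continuous f) (h : φ.ker ≤ f.ker) :
    ∃ c : A →* B, Continuous c ∧ ∀ x, c (φ x) = f x := by
  have hc : ∀ x, φ.liftOfSurjective hs ⟨f, h⟩ (φ x) = f x := fun x =>
    φ.liftOfRightInverse_comp_apply _ _ ⟨f, h⟩ x
  refine ⟨φ.liftOfSurjective hs ⟨f, h⟩, ?_, hc⟩
  rw [(isQuotientMap_of_compact hφ hs).continuous_iff]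
  exact hf.congr fun x => (hc x).symm

end Helpers

/-! ### The Frattini quotient of `F_n` -/

section Coordinates

variable {p n : ℕ} [hp : Fact p.Prime]

lemma isProPGroup_multiplicative_pi (n : ℕ) : IsProPGroup p (Multiplicative (Fin n → ZMod p)) := by
  have : Finite (Multiplicative (Fin n → ZMod p)) := inferInstanceAs (Finite (Fin n → ZMod p))
  have : DiscreteTopology (Multiplicative (Fin n → ZMod p)) :=
    inferInstanceAs (DiscreteTopology (Fin n → ZMod p))
  refine isProPGroup_of_finite (IsPGroup.of_card (n := n) ?_)
  rw [Nat.card_congr Multiplicative.toAdd]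
  simp

/-- The coordinates of the image in `F_n / Φ(F_n) = 𝔽_p ^ n`, as a homomorphism. -/
noncomputable def coordHom (p n : ℕ) [Fact p.Prime] :
    FreeProP p n →ₜ* Multiplicative (Fin n → ZMod p) :=
  (exists_freeProP_lift (isProPGroup_multiplicative_pi n)
    fun i => Multiplicative.ofAdd (Pi.single i 1)).choose

/-- The coordinates of the image in `F_n / Φ(F_n) = 𝔽_p ^ n`. -/
noncomputable def coord (x : FreeProP p n) : Fin n → ZMod p := (coordHom p n x).toAdd

lemma coord_freeGen (i : Fin n) : coord (freeGen p i) = Pi.single i 1 :=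
  congrArg Multiplicative.toAdd ((exists_freeProP_lift (isProPGroup_multiplicative_pi n)
    fun i => Multiplicative.ofAdd (Pi.single i (1 : ZMod p))).choose_spec i)

lemma coord_mul (x y : FreeProP p n) : coord (x * y) = coord x + coord y :=
  congrArg Multiplicative.toAdd (map_mul (coordHom p n) x y)

lemma coord_one : coord (1 : FreeProP p n) = 0 :=
  congrArg Multiplicative.toAdd (map_one (coordHom p n))

lemma coord_inv (x : FreeProP p n) : coord x⁻¹ = - coord x :=
  congrArg Multiplicative.toAdd (map_inv (coordHom p n) x)

lemma coord_pow (x : FreeProP p n) (k : ℕ) : coord (x ^ k) = k • coord x :=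
  congrArg Multiplicative.toAdd (map_pow (coordHom p n) x k)

lemma continuous_coord : Continuous (coord : FreeProP p n → Fin n → ZMod p) :=
  (coordHom p n).continuous

lemma mem_ker_coordHom {x : FreeProP p n} : x ∈ (coordHom p n).toMonoidHom.ker ↔
    coord x = 0 := Iff.rfl

lemma contHom_ext {f g : C(FreeProP p n, ZMod p)}
    (hf : f ∈ contHom p (FreeProP p n)) (hg : g ∈ contHom p (FreeProP p n))
    (h : ∀ i, f (freeGen p i) = g (freeGen p i)) : f = g := by
  let toHom : ∀ f ∈ contHom p (FreeProP p n), FreeProP p n →* Multiplicative (ZMod p) :=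
    fun f hf => ⟨⟨fun x => Multiplicative.ofAdd (f x), congrArg _ (contHom_one hf)⟩,
      fun x y => congrArg Multiplicative.ofAdd (hf x y)⟩
  have h1 := freeProP_hom_ext (φ := toHom f hf) (ψ := toHom g hg)
    (continuous_ofAdd.comp f.continuous) (continuous_ofAdd.comp g.continuous) h
  ext x
  exact congrArg Multiplicative.toAdd (DFunLike.congr_fun h1 x)

/-- The homomorphism `F_n → 𝔽_p` with prescribed values on the generators. -/
noncomputable def coordComb (a : Fin n → ZMod p) : C(FreeProP p n, ZMod p) :=
  ⟨fun x => ∑ i, a i * coord x i, by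
    refine continuous_finsetSum _ fun i _ => continuous_const.mul ?_
    exact (continuous_apply i).comp continuous_coord⟩

lemma coordComb_mem (a : Fin n → ZMod p) : coordComb a ∈ contHom p (FreeProP p n) := fun x y => by
  simp only [coordComb, ContinuousMap.coe_mk, coord_mul, Pi.add_apply, mul_add,
    Finset.sum_add_distrib]

lemma coordComb_freeGen (a : Fin n → ZMod p) (i : Fin n) : coordComb a (freeGen p i) = a i := by
  simp [coordComb, coord_freeGen, Pi.single_apply]

/-- A homomorphism to `𝔽_p` is the linear combination of the coordinates whose coefficients are its
values on the free generators. -/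
lemma contHom_eq_zero_of_coord {f : C(FreeProP p n, ZMod p)} (hf : f ∈ contHom p (FreeProP p n))
    {x : FreeProP p n} (hx : coord x = 0) : f x = 0 := by
  have h : f = coordComb fun i => f (freeGen p i) :=
    contHom_ext hf (coordComb_mem _) fun i =>
      (coordComb_freeGen (fun i => f (freeGen p i)) i).symm
  rw [h]
  simp [coordComb, hx]

-- For the converse direction: the Frattini subgroup is open, so its quotient is finite elementary
-- abelian and is detected by homomorphisms to `𝔽_p`, which only depend on `coord`.
open scoped commutatorElement in
lemma mem_frattini_iff {x : FreeProP p n} :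
    x ∈ relFrattini p (⊤ : Subgroup (FreeProP p n)) ↔ coord x = 0 := by
  constructor
  · intro hx
    rw [← mem_ker_coordHom]
    refine relFrattini_le ?_ (fun y _ => ?_) (fun g y _ => ?_) hx
    · exact isClosed_singleton.preimage (coordHom p n).continuous
    · rw [mem_ker_coordHom, coord_pow]
      ext i
      simp
    · rw [mem_ker_coordHom, commutatorElement_def, coord_mul, coord_mul, coord_mul, coord_inv,
        coord_inv]
      abel
  · intro hx
    have hO := isOpen_relFrattini_freeProP (p := p) (n := n) (M := ⊤) isOpen_univ
    obtain ⟨k, hk⟩ := isProPGroup_freeProP.index_eq _ inferInstance hO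
    obtain ⟨d, -, ψ, -, hψ⟩ := exists_hasQuotientDim (p := p) (B := (⊤ : Subgroup (FreeProP p n)))
      (A := relFrattini p ⊤) le_top (fun x hx => pow_mem_relFrattini hx)
      (fun g _ x hx => commutator_mem_relFrattini g hx) (by
        rw [Subgroup.relIndex_top_right, hk]
        exact pow_ne_zero _ hp.out.ne_zero)
    let ψ' : FreeProP p n →* Multiplicative (Fin d → ZMod p) :=
      ψ.comp (Subgroup.topEquiv.symm : FreeProP p n ≃* (⊤ : Subgroup (FreeProP p n))).toMonoidHom
    have hker : ∀ y, ψ' y = 1 ↔ y ∈ relFrattini p (⊤ : Subgroup (FreeProP p n)) := fun y => by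
      change (⟨y, Subgroup.mem_top y⟩ : (⊤ : Subgroup (FreeProP p n))) ∈ ψ.ker ↔ _
      rw [hψ]
      rfl
    have hcont : Continuous ψ' := by
      refine continuous_of_isOpen_ker ψ' ?_
      have : ψ'.ker = relFrattini p ⊤ := Subgroup.ext hker
      rwa [this]
    rw [← hker]
    refine Multiplicative.toAdd.injective (funext fun i => ?_)
    let f : C(FreeProP p n, ZMod p) := ⟨fun y => (ψ' y).toAdd i,
      (continuous_apply i).comp (continuous_toAdd.comp hcont)⟩
    have hf : f ∈ contHom p (FreeProP p n) := fun y z => by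
      change (ψ' (y * z)).toAdd i = _
      rw [map_mul]
      rfl
    exact contHom_eq_zero_of_coord hf hx

/-- A subgroup containing the Frattini subgroup and elements whose coordinates span is
everything. -/
lemma eq_top_of_span_coord {W : Subgroup (FreeProP p n)}
    (hW : relFrattini p (⊤ : Subgroup (FreeProP p n)) ≤ W) {A : Set (Fin n → ZMod p)}
    (hA : ∀ a ∈ A, ∃ x ∈ W, coord x = a) (hspan : Submodule.span (ZMod p) A = ⊤) : W = ⊤ := by
  let V : Submodule (ZMod p) (Fin n → ZMod p) :=
    { carrier := {v | ∃ x ∈ W, coord x = v}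
      add_mem' := by
        rintro _ _ ⟨x, hx, rfl⟩ ⟨y, hy, rfl⟩
        exact ⟨x * y, W.mul_mem hx hy, coord_mul x y⟩
      zero_mem' := ⟨1, W.one_mem, coord_one⟩
      smul_mem' := by
        rintro c _ ⟨x, hx, rfl⟩
        refine ⟨x ^ c.val, W.pow_mem hx _, ?_⟩
        rw [coord_pow, ← Nat.cast_smul_eq_nsmul (ZMod p), ZMod.natCast_zmod_val] }
  have hV : V = ⊤ := by
    rw [eq_top_iff, ← hspan, Submodule.span_le]
    exact hA
  rw [eq_top_iff]
  intro y _
  obtain ⟨x, hx, hxy⟩ : coord y ∈ V := hV ▸ Submodule.mem_top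
  have h1 : x⁻¹ * y ∈ W := hW (mem_frattini_iff.2 (by rw [coord_mul, coord_inv, hxy]; simp))
  have := W.mul_mem hx h1
  rwa [mul_inv_cancel_left] at this

lemma span_single_eq_top (n : ℕ) : Submodule.span (ZMod p)
    (Set.range fun i : Fin n => (Pi.single i 1 : Fin n → ZMod p)) = ⊤ := by
  have := (Pi.basisFun (ZMod p) (Fin n)).span_eq
  rw [← this]
  congr 1
  ext v
  simp [Pi.basisFun_apply]

lemma coord_surjective : Function.Surjective (coord : FreeProP p n → Fin n → ZMod p) := by
  intro v
  have hV : (v : Fin n → ZMod p) ∈ Submodule.span (ZMod p)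
    (Set.range fun i : Fin n => (Pi.single i 1 : Fin n → ZMod p)) := by
    rw [span_single_eq_top]
    exact Submodule.mem_top
  induction hV using Submodule.span_induction with
  | mem x h =>
    obtain ⟨i, rfl⟩ := h
    exact ⟨_, coord_freeGen i⟩
  | zero => exact ⟨1, coord_one⟩
  | add x y _ _ hx hy =>
    obtain ⟨a, rfl⟩ := hx
    obtain ⟨b, rfl⟩ := hy
    exact ⟨a * b, coord_mul a b⟩
  | smul c x _ hx =>
    obtain ⟨a, rfl⟩ := hx
    refine ⟨a ^ c.val, ?_⟩
    rw [coord_pow, ← Nat.cast_smul_eq_nsmul (ZMod p), ZMod.natCast_zmod_val]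

end Coordinates

/-! ### Generator ranks and surjections from `F_n` -/

section Surjections

variable {p n : ℕ} [hp : Fact p.Prime] {G : Type*} [Group G] [TopologicalSpace G]
  [IsTopologicalGroup G]

omit hp in
lemma IsProPGroup.t2Space (hG : IsProPGroup p G) : T2Space G := by
  have := hG.totallyDisconnectedSpace
  infer_instance

omit [IsTopologicalGroup G] in
lemma isClosed_range_of_compact [T2Space G] {φ : FreeProP p n →* G} (hφ : Continuous φ) :
    IsClosed (φ.range : Set G) := by
  rw [MonoidHom.coe_range]
  exact (isCompact_range hφ).isClosed

/-- A homomorphism is surjective if its image contains representatives modulo the Frattini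
subgroup. -/
lemma surjective_of_frattini (hG : IsProPGroup p G) {φ ψ : FreeProP p n →* G} (hφ : Continuous φ)
    (hψ : Continuous ψ) (hs : Function.Surjective φ)
    (h : ∀ x, ∃ y z, coord z = 0 ∧ φ x = ψ y * φ z) : Function.Surjective ψ := by
  have := hG.t2Space
  rw [← MonoidHom.range_eq_top]
  refine hG.eq_top_of_sup_relFrattini (isClosed_range_of_compact hψ) ?_
  rw [eq_top_iff]
  intro g _
  obtain ⟨x, rfl⟩ := hs g
  obtain ⟨y, z, hz, hyz⟩ := h x
  rw [hyz]
  refine Subgroup.mul_mem_sup ⟨y, rfl⟩ ?_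
  rw [← Subgroup.map_top_of_surjective φ hs, ← map_relFrattini φ hφ hs]
  exact Subgroup.mem_map_of_mem φ (mem_frattini_iff.2 hz)

lemma exists_surjective_of_genRank (hG : IsProPGroup p G) (h : genRank G = n) :
    ∃ φ : FreeProP p n →ₜ* G, Function.Surjective φ := by
  have := hG.t2Space
  have hne : Nonempty {S : Set G // Dense (Subgroup.closure S : Set G)} := ⟨⟨Set.univ, by simp⟩⟩
  obtain ⟨⟨S, hS⟩, hSn⟩ := ENat.exists_eq_iInf
    (fun S : {S : Set G // Dense (Subgroup.closure S : Set G)} => S.1.encard)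
  have hcard : S.encard = n := hSn.trans h
  have hfin : S.Finite := Set.finite_of_encard_eq_coe hcard
  have hn : Nat.card S = n := by
    have := hfin.cast_ncard_eq
    rw [hcard] at this
    exact_mod_cast this
  have := hfin.to_subtype
  let e : Fin n ≃ S := (Finite.equivFinOfCardEq hn).symm
  obtain ⟨φ, hφ⟩ := exists_freeProP_lift hG fun i => (e i : G)
  refine ⟨φ, ?_⟩
  have hc : IsClosed (φ.toMonoidHom.range : Set G) := isClosed_range_of_compact φ.continuous
  have hle : Subgroup.closure S ≤ φ.toMonoidHom.range := by
    rw [Subgroup.closure_le]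
    intro s hs
    obtain ⟨i, hi⟩ := e.surjective ⟨s, hs⟩
    exact ⟨freeGen p i, (hφ i).trans (congrArg Subtype.val hi)⟩
  intro g
  exact closure_minimal hle hc (hS g)

-- The coordinates descend to `G`, and the image of a generating set spans `𝔽_p ^ n`.
omit [IsTopologicalGroup G] in
lemma le_genRank {φ : FreeProP p n →ₜ* G} [T2Space G] (hs : Function.Surjective φ)
    (hker : ∀ x, φ x = 1 → coord x = 0) : n ≤ genRank G := by
  refine le_iInf fun S => ?_
  obtain ⟨S, hS⟩ := S
  by_contra! hlt
  have hfin : S.Finite := Set.finite_of_encard_le_coe hlt.le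
  obtain ⟨c, hc, hcφ⟩ := exists_factor φ.toMonoidHom φ.continuous hs (coordHom p n).toMonoidHom
    (coordHom p n).continuous fun x hx => mem_ker_coordHom.2 (hker x hx)
  let A : Set (Fin n → ZMod p) := (fun g => (c g).toAdd) '' S
  have hA : A.Finite := hfin.image _
  let V := Submodule.span (ZMod p) A
  let W : Subgroup G := (AddSubgroup.toSubgroup V.toAddSubgroup).comap c
  have hWc : IsClosed (W : Set G) := by
    have : IsClosed {v : Multiplicative (Fin n → ZMod p) | v.toAdd ∈ V} :=
      (isClosed_discrete (V : Set (Fin n → ZMod p))).preimage continuous_toAdd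
    exact this.preimage hc
  have hSW : Subgroup.closure S ≤ W := by
    rw [Subgroup.closure_le]
    exact fun s hs => Submodule.subset_span ⟨s, hs, rfl⟩
  have hW : ∀ g, g ∈ W := fun g => closure_minimal hSW hWc (hS g)
  have hV : V = ⊤ := by
    rw [eq_top_iff]
    intro v _
    obtain ⟨x, rfl⟩ := coord_surjective v
    have h1 : (c (φ x)).toAdd ∈ V := hW (φ x)
    have h2 : c (φ x) = coordHom p n x := hcφ x
    rwa [h2] at h1
  have h1 : Module.finrank (ZMod p) V ≤ A.ncard := by
    have := hA.fintype
    rw [Set.ncard_eq_toFinset_card']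
    exact finrank_span_le_card A
  rw [hV, finrank_top, Module.finrank_fin_fun] at h1
  have h2 : A.ncard ≤ S.ncard := Set.ncard_image_le hfin
  have h3 : (S.ncard : ℕ∞) < n := by rwa [hfin.cast_ncard_eq]
  have h4 : S.ncard < n := by exact_mod_cast h3
  omega

lemma genRank_le {φ : FreeProP p n →ₜ* G} (hs : Function.Surjective φ) : genRank G ≤ n := by
  have hd : Dense (Subgroup.closure (Set.range fun i => φ (freeGen p i)) : Set G) := by
    intro g
    obtain ⟨x, rfl⟩ := hs g
    let T := (Subgroup.closure (Set.range fun i => φ (freeGen p i))).topologicalClosure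
    have hT : T.comap φ.toMonoidHom = ⊤ := eq_top_of_freeGen_mem
      ((Subgroup.isClosed_topologicalClosure _).preimage φ.continuous)
      fun i => Subgroup.le_topologicalClosure _ (Subgroup.subset_closure ⟨i, rfl⟩)
    have : x ∈ T.comap φ.toMonoidHom := hT ▸ Subgroup.mem_top x
    exact this
  refine (iInf_le _ ⟨_, hd⟩).trans ?_
  refine (Set.encard_le_encard (Set.image_univ.ge)).trans ((Set.encard_image_le _ _).trans ?_)
  simp

/-- The kernel of a surjection `F_n → G` with `d(G) = n` is contained in the Frattini subgroup. -/
lemma coord_eq_zero_of_genRank (hG : IsProPGroup p G) {φ : FreeProP p n →ₜ* G}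
    (hs : Function.Surjective φ) (h : genRank G = n) {x : FreeProP p n} (hx : φ x = 1) :
    coord x = 0 := by
  have := hG.t2Space
  by_contra hne
  obtain ⟨i, hi⟩ : ∃ i, coord x i ≠ 0 := by
    by_contra! hall
    exact hne (funext hall)
  -- Since the `i`-th coordinate of the relation `x` is nonzero, the `i`-th generator is redundant
  -- modulo the Frattini subgroup; the remaining `n - 1` generators contradict the rank.
  let S : Set G := (fun j => φ (freeGen p j)) '' {j | j ≠ i}
  let T : Subgroup G := (Subgroup.closure S).topologicalClosure
  have hT : T = ⊤ := by
    refine hG.eq_top_of_sup_relFrattini (Subgroup.isClosed_topologicalClosure _) ?_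
    have hmap := map_relFrattini (p := p) φ.toMonoidHom φ.continuous hs ⊤
    rw [Subgroup.map_top_of_surjective _ hs] at hmap
    have hW : (T ⊔ relFrattini p ⊤).comap φ.toMonoidHom = ⊤ := by
      refine eq_top_of_span_coord (A := insert (coord x) ((fun j => Pi.single j 1) '' {j | j ≠ i}))
        ?_ ?_ ?_
      · rw [← Subgroup.map_le_iff_le_comap, hmap]
        exact le_sup_right
      · rintro a (rfl | ⟨j, hj, rfl⟩)
        · refine ⟨x, ?_, rfl⟩
          change φ x ∈ (T ⊔ relFrattini p ⊤ : Subgroup G)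
          rw [hx]
          exact Subgroup.one_mem _
        · refine ⟨freeGen p j, ?_, coord_freeGen j⟩
          exact Subgroup.mem_sup_left (Subgroup.le_topologicalClosure _
            (Subgroup.subset_closure ⟨j, hj, rfl⟩))
      · rw [eq_top_iff, ← span_single_eq_top, Submodule.span_le]
        set V := Submodule.span (ZMod p)
          (insert (coord x) ((fun j => (Pi.single j 1 : Fin n → ZMod p)) '' {j | j ≠ i}))
        have hj : ∀ j, j ≠ i → (Pi.single j 1 : Fin n → ZMod p) ∈ V := fun j hj =>
          Submodule.subset_span (Or.inr ⟨j, hj, rfl⟩)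
        rintro _ ⟨j, rfl⟩
        by_cases hji : j = i
        · subst hji
          have h1 : coord x = ∑ k, coord x k • (Pi.single k 1 : Fin n → ZMod p) :=
            pi_eq_sum_univ' (coord x)
          rw [← Finset.add_sum_erase _ _ (Finset.mem_univ j)] at h1
          have h2 : (Pi.single j 1 : Fin n → ZMod p) = (coord x j)⁻¹ • (coord x -
              ∑ k ∈ Finset.univ.erase j, coord x k • (Pi.single k 1 : Fin n → ZMod p)) := by
            nth_rewrite 2 [h1]
            rw [add_sub_cancel_right, smul_smul, inv_mul_cancel₀ hi, one_smul]
          change (Pi.single j 1 : Fin n → ZMod p) ∈ V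
          rw [h2]
          refine V.smul_mem _ (V.sub_mem (Submodule.subset_span (Or.inl rfl)) ?_)
          exact V.sum_mem fun k hk => V.smul_mem _ (hj k (Finset.ne_of_mem_erase hk))
        · exact hj j hji
    rw [← Subgroup.map_comap_eq_self_of_surjective (f := φ.toMonoidHom) hs (T ⊔ relFrattini p ⊤),
      hW, Subgroup.map_top_of_surjective _ hs]
  have hd : Dense (Subgroup.closure S : Set G) := by
    intro g
    have : g ∈ T := hT ▸ Subgroup.mem_top g
    exact this
  have h1 : genRank G ≤ S.encard := iInf_le
    (fun S : {S : Set G // Dense (Subgroup.closure S : Set G)} => S.1.encard) ⟨S, hd⟩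
  have h2 : S.encard ≤ ({j | j ≠ i} : Set (Fin n)).encard := Set.encard_image_le _ _
  have h3 : ({j | j ≠ i} : Set (Fin n)).encard < (Set.univ : Set (Fin n)).encard := by
    refine Set.Finite.encard_lt_encard (Set.toFinite _) ?_
    refine ⟨Set.subset_univ _, fun h => ?_⟩
    exact h (Set.mem_univ i) rfl
  rw [h] at h1
  have h4 := (h1.trans h2).trans_lt h3
  simp at h4

end Surjections

/-! ### Automorphisms of `F_n` and independence of the presentation -/

section Automorphisms

variable {p n : ℕ} [hp : Fact p.Prime]

/-- Freeness gives a right inverse `β` of `α`. As the kernel of `α` is in the Frattini subgroup, `β`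
is onto, and so `α` is injective. -/
lemma freeProP_bijective {α : FreeProP p n →ₜ* FreeProP p n} (hs : Function.Surjective α)
    (hker : ∀ x, α x = 1 → coord x = 0) : Function.Bijective α := by
  choose f hf using fun i => hs (freeGen p i)
  obtain ⟨β, hβ⟩ := exists_freeProP_lift isProPGroup_freeProP f
  have hαβ : ∀ x, α (β x) = x := by
    have h := freeProP_hom_ext (φ := α.toMonoidHom.comp β.toMonoidHom)
      (ψ := MonoidHom.id (FreeProP p n)) (α.continuous.comp β.continuous) continuous_id
      fun i => (congrArg α (hβ i)).trans (hf i)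
    exact fun x => DFunLike.congr_fun h x
  have hβs : Function.Surjective β := by
    refine surjective_of_frattini (φ := MonoidHom.id (FreeProP p n)) (ψ := β.toMonoidHom)
      isProPGroup_freeProP continuous_id β.continuous Function.surjective_id fun x => ?_
    refine ⟨α x, (β (α x))⁻¹ * x, hker _ ?_, ?_⟩
    · rw [map_mul, map_inv, hαβ]
      simp
    · change x = β (α x) * ((β (α x))⁻¹ * x)
      simp
  refine ⟨(injective_iff_map_eq_one α).2 fun x hx => ?_, hs⟩
  obtain ⟨y, rfl⟩ := hβs x
  rw [hαβ] at hx
  rw [hx, map_one]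

/-- The surjections from `F_n` to a pro-`p`-group of rank `n` are conjugate under the
automorphisms of `F_n`. -/
lemma exists_automorphism {A : Type*} [Group A] [TopologicalSpace A] [IsTopologicalGroup A]
    (hA : IsProPGroup p A) {φ ψ : FreeProP p n →ₜ* A} (hφ : Function.Surjective φ)
    (hψ : Function.Surjective ψ) (hφk : ∀ x, φ x = 1 → coord x = 0)
    (hψk : ∀ x, ψ x = 1 → coord x = 0) :
    ∃ α : FreeProP p n ≃ₜ* FreeProP p n, ∀ x, ψ (α x) = φ x := by
  have := hA.t2Space
  choose f hf using fun i => hψ (φ (freeGen p i))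
  obtain ⟨α, hα⟩ := exists_freeProP_lift isProPGroup_freeProP f
  have hαψ : ∀ x, ψ (α x) = φ x := by
    have h := freeProP_hom_ext (φ := ψ.toMonoidHom.comp α.toMonoidHom)
      (ψ := φ.toMonoidHom) (ψ.continuous.comp α.continuous) φ.continuous
      fun i => (congrArg ψ (hα i)).trans (hf i)
    exact fun x => DFunLike.congr_fun h x
  have hαs : Function.Surjective α := by
    refine surjective_of_frattini (φ := MonoidHom.id (FreeProP p n)) (ψ := α.toMonoidHom)
      isProPGroup_freeProP continuous_id α.continuous Function.surjective_id fun x => ?_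
    obtain ⟨y, hy⟩ := hφ (ψ x)
    refine ⟨y, (α y)⁻¹ * x, hψk _ ?_, ?_⟩
    · rw [map_mul, map_inv, hαψ, hy]
      simp
    · change x = α y * ((α y)⁻¹ * x)
      simp
  have hb := freeProP_bijective hαs fun x hx => hφk x (by rw [← hαψ, hx, map_one])
  refine ⟨{ MulEquiv.ofBijective α.toMonoidHom hb with
    continuous_toFun := α.continuous
    continuous_invFun := (Continuous.homeoOfEquivCompactToT2
      (f := (MulEquiv.ofBijective α.toMonoidHom hb).toEquiv) α.continuous).symm.continuous }, hαψ⟩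

omit hp in
lemma presentation_spec {G : Type*} [Group G] [TopologicalSpace G]
    {φ : FreeProP p n →ₜ* G} (hs : Function.Surjective φ) :
    ∃ ψ : FreeProP p n →ₜ* G, Function.Surjective ψ ∧ presentation p n G = ψ.toMonoidHom := by
  have h : ∃ φ : FreeProP p n →ₜ* G, Function.Surjective φ := ⟨φ, hs⟩
  exact ⟨h.choose, h.choose_spec, dif_pos h⟩

/-- The kernel of the chosen presentation is the image of any other kernel under an
automorphism. -/
lemma exists_automorphism_relSubgroup {G : Type*} [Group G] [TopologicalSpace G]
    [IsTopologicalGroup G] (hG : IsProPGroup p G) {φ : FreeProP p n →ₜ* G}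
    (hs : Function.Surjective φ) (hker : ∀ x, φ x = 1 → coord x = 0) :
    ∃ α : FreeProP p n ≃ₜ* FreeProP p n, (∀ x, presentation p n G (α x) = φ x) ∧
      relSubgroup p n G = φ.toMonoidHom.ker.map (α : FreeProP p n →* FreeProP p n) := by
  have := hG.t2Space
  obtain ⟨ψ, hψ, hp⟩ := presentation_spec hs
  have hr : genRank G = n := le_antisymm (genRank_le hs) (le_genRank hs hker)
  obtain ⟨α, hα⟩ := exists_automorphism hG hs hψ hker
    fun x hx => coord_eq_zero_of_genRank hG hψ hr hx
  refine ⟨α, fun x => by rw [hp]; exact hα x, ?_⟩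
  ext x
  obtain ⟨x, rfl⟩ := α.surjective x
  rw [relSubgroup, hp]
  constructor
  · intro h
    exact ⟨x, (hα x).symm.trans h, rfl⟩
  · rintro ⟨y, hy, hyx⟩
    have : y = x := α.injective hyx
    subst this
    exact (hα y).trans hy

/-- The given surjection and the chosen presentation differ by an automorphism of `F_n`, which
preserves `E`. From here on any presentation with kernel in the Frattini subgroup may be used. -/
lemma charSubgroup_eq {G : Type*} [Group G] [TopologicalSpace G] [IsTopologicalGroup G]
    (hG : IsProPGroup p G) {φ : FreeProP p n →ₜ* G}
    (hs : Function.Surjective φ) (hker : ∀ x, φ x = 1 → coord x = 0)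
    {E : Subgroup (FreeProP p n)} (hE : IsTopCharacteristic E) :
    charSubgroup G E = E.map φ.toMonoidHom := by
  obtain ⟨α, hα, -⟩ := exists_automorphism_relSubgroup hG hs hker
  rw [charSubgroup]
  nth_rewrite 1 [← hE α]
  rw [Subgroup.map_map]
  congr 1
  ext x
  exact hα x

/-- A proper open characteristic subgroup is contained in the Frattini subgroup. -/
lemma coord_eq_zero_of_isTopCharacteristic {D : Subgroup (FreeProP p n)}
    (hD : IsTopCharacteristic D) (hO : IsOpen (D : Set (FreeProP p n))) (hne : D ≠ ⊤)
    {x : FreeProP p n} (hx : x ∈ D) : coord x = 0 := by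
  by_contra hx0
  refine hne (isProPGroup_freeProP.eq_top_of_sup_relFrattini (Subgroup.isClosed_of_isOpen D hO) ?_)
  refine eq_top_of_span_coord (A := {0}ᶜ) le_sup_right ?_ ?_
  · intro u hu
    replace hu : u ≠ 0 := hu
    -- A linear automorphism carrying `coord x` to `u` lifts to an automorphism of `F_n`. As `D` is
    -- characteristic, one nonzero coordinate vector in its image therefore yields all of them.
    obtain ⟨A, hA⟩ := Submodule.exists_linearEquiv_restrict_eq
      ((LinearEquiv.toSpanNonzeroSingleton (ZMod p) _ (coord x) hx0).symm ≪≫ₗ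
        LinearEquiv.toSpanNonzeroSingleton (ZMod p) _ u hu)
    have hAx : A (coord x) = u := by
      have h := hA ⟨coord x, Submodule.mem_span_singleton_self _⟩
      rw [← h]
      have h2 : (⟨coord x, Submodule.mem_span_singleton_self _⟩ :
          Submodule.span (ZMod p) {coord x}) =
          LinearEquiv.toSpanNonzeroSingleton (ZMod p) _ (coord x) hx0 1 := by
        apply Subtype.ext
        simp
      rw [h2, LinearEquiv.trans_apply, LinearEquiv.symm_apply_apply]
      simp
    let B : Multiplicative (Fin n → ZMod p) →* Multiplicative (Fin n → ZMod p) :=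
      AddMonoidHom.toMultiplicative (A : (Fin n → ZMod p) →+ (Fin n → ZMod p))
    have : DiscreteTopology (Multiplicative (Fin n → ZMod p)) :=
      inferInstanceAs (DiscreteTopology (Fin n → ZMod p))
    let φ : FreeProP p n →ₜ* Multiplicative (Fin n → ZMod p) :=
      ⟨B.comp (coordHom p n).toMonoidHom,
        (continuous_of_discreteTopology (f := B)).comp (coordHom p n).continuous⟩
    have hφ : ∀ y, (φ y).toAdd = A (coord y) := fun y => rfl
    obtain ⟨α, hα⟩ := exists_automorphism (isProPGroup_multiplicative_pi n) (φ := φ)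
      (ψ := coordHom p n) (fun v => by
        obtain ⟨y, hy⟩ := coord_surjective (A.symm v.toAdd)
        refine ⟨y, Multiplicative.toAdd.injective ?_⟩
        rw [hφ, hy, A.apply_symm_apply])
      (fun v => coord_surjective v.toAdd) (fun y hy => by
        have h := hφ y
        rw [hy] at h
        exact (A.map_eq_zero_iff).1 h.symm)
      (fun y hy => hy)
    refine ⟨α x, Subgroup.mem_sup_left (hD.apply_mem α hx), ?_⟩
    rw [← hAx, ← hφ, ← hα]
    rfl
  · rw [eq_top_iff]
    intro v _
    by_cases hv : v = 0
    · rw [hv]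
      exact Submodule.zero_mem _
    · exact Submodule.subset_span hv

end Automorphisms

/-! ### Splitting of continuous 2-cocycles of `F_n` -/

section Splitting

variable {p : ℕ} {F : Type*} [Group F] [TopologicalSpace F] [IsTopologicalGroup F]

/-- Normalized continuous `2`-cocycles with values in `𝔽_p`. -/
structure TwoCocycle (p : ℕ) (F : Type*) [Group F] [TopologicalSpace F] where
  /-- The underlying function. -/
  toFun : C(F × F, ZMod p)
  map_one_right : ∀ x, toFun (x, 1) = 0
  map_one_left : ∀ x, toFun (1, x) = 0
  cocycle : ∀ x y z, toFun (x, y) + toFun (x * y, z) = toFun (y, z) + toFun (x, y * z)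

/-- The central extension of `F` by `𝔽_p` that is given by a cocycle. -/
def TwoCocycle.Extension (_ : TwoCocycle p F) : Type _ := ZMod p × F

namespace TwoCocycle

variable (c : TwoCocycle p F)

instance : TopologicalSpace c.Extension := inferInstanceAs (TopologicalSpace (ZMod p × F))

instance : Group c.Extension where
  mul u v := (u.1 + v.1 + c.toFun (u.2, v.2), u.2 * v.2)
  one := ((0 : ZMod p), (1 : F))
  inv u := (-u.1 - c.toFun (u.2⁻¹, u.2), u.2⁻¹)
  mul_assoc u v w := by
    refine Prod.ext ?_ (mul_assoc u.2 v.2 w.2)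
    change u.1 + v.1 + c.toFun (u.2, v.2) + w.1 + c.toFun (u.2 * v.2, w.2) =
      u.1 + (v.1 + w.1 + c.toFun (v.2, w.2)) + c.toFun (u.2, v.2 * w.2)
    linear_combination c.cocycle u.2 v.2 w.2
  one_mul u := by
    refine Prod.ext ?_ (one_mul u.2)
    change 0 + u.1 + c.toFun (1, u.2) = u.1
    rw [c.map_one_left, zero_add, add_zero]
  mul_one u := by
    refine Prod.ext ?_ (mul_one u.2)
    change u.1 + 0 + c.toFun (u.2, 1) = u.1
    rw [c.map_one_right, add_zero, add_zero]
  inv_mul_cancel u := by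
    refine Prod.ext ?_ (inv_mul_cancel u.2)
    change -u.1 - c.toFun (u.2⁻¹, u.2) + u.1 + c.toFun (u.2⁻¹, u.2) = 0
    ring

instance : IsTopologicalGroup c.Extension where
  continuous_mul := by
    change Continuous fun q : (ZMod p × F) × (ZMod p × F) =>
      (q.1.1 + q.2.1 + c.toFun (q.1.2, q.2.2), q.1.2 * q.2.2)
    fun_prop
  continuous_inv := by
    change Continuous fun u : ZMod p × F => (-u.1 - c.toFun (u.2⁻¹, u.2), u.2⁻¹)
    fun_prop

/-- The projection of the extension to `F`. -/
def proj : c.Extension →* F where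
  toFun u := u.2
  map_one' := rfl
  map_mul' _ _ := rfl

omit [IsTopologicalGroup F] in
lemma continuous_proj : Continuous c.proj := continuous_snd

omit [IsTopologicalGroup F] in
lemma proj_surjective : Function.Surjective c.proj := fun x => ⟨((0 : ZMod p), x), rfl⟩

omit [IsTopologicalGroup F] in
lemma card_ker_proj : Nat.card c.proj.ker = p := by
  let e : ZMod p ≃ c.proj.ker :=
    { toFun := fun a => ⟨(a, (1 : F)), rfl⟩
      invFun := fun u => u.1.1
      left_inv := fun _ => rfl
      right_inv := fun u => Subtype.ext (Prod.ext rfl u.2.symm) }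
  rw [← Nat.card_congr e, Nat.card_zmod]

/-- The index of `U` is the index of its image in `F` times a divisor of the order `p` of the kernel
of `proj`. -/
lemma isProPGroup_extension [Fact p.Prime] (hF : IsProPGroup p F) : IsProPGroup p c.Extension := by
  have := hF.compactSpace
  have := hF.totallyDisconnectedSpace
  refine ⟨inferInstanceAs (CompactSpace (ZMod p × F)),
    inferInstanceAs (TotallyDisconnectedSpace (ZMod p × F)), fun U hU hUo => ?_⟩
  obtain ⟨k, hk⟩ := hF.index_eq (U.map c.proj) (hU.map _ c.proj_surjective)
    ((isOpenMap_snd : IsOpenMap (Prod.snd : ZMod p × F → F)) _ hUo)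
  have h1 : (U ⊔ c.proj.ker).index = p ^ k := by
    rw [← hk, Subgroup.index_map, MonoidHom.range_eq_top.2 c.proj_surjective, Subgroup.index_top,
      mul_one]
  have h2 : U.relIndex (U ⊔ c.proj.ker) ∣ p := by
    rw [sup_comm, Subgroup.relIndex_sup_right]
    have := Subgroup.index_dvd_card (U.subgroupOf c.proj.ker)
    rwa [card_ker_proj] at this
  refine exists_index_eq_pow_of_dvd (k := 1 + k) ?_
  rw [← Subgroup.relIndex_mul_index (le_sup_left : U ≤ U ⊔ c.proj.ker), h1, pow_add, pow_one]
  exact mul_dvd_mul_right h2 _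

end TwoCocycle

/-- Continuous `2`-cocycles of a free pro-`p`-group are coboundaries. -/
lemma freeProP_cocycle_split [Fact p.Prime] {n : ℕ} (c : TwoCocycle p (FreeProP p n)) :
    ∃ b : C(FreeProP p n, ZMod p), ∀ x y, b (x * y) = b x + b y + c.toFun (x, y) := by
  -- By freeness the extension has a continuous section `s`, and the first component of `s` splits
  -- the cocycle.
  obtain ⟨s, hs⟩ := exists_freeProP_lift (c.isProPGroup_extension isProPGroup_freeProP)
    fun i => ((0 : ZMod p), freeGen p i)
  have h1 : c.proj.comp s.toMonoidHom = MonoidHom.id _ :=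
    freeProP_hom_ext (c.continuous_proj.comp s.continuous) continuous_id
      fun i => congrArg Prod.snd (hs i)
  have h2 : ∀ x, (s x).2 = x := DFunLike.congr_fun h1
  have hc : Continuous fun x => (s x).1 :=
    (continuous_fst : Continuous (Prod.fst : ZMod p × FreeProP p n → ZMod p)).comp s.continuous
  refine ⟨⟨fun x => (s x).1, hc⟩, fun x y => ?_⟩
  change (s (x * y)).1 = (s x).1 + (s y).1 + c.toFun (x, y)
  rw [map_mul s]
  change (s x).1 + (s y).1 + c.toFun ((s x).2, (s y).2) = _
  rw [h2, h2]

end Splitting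

/-! ### Kernel and image of the transgression -/

section Transgression

open TopRep CategoryTheory

variable {p : ℕ} {F G : Type} [Group F] [TopologicalSpace F]
  [IsTopologicalGroup F] [Group G] [TopologicalSpace G] [IsTopologicalGroup G]

omit [IsTopologicalGroup F] [IsTopologicalGroup G] in
lemma isQuotientMap_tripleMap [CompactSpace F] [T2Space G] {φ : F →ₜ* G}
    (hs : Function.Surjective φ) : Topology.IsQuotientMap (tripleMap φ) :=
  isQuotientMap_of_compact (tripleMap φ).continuous ((hs.prodMap hs).prodMap hs)

variable (φ : F →ₜ* G) (hφ : Topology.IsQuotientMap (tripleMap φ))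

/-- If `b` vanishes on the kernel, then `b (x⁻¹ * y)` descends to a homogeneous 1-cochain on `G`,
whose coboundary is the given cocycle. Thus the class only depends on the restriction of `b` to the
kernel. -/
lemma transgression_eq_zero_of_ker [CompactSpace F] [T2Space G] (b : kerAdditive p φ)
    (hb : ∀ r, φ r = 1 → b.1 r = 0) : transgression φ hφ b = 0 := by
  have hs := surjective_of_tripleMap φ hφ
  have hs2 : Topology.IsQuotientMap (Prod.map φ φ) :=
    isQuotientMap_of_compact (by fun_prop) (hs.prodMap hs)
  let B : C(F × F, ZMod p) := ⟨fun q => b.1 (q.1⁻¹ * q.2), by fun_prop⟩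
  let P : C(F × F, G × G) := ⟨Prod.map φ φ, by fun_prop⟩
  have hP : Function.FactorsThrough B P := by
    rintro ⟨x, y⟩ ⟨x', y'⟩ h
    obtain ⟨hx, hy⟩ : φ x = φ x' ∧ φ y = φ y' := Prod.mk.inj h
    obtain ⟨u, hu, rfl⟩ : ∃ u, φ u = 1 ∧ x' = x * u := ⟨x⁻¹ * x', by simp [hx], by simp⟩
    obtain ⟨v, hv, rfl⟩ : ∃ u, φ u = 1 ∧ y' = y * u := ⟨y⁻¹ * y', by simp [hy], by simp⟩
    change b.1 (x⁻¹ * y) = b.1 ((x * u)⁻¹ * (y * v))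
    have h1 : (x * u)⁻¹ * (y * v) = u⁻¹ * (x⁻¹ * y * v) := by group
    have hu' : φ u⁻¹ = 1 := by simp [hu]
    rw [h1, (b.2 _ _ hu').2, (b.2 _ _ hv).1, hb _ hu', hb _ hv, add_zero, zero_add]
  let Y : C(G × G, ZMod p) := hs2.lift (f := P) B hP
  have hY : ∀ x y, Y (φ x, φ y) = b.1 (x⁻¹ * y) := fun x y =>
    congr($(hs2.lift_comp (f := P) B hP) (x, y))
  refine (cocycleClass_eq_zero_iff (homogeneousCochains (trivialFp p G)) 1 _).2 ?_
  refine ⟨⟨Y.curry, (mem_invariants_two_iff p).2 fun g x y => ?_⟩, ?_⟩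
  · obtain ⟨g, rfl⟩ := hs g
    obtain ⟨x, rfl⟩ := hs x
    obtain ⟨y, rfl⟩ := hs y
    change Y (φ g * φ x, φ g * φ y) = Y (φ x, φ y)
    rw [← map_mul φ, ← map_mul φ, hY, hY]
    congr 1
    group
  · refine Subtype.ext ((homogeneousCochains.d_apply _ 1 _).trans ?_)
    refine ContinuousMap.ext fun u => ContinuousMap.ext fun v => ContinuousMap.ext fun w => ?_
    obtain ⟨u, rfl⟩ := hs u
    obtain ⟨v, rfl⟩ := hs v
    obtain ⟨w, rfl⟩ := hs w
    refine Eq.trans ?_ (transgressionCochain_apply φ hφ b u v w).symm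
    change Y (φ v, φ w) - (Y (φ u, φ w) - Y (φ u, φ v)) = _
    rw [hY, hY, hY]
    ring

variable {n : ℕ} [Fact p.Prime]

lemma transgression_surjective_freeProP [LocallyCompactSpace G] (φ : FreeProP p n →ₜ* G)
    (hφ : Topology.IsQuotientMap (tripleMap φ)) :
    Function.Surjective (transgression (p := p) φ hφ) :=
  transgression_surjective φ hφ fun c h1 h2 h3 => freeProP_cocycle_split ⟨c, h1, h2, h3⟩

end Transgression

/-! ### The inversion of the generators and equivariant presentations -/

section InversionAutomorphism

variable (p n : ℕ) [hp : Fact p.Prime]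

lemma exists_invAut : ∃ σ : FreeProP p n ≃ₜ* FreeProP p n,
    (∀ x, σ (σ x) = x) ∧ ∀ i, σ (freeGen p i) = (freeGen p i)⁻¹ := by
  obtain ⟨s, hs⟩ := exists_freeProP_lift (p := p) (n := n) isProPGroup_freeProP
    fun i => (freeGen p i)⁻¹
  have h : s.toMonoidHom.comp s.toMonoidHom = MonoidHom.id _ :=
    freeProP_hom_ext (s.continuous.comp s.continuous) continuous_id fun i => by
      change s (s (freeGen p i)) = freeGen p i
      rw [hs, map_inv s, hs, inv_inv]
  have h2 : ∀ x, s (s x) = x := DFunLike.congr_fun h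
  exact ⟨{ s with
    invFun := s
    left_inv := h2
    right_inv := h2
    continuous_toFun := s.continuous
    continuous_invFun := s.continuous }, h2, hs⟩

/-- The automorphism of order two of `F_n` that inverts the generators. -/
noncomputable def invAut : FreeProP p n ≃ₜ* FreeProP p n := (exists_invAut p n).choose

variable {p n}

lemma invAut_invAut (x : FreeProP p n) : invAut p n (invAut p n x) = x :=
  (exists_invAut p n).choose_spec.1 x

lemma invAut_freeGen (i : Fin n) : invAut p n (freeGen p i) = (freeGen p i)⁻¹ :=
  (exists_invAut p n).choose_spec.2 i

lemma coord_invAut (x : FreeProP p n) : coord (invAut p n x) = - coord x := by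
  have h := freeProP_hom_ext
    (φ := (coordHom p n).toMonoidHom.comp (invAut p n).toMulEquiv.toMonoidHom)
    (ψ := ((coordHom p n).toMonoidHom)⁻¹)
    ((coordHom p n).continuous.comp (invAut p n).continuous) (coordHom p n).continuous.inv
    fun i => by
      change coordHom p n (invAut p n (freeGen p i)) = (coordHom p n (freeGen p i))⁻¹
      rw [invAut_freeGen, map_inv (coordHom p n)]
  exact congrArg Multiplicative.toAdd (DFunLike.congr_fun h x)

variable {G : Type*} [Group G] [TopologicalSpace G] [IsTopologicalGroup G]

/-- A group with an action of a group of order two that is `-1` on the homomorphisms to `𝔽_p`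
has an equivariant presentation. -/
lemma exists_equivariant_presentation (h2 : p ≠ 2) (hG : IsProPGroup p G) (hn : genRank G = n)
    (σ : G ≃ₜ* G) (hσ : ∀ x, σ (σ x) = x)
    (hodd : ∀ f ∈ contHom p G, ∀ x, f (σ x) = - f x) :
    ∃ φ : FreeProP p n →ₜ* G, Function.Surjective φ ∧ (∀ x, φ x = 1 → coord x = 0) ∧
      ∀ x, φ (invAut p n x) = σ (φ x) := by
  have := hG.t2Space
  have h2' : (2 : ZMod p) ≠ 0 := by
    have := (Nat.coprime_primes Nat.prime_two hp.out).2 h2.symm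
    have := (ZMod.unitOfCoprime 2 this).ne_zero
    simpa using this
  obtain ⟨ψ, hψ⟩ := exists_surjective_of_genRank hG hn
  -- Each generator `g` is replaced by the odd element `g * (σ g)⁻¹`. Modulo the Frattini subgroup
  -- this is `g ^ 2`, as `σ` acts by `-1` there; for odd `p` these elements still generate.
  obtain ⟨φ, hφ⟩ := exists_freeProP_lift hG fun i => ψ (freeGen p i) * (σ (ψ (freeGen p i)))⁻¹
  obtain ⟨c, hc, hcψ⟩ := exists_factor ψ.toMonoidHom ψ.continuous hψ (coordHom p n).toMonoidHom
    (coordHom p n).continuous fun x hx =>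
      mem_ker_coordHom.2 (coord_eq_zero_of_genRank hG hψ hn hx)
  have hcσ : ∀ g, c (σ g) = (c g)⁻¹ := fun g => by
    refine Multiplicative.toAdd.injective (funext fun i => ?_)
    refine hodd ⟨fun g => (c g).toAdd i, (continuous_apply i).comp hc⟩ (fun x y => ?_) g
    change (c (x * y)).toAdd i = _
    rw [map_mul]
    rfl
  have hcφ : c.comp φ.toMonoidHom = (coordHom p n).toMonoidHom ^ 2 :=
    freeProP_hom_ext (hc.comp φ.continuous) ((coordHom p n).continuous.pow 2) fun i => by
      change c (φ (freeGen p i)) = (coordHom p n (freeGen p i)) ^ 2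
      have h1 : c (ψ (freeGen p i)) = coordHom p n (freeGen p i) := hcψ _
      rw [hφ, map_mul, map_inv, hcσ, inv_inv, h1, sq]
  have hcφ' : ∀ x, (c (φ x)).toAdd = (2 : ZMod p) • coord x := fun x => by
    have h1 : (c (φ x)).toAdd = coord (x ^ 2) := congrArg Multiplicative.toAdd
      ((DFunLike.congr_fun hcφ x).trans (map_pow (coordHom p n) x 2).symm)
    rw [h1, coord_pow, two_nsmul, two_smul]
  have hs : Function.Surjective φ := by
    refine surjective_of_frattini (φ := ψ.toMonoidHom) (ψ := φ.toMonoidHom) hG ψ.continuous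
      φ.continuous hψ fun x => ?_
    obtain ⟨y, hy⟩ := coord_surjective (p := p) ((2 : ZMod p)⁻¹ • coord x)
    obtain ⟨w, hw⟩ := hψ (φ y)
    refine ⟨y, w⁻¹ * x, ?_, ?_⟩
    · have h1 : coord w = (c (φ y)).toAdd := by
        rw [← hw]
        exact (congrArg Multiplicative.toAdd (hcψ w)).symm
      rw [coord_mul, coord_inv, h1, hcφ', hy, smul_inv_smul₀ h2', neg_add_cancel]
    · change ψ x = φ y * ψ (w⁻¹ * x)
      rw [map_mul ψ, map_inv ψ, hw, mul_inv_cancel_left]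
  refine ⟨φ, hs, fun x hx => coord_eq_zero_of_genRank hG hs hn hx, fun x => ?_⟩
  have h := freeProP_hom_ext
    (φ := φ.toMonoidHom.comp (invAut p n).toMulEquiv.toMonoidHom)
    (ψ := σ.toMulEquiv.toMonoidHom.comp φ.toMonoidHom)
    (φ.continuous.comp (invAut p n).continuous) (σ.continuous.comp φ.continuous) fun i => by
      change φ (invAut p n (freeGen p i)) = σ (φ (freeGen p i))
      rw [invAut_freeGen, map_inv φ, hφ, map_mul σ, map_inv σ, hσ, mul_inv_rev, inv_inv]
  exact DFunLike.congr_fun h x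

end InversionAutomorphism

section OddGeneration

variable {p n : ℕ} [hp : Fact p.Prime] {K : Type*} [Group K] [TopologicalSpace K]
  [DiscreteTopology K]

/-- A homomorphism to `𝔽_p` changes sign under `σ` on the odd generators, hence everywhere. -/
lemma HasOddGeneration.exists_equivariant_presentation [Finite K] (hK : HasOddGeneration K)
    (h2 : p ≠ 2) (hp : IsPGroup p K) (hn : genRank K = n) :
    ∃ (σ : K ≃ₜ* K) (φ : FreeProP p n →ₜ* K), Function.Surjective φ ∧
      (∀ x, φ x = 1 → coord x = 0) ∧ ∀ x, φ (invAut p n x) = σ (φ x) := by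
  obtain ⟨σ, hσ, hgen⟩ := hK
  let τ : K ≃ₜ* K := { σ with
    continuous_toFun := continuous_of_discreteTopology
    continuous_invFun := continuous_of_discreteTopology }
  refine ⟨τ, _root_.exists_equivariant_presentation h2 (isProPGroup_of_finite hp) hn τ hσ
    fun f hf x => ?_⟩
  have hx : x ∈ Subgroup.closure {a : K | σ a = a⁻¹} := hgen ▸ Subgroup.mem_top x
  change f (σ x) = _
  induction hx using Subgroup.closure_induction with
  | mem x h => rw [show σ x = x⁻¹ from h, contHom_inv hf]
  | one => rw [map_one, contHom_one hf, neg_zero]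
  | mul x y _ _ hx hy => rw [map_mul, hf, hf, hx, hy, neg_add]
  | inv x _ hx => rw [map_inv, contHom_inv hf, contHom_inv hf, hx]

/-- A group with an equivariant surjection from `F_n` is generated by odd elements. -/
lemma hasOddGeneration_of_equivariant {φ : FreeProP p n →ₜ* K} (hs : Function.Surjective φ)
    (σ : K ≃* K) (hσ : ∀ x, φ (invAut p n x) = σ (φ x)) : HasOddGeneration K := by
  refine ⟨σ, fun x => ?_, ?_⟩
  · obtain ⟨x, rfl⟩ := hs x
    rw [← hσ, ← hσ, invAut_invAut]
  · let S := Subgroup.closure {a : K | σ a = a⁻¹}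
    have h : S.comap φ.toMonoidHom = ⊤ := by
      refine eq_top_of_freeGen_mem ((isClosed_discrete (S : Set K)).preimage φ.continuous)
        fun i => Subgroup.subset_closure ?_
      change σ (φ (freeGen p i)) = (φ (freeGen p i))⁻¹
      rw [← hσ, invAut_freeGen, map_inv φ]
    rw [eq_top_iff]
    intro g _
    obtain ⟨x, rfl⟩ := hs g
    exact (h ▸ Subgroup.mem_top x : x ∈ S.comap φ.toMonoidHom)

end OddGeneration

/-! ### First cohomology of weak Schur `σ`-groups -/

section WeakSchur

variable {p n : ℕ} [hp : Fact p.Prime] {G : Type} [Group G] [TopologicalSpace G]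
  [IsTopologicalGroup G] {σ : G ≃ₜ* G}

lemma IsWeakSchurSigmaGroup.contHom_odd (hG : IsWeakSchurSigmaGroup p G σ) (f : C(G, ZMod p))
    (hf : f ∈ contHom p G) (x : G) : f (σ x) = - f x := by
  let f₁ : contHom p G := ⟨f, hf⟩
  let f₂ : contHom p G := ⟨f.comp ⟨σ, σ.continuous⟩, fun x y => by
    change f (σ (x * y)) = f (σ x) + f (σ y)
    rw [map_mul σ, hf]⟩
  have h := cohomFpAction_homEquivH1 p σ f₁ f₂ fun _ => rfl
  rw [hG.odd_H1, ← map_neg] at h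
  exact (DFunLike.congr_fun (congrArg Subtype.val ((homEquivH1 p).injective h)) x).symm

lemma IsWeakSchurSigmaGroup.exists_equivariant_presentation (hG : IsWeakSchurSigmaGroup p G σ)
    (h2 : p ≠ 2) (hn : genRank G = n) :
    ∃ φ : FreeProP p n →ₜ* G, Function.Surjective φ ∧ (∀ x, φ x = 1 → coord x = 0) ∧
      ∀ x, φ (invAut p n x) = σ (φ x) :=
  _root_.exists_equivariant_presentation h2 hG.isProPGroup hn σ hG.involutive hG.contHom_odd

/-- For a group with `d(G) = n`, the first cohomology group has dimension `n`. -/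
lemma finrank_cohomFp_one [CompactSpace G] [T2Space G] {φ : FreeProP p n →ₜ* G}
    (hs : Function.Surjective φ) (hker : ∀ x, φ x = 1 → coord x = 0) :
    Nonempty (CohomFp p G 1 ≃ₗ[ZMod p] (Fin n → ZMod p)) := by
  let e : contHom p G →ₗ[ZMod p] (Fin n → ZMod p) :=
    { toFun := fun f i => f.1 (φ (freeGen p i))
      map_add' := fun _ _ => rfl
      map_smul' := fun _ _ => rfl }
  have hpull : ∀ f : contHom p G, f.1.comp ⟨φ, φ.continuous⟩ ∈ contHom p (FreeProP p n) :=
    fun f x y => by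
      change f.1 (φ (x * y)) = f.1 (φ x) + f.1 (φ y)
      rw [map_mul φ]
      exact f.2 _ _
  have he : Function.Bijective e := by
    constructor
    · intro f g h
      refine Subtype.ext (ContinuousMap.ext fun x => ?_)
      obtain ⟨x, rfl⟩ := hs x
      exact DFunLike.congr_fun (contHom_ext (hpull f) (hpull g) fun i => congrFun h i) x
    · intro a
      have hq := isQuotientMap_of_compact φ.continuous hs
      let P : C(FreeProP p n, G) := ⟨φ, φ.continuous⟩
      have hP : Function.FactorsThrough (coordComb a) P := by
        intro x y hxy
        have h1 : φ x = φ y := hxy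
        have h3 : coordComb a (x * y⁻¹) = 0 := contHom_eq_zero_of_coord (coordComb_mem a)
          (hker _ (by rw [map_mul φ, map_inv φ, h1, mul_inv_cancel]))
        have h4 := coordComb_mem a (x * y⁻¹) y
        rw [h3, inv_mul_cancel_right, zero_add] at h4
        exact h4
      let f : C(G, ZMod p) := hq.lift (f := P) (coordComb a) hP
      have hf : ∀ x, f (φ x) = coordComb a x := fun x =>
        congr($(hq.lift_comp (f := P) (coordComb a) hP) x)
      refine ⟨⟨f, fun x y => ?_⟩, funext fun i => ?_⟩
      · obtain ⟨x, rfl⟩ := hs x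
        obtain ⟨y, rfl⟩ := hs y
        rw [← map_mul φ, hf, hf, hf]
        exact coordComb_mem a x y
      · exact (hf _).trans (coordComb_freeGen a i)
  exact ⟨(homEquivH1 p).symm.trans (LinearEquiv.ofBijective e he)⟩

end WeakSchur

/-! ### Invariant functionals on normal subgroups -/

section Functionals

variable {p : ℕ} {F : Type*} [Group F] [TopologicalSpace F]

/-- A function on `F` that restricts to a continuous `F`-invariant homomorphism `L → 𝔽_p` on a
subgroup `L`. -/
structure IsInvariantFunctional (L : Subgroup F) (f : F → ZMod p) : Prop where
  map_mul : ∀ l ∈ L, ∀ m ∈ L, f (l * m) = f l + f m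
  map_conj : ∀ g, ∀ l ∈ L, f (g * l * g⁻¹) = f l
  isOpen : IsOpen {l | l ∈ L ∧ f l = 0}

/-- An invariant homomorphism on an open normal subgroup extends to the whole group as a function
that is additive with respect to the subgroup. -/
lemma IsInvariantFunctional.exists_extension [IsTopologicalGroup F] {L : Subgroup F}
    [hL : L.Normal] {f : F → ZMod p} (hf : IsInvariantFunctional L f) :
    ∃ b : C(F, ZMod p), (∀ l ∈ L, b l = f l) ∧
      ∀ x, ∀ l ∈ L, b (x * l) = b x + b l ∧ b (l * x) = b l + b x := by
  let s : F → F := fun x => (QuotientGroup.mk x : F ⧸ L).out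
  have hs : ∀ x, (s x)⁻¹ * x ∈ L := fun x =>
    QuotientGroup.eq.1 (QuotientGroup.out_eq' (QuotientGroup.mk x : F ⧸ L))
  have hsl : ∀ x, ∀ l ∈ L, s (x * l) = s x := fun x l hl =>
    congrArg Quotient.out (QuotientGroup.eq.2 (by simpa using hl)).symm
  -- The coset representative of `L` itself need not be `1`; subtracting the value at `1` ensures
  -- that `b` extends `f`.
  let b : F → ZMod p := fun x => f ((s x)⁻¹ * x) - f ((s 1)⁻¹ * 1)
  have h1 : b 1 = 0 := sub_self _
  have h2 : ∀ x, ∀ l ∈ L, b (x * l) = b x + f l := fun x l hl => by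
    change f ((s (x * l))⁻¹ * (x * l)) - _ = f ((s x)⁻¹ * x) - _ + f l
    rw [hsl x l hl, ← mul_assoc, hf.map_mul _ (hs x) _ hl]
    ring
  have h3 : ∀ l ∈ L, b l = f l := fun l hl => by
    have := h2 1 l hl
    rwa [one_mul, h1, zero_add] at this
  have hconj : ∀ x, ∀ l ∈ L, f (x⁻¹ * l * x) = f l := fun x l hl => by
    simpa using hf.map_conj x⁻¹ l hl
  have hc : Continuous b := by
    refine IsLocallyConstant.continuous ((IsLocallyConstant.iff_eventually_eq b).2 fun x => ?_)
    have h1 : (1 : F) ∈ {l | l ∈ L ∧ f l = 0} := ⟨L.one_mem, by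
      have := hf.map_mul 1 L.one_mem 1 L.one_mem
      simpa using this⟩
    have h4 : Filter.Tendsto (fun y => x⁻¹ * y) (nhds x) (nhds 1) := by
      have : Continuous fun y => x⁻¹ * y := by fun_prop
      simpa using this.tendsto x
    filter_upwards [h4.eventually (hf.isOpen.mem_nhds h1)] with y hy
    have := h2 x _ hy.1
    rwa [mul_inv_cancel_left, hy.2, add_zero] at this
  refine ⟨⟨b, hc⟩, h3, fun x l hl => ⟨?_, ?_⟩⟩
  · change b (x * l) = b x + b l
    rw [h2 x l hl, h3 l hl]
  · change b (l * x) = b l + b x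
    have hx : x⁻¹ * l * x ∈ L := by simpa using hL.conj_mem l hl x⁻¹
    have h4 : l * x = x * (x⁻¹ * l * x) := by group
    rw [h4, h2 _ _ hx, hconj x l hl, h3 l hl, add_comm]

/-- The coordinates on `M / N`, extended by zero outside `M`. They are conjugation invariant because
commutators with `M` lie in `M^* ≤ N`, and their kernels in `M` are open because `N` is. -/
lemma HasQuotientDim.exists_functionals [IsTopologicalGroup F] {M N : Subgroup F} {d : ℕ}
    [M.Normal] (h : HasQuotientDim p M N d) (hN : IsOpen (N : Set F))
    (hc : relFrattini p M ≤ N) :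
    ∃ f : F → Fin d → ZMod p, (∀ i, IsInvariantFunctional M fun x => f x i) ∧
      (∀ x ∈ M, f x = 0 ↔ x ∈ N) ∧ ∀ v, ∃ x ∈ M, f x = v := by
  classical
  obtain ⟨hNM, ψ, hψ, hker⟩ := h
  let f : F → Fin d → ZMod p := fun x => if h : x ∈ M then (ψ ⟨x, h⟩).toAdd else 0
  have hf : ∀ x (h : x ∈ M), f x = (ψ ⟨x, h⟩).toAdd := fun x h => dif_pos h
  have hmul : ∀ l ∈ M, ∀ m ∈ M, f (l * m) = f l + f m := fun l hl m hm => by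
    rw [hf _ hl, hf _ hm, hf _ (M.mul_mem hl hm)]
    exact congrArg Multiplicative.toAdd (ψ.map_mul ⟨l, hl⟩ ⟨m, hm⟩)
  have h0 : ∀ x ∈ M, f x = 0 ↔ x ∈ N := fun x hx => by
    rw [hf x hx]
    have : (⟨x, hx⟩ : M) ∈ ψ.ker ↔ x ∈ N := by rw [hker]; rfl
    exact this
  refine ⟨f, fun i => ⟨fun l hl m hm => congrFun (hmul l hl m hm) i, fun g l hl => ?_, ?_⟩, h0,
    fun v => ?_⟩
  · have h1 : g * l * g⁻¹ * l⁻¹ ∈ N := hc (commutator_mem_relFrattini g hl)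
    have h2 := hmul _ (hNM h1) l hl
    rw [(h0 _ (hNM h1)).2 h1, zero_add, inv_mul_cancel_right] at h2
    exact congrFun h2 i
  · refine isOpen_iff_mem_nhds.2 fun x hx => ?_
    have h2 : (fun y => x⁻¹ * y) ⁻¹' (N : Set F) ∈ nhds x :=
      (hN.preimage (by fun_prop)).mem_nhds (by simp)
    filter_upwards [h2] with y hy
    have h3 := hmul x hx.1 _ (hNM hy)
    rw [mul_inv_cancel_left, (h0 _ (hNM hy)).2 hy, add_zero] at h3
    have h4 := M.mul_mem hx.1 (hNM hy)
    rw [mul_inv_cancel_left] at h4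
    exact ⟨h4, (congrFun h3 i).trans hx.2⟩
  · obtain ⟨x, hx⟩ := hψ (Multiplicative.ofAdd v)
    exact ⟨x, x.2, by rw [hf _ x.2]; exact congrArg Multiplicative.toAdd hx⟩

end Functionals

/-! ### Relations of `G` and the second cohomology group -/

section LinearAlgebra

/-- The images of vectors with a dual basis of functionals that vanish on the kernel are linearly
independent. -/
lemma le_rank_of_dual {k V W : Type} [Field k] [AddCommGroup V] [Module k V] [AddCommGroup W]
    [Module k W] (T : V →ₗ[k] W) {d : ℕ} (B : Fin d → V) (e : V →ₗ[k] Fin d → k)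
    (he : ∀ i, e (B i) = Pi.single i 1) (hT : ∀ v, T v = 0 → e v = 0) :
    (d : Cardinal) ≤ Module.rank k W := by
  have hli : LinearIndependent k fun i => T (B i) := by
    rw [Fintype.linearIndependent_iff]
    intro c hc i
    have h1 := congrFun (hT (∑ i, c i • B i) (by simpa using hc)) i
    simpa [he, Pi.single_apply] using h1
  simpa using hli.cardinal_le_rank

end LinearAlgebra

section RelationRank

variable {p n : ℕ} [hp : Fact p.Prime] {G : Type} [Group G] [TopologicalSpace G]
  [IsTopologicalGroup G] {φ : FreeProP p n →ₜ* G}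

/-- The evaluation of functions at given elements. -/
def kerAdditiveEval {F : Type} [Group F] [TopologicalSpace F] [IsTopologicalGroup F]
    (φ : F →ₜ* G) {d : ℕ} (r : Fin d → F) : kerAdditive p φ →ₗ[ZMod p] Fin d → ZMod p where
  toFun b i := b.1 (r i)
  map_add' _ _ := rfl
  map_smul' _ _ := rfl

/-- The dimension of the second cohomology group bounds the rank of the relation module. -/
lemma le_rank_cohomFp_two [T2Space G] (hs : Function.Surjective φ)
    (hker : ∀ x, φ x = 1 → coord x = 0) {L A E : Subgroup (FreeProP p n)} [L.Normal] {d : ℕ}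
    (hA : IsOpen (A : Set (FreeProP p n))) (hd : HasQuotientDim p L A d)
    (hc : relFrattini p L ≤ A) (hE : E ≤ A) (hL : L = E ⊔ φ.toMonoidHom.ker) :
    (d : Cardinal) ≤ Module.rank (ZMod p) (CohomFp p G 2) := by
  have hRL : ∀ r, φ r = 1 → r ∈ L := fun r hr => hL ▸ le_sup_right (a := E) hr
  obtain ⟨f, hf, hf0, hfs⟩ := hd.exists_functionals hA hc
  choose b hbf hb using fun i => (hf i).exists_extension
  -- The dual basis of `L / A` can be represented by relations of `G`, because `L` is generated by
  -- `E` and the relations, and `E` dies in `L / A`.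
  have hr : ∀ i, ∃ r, φ r = 1 ∧ f r = Pi.single i 1 := fun i => by
    obtain ⟨l, hl, hfl⟩ := hfs (Pi.single i 1)
    rw [hL] at hl
    obtain ⟨e, he, r, hr, rfl⟩ := Subgroup.mem_sup_of_normal_right.1 hl
    have h2 : f (e * r) = f e + f r :=
      funext fun i => (hf i).map_mul e (hL ▸ Subgroup.mem_sup_left he) r (hRL r hr)
    rw [hfl, (hf0 e (hL ▸ Subgroup.mem_sup_left he)).2 (hE he), zero_add] at h2
    exact ⟨r, hr, h2.symm⟩
  choose r hr hfr using hr
  refine le_rank_of_dual (transgression (p := p) φ (isQuotientMap_tripleMap hs))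
    (fun i => ⟨b i, fun x r hr => hb i x r (hRL r hr)⟩) (kerAdditiveEval φ r)
    (fun i => funext fun j => ?_) fun v hv => funext fun j => ?_
  · refine (hbf i _ (hRL _ (hr j))).trans ?_
    rw [hfr, Pi.single_apply, Pi.single_apply]
    simp only [eq_comm]
  · exact transgression_eq_zero φ (isQuotientMap_tripleMap hs)
      (fun f hf r hr => contHom_eq_zero_of_coord hf (hker r hr)) hv (hr j)

/-- For a weak Schur `σ`-group, the action on the relations is by `-1`. -/
lemma IsWeakSchurSigmaGroup.functional_odd {σ : G ≃ₜ* G} (hG : IsWeakSchurSigmaGroup p G σ)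
    (hs : Function.Surjective φ) (hker : ∀ x, φ x = 1 → coord x = 0)
    (hσ : ∀ x, φ (invAut p n x) = σ (φ x)) {L : Subgroup (FreeProP p n)} [L.Normal]
    (hL : φ.toMonoidHom.ker ≤ L) {f : FreeProP p n → ZMod p} (hf : IsInvariantFunctional L f)
    {r : FreeProP p n} (hr : φ r = 1) : f (invAut p n r) = - f r := by
  have := hG.isProPGroup.t2Space
  obtain ⟨b, hbf, hb⟩ := hf.exists_extension
  let B : kerAdditive p φ := ⟨b, fun x r hr => hb x r (hL hr)⟩
  let B' : kerAdditive p φ := kerAdditiveComp φ σ (invAut p n) hσ B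
  have hq := isQuotientMap_tripleMap hs
  have h1 := cohomFpAction_transgression φ hq σ (invAut p n) hσ B B' fun x => rfl
  -- The sum of `B` and its composite with the inversion has trivial transgression, so it vanishes
  -- on the relations.
  rw [hG.odd_H2, eq_comm, eq_neg_iff_add_eq_zero, ← map_add] at h1
  have h2 := transgression_eq_zero φ hq
    (fun f hf r hr => contHom_eq_zero_of_coord hf (hker r hr)) h1 hr
  have h3 : φ (invAut p n r) = 1 := by rw [hσ, hr, _root_.map_one σ]
  have h4 : b (invAut p n r) + b r = 0 := h2
  rw [← hbf _ (hL h3), ← hbf _ (hL hr)]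
  exact eq_neg_of_add_eq_zero_left h4

/-- For a weak Schur `σ`-group, the action on the relations is by `-1`. -/
lemma IsWeakSchurSigmaGroup.invAut_mul_mem {σ : G ≃ₜ* G} (hG : IsWeakSchurSigmaGroup p G σ)
    (hs : Function.Surjective φ) (hker : ∀ x, φ x = 1 → coord x = 0)
    (hσ : ∀ x, φ (invAut p n x) = σ (φ x)) {D M N : Subgroup (FreeProP p n)} [M.Normal] {d : ℕ}
    (hD : IsTopCharacteristic D) (hDN : D ≤ N) (hM : M = D ⊔ φ.toMonoidHom.ker)
    (hN : IsOpen (N : Set (FreeProP p n))) (hd : HasQuotientDim p M N d)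
    (hc : relFrattini p M ≤ N) {m : FreeProP p n} (hm : m ∈ M) : invAut p n m * m ∈ N := by
  obtain ⟨f, hf, hf0, -⟩ := hd.exists_functionals hN hc
  have hR : φ.toMonoidHom.ker ≤ M := hM ▸ le_sup_right
  have hDM : D ≤ M := hM ▸ le_sup_left
  rw [hM] at hm
  obtain ⟨e, he, r, hr, rfl⟩ := Subgroup.mem_sup_of_normal_right.1 hm
  have he' : invAut p n e ∈ D := hD.apply_mem _ he
  have hr' : invAut p n r ∈ φ.toMonoidHom.ker := by
    change φ (invAut p n r) = 1
    rw [hσ, show φ r = 1 from hr, _root_.map_one σ]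
  have h1 : invAut p n (e * r) ∈ M := by
    rw [_root_.map_mul (invAut p n)]
    exact M.mul_mem (hDM he') (hR hr')
  have hmM : e * r ∈ M := M.mul_mem (hDM he) (hR hr)
  refine (hf0 _ (M.mul_mem h1 hmM)).1 (funext fun i => ?_)
  have h3 : ∀ e ∈ D, f e i = 0 := fun e he => congrFun ((hf0 e (hDM he)).2 (hDN he)) i
  rw [(hf i).map_mul _ h1 _ hmM, (hf i).map_mul _ (hDM he) _ (hR hr),
    _root_.map_mul (invAut p n), (hf i).map_mul _ (hDM he') _ (hR hr'), h3 e he, h3 _ he',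
    hG.functional_odd hs hker hσ hR (hf i) hr]
  simp

end RelationRank

/-! ### Closed normal closures and induced involutions -/

section ClosedNormalClosure

variable {F : Type*} [Group F] [TopologicalSpace F] [IsTopologicalGroup F]

/-- The smallest closed normal subgroup that contains a set. -/
def closedNormalClosure (S : Set F) : Subgroup F := (Subgroup.normalClosure S).topologicalClosure

instance (S : Set F) : (closedNormalClosure S).Normal := Subgroup.is_normal_topologicalClosure _

lemma isClosed_closedNormalClosure (S : Set F) : IsClosed (closedNormalClosure S : Set F) :=
  Subgroup.isClosed_topologicalClosure _

lemma subset_closedNormalClosure (S : Set F) : S ⊆ closedNormalClosure S :=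
  Subgroup.subset_normalClosure.trans (Subgroup.le_topologicalClosure _)

lemma closedNormalClosure_le {S : Set F} {N : Subgroup F} [N.Normal] (hN : IsClosed (N : Set F))
    (h : S ⊆ N) : closedNormalClosure S ≤ N :=
  Subgroup.topologicalClosure_minimal _ (Subgroup.normalClosure_le_normal h) hN

lemma closedNormalClosure_apply_mem {S : Set F} (σ : F ≃ₜ* F)
    (h : ∀ x ∈ S, σ x ∈ closedNormalClosure S) {x : F} (hx : x ∈ closedNormalClosure S) :
    σ x ∈ closedNormalClosure S := by
  have : ((closedNormalClosure S).comap σ.toMulEquiv.toMonoidHom).Normal :=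
    Subgroup.Normal.comap inferInstance _
  exact closedNormalClosure_le (N := (closedNormalClosure S).comap σ.toMulEquiv.toMonoidHom)
    ((isClosed_closedNormalClosure S).preimage σ.continuous) h hx

end ClosedNormalClosure

section QuotientAction

variable {F : Type*} [Group F] [TopologicalSpace F] [IsTopologicalGroup F]

omit [IsTopologicalGroup F] in
/-- The automorphism induced on a quotient by an involution. -/
lemma exists_quotient_involution (σ : F ≃ₜ* F) (hσ : ∀ x, σ (σ x) = x) (N : Subgroup F) [N.Normal]
    (hN : ∀ x ∈ N, σ x ∈ N) :
    ∃ τ : (F ⧸ N) ≃ₜ* (F ⧸ N), ∀ x : F, τ (QuotientGroup.mk x) = QuotientGroup.mk (σ x) := by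
  let f : (F ⧸ N) →* (F ⧸ N) := QuotientGroup.map N N σ.toMulEquiv.toMonoidHom hN
  have hf : ∀ x : F, f (QuotientGroup.mk x) = QuotientGroup.mk (σ x) := fun _ => rfl
  have hff : ∀ x, f (f x) = x := fun x => by
    induction x using QuotientGroup.induction_on with
    | H x => rw [hf, hf, hσ]
  have hc : Continuous f := continuous_quot_lift _
    (QuotientGroup.continuous_mk.comp σ.continuous)
  exact ⟨{ f with
    invFun := f
    left_inv := hff
    right_inv := hff
    continuous_toFun := hc
    continuous_invFun := hc }, hf⟩

end QuotientAction

/-! ### Weak Schur `σ`-groups from `n` odd relations -/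

section LinearAlgebra

lemma rank_le_of_ker_le {k V W : Type} [Field k] [AddCommGroup V] [Module k V] [AddCommGroup W]
    [Module k W] (T : V →ₗ[k] W) (hTs : Function.Surjective T) {d : ℕ} (e : V →ₗ[k] Fin d → k)
    (hT : ∀ v, e v = 0 → T v = 0) : Module.rank k W ≤ d := by
  obtain ⟨s, hs⟩ := T.exists_rightInverse_of_surjective (LinearMap.range_eq_top.2 hTs)
  have hs' : ∀ w, T (s w) = w := LinearMap.congr_fun hs
  have hi : Function.Injective (e ∘ₗ s) := (injective_iff_map_eq_zero _).2 fun w hw => by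
    rw [← hs' w]
    exact hT _ hw
  simpa using LinearMap.rank_le_of_injective _ hi

end LinearAlgebra

section Construction

/-- A function vanishing on generators of the kernel vanishes on the kernel. -/
lemma kerAdditive_eq_zero {p : ℕ} {F G : Type} [Group F] [TopologicalSpace F] [IsTopologicalGroup F]
    [Group G] [TopologicalSpace G] [IsTopologicalGroup G] {φ : F →ₜ* G} {S : Set F}
    (hφ : φ.toMonoidHom.ker = closedNormalClosure S) (b : kerAdditive p φ)
    (hb : ∀ x ∈ S, b.1 x = 0) {r : F} (hr : φ r = 1) : b.1 r = 0 := by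
  have hk : ∀ {x}, x ∈ φ.toMonoidHom.ker → φ x = 1 := fun h => h
  let N : Subgroup F :=
    { carrier := {x | x ∈ φ.toMonoidHom.ker ∧ b.1 x = 0}
      mul_mem' := fun {x y} hx hy =>
        ⟨mul_mem hx.1 hy.1, by rw [(b.2 x y (hk hy.1)).1, hx.2, hy.2, add_zero]⟩
      one_mem' := ⟨one_mem _, kerAdditive_one b.2⟩
      inv_mem' := fun {x} hx =>
        ⟨inv_mem hx.1, by rw [kerAdditive_inv b.2 (hk hx.1), hx.2, neg_zero]⟩ }
  -- Two-sided additivity of `b` makes its restriction to the kernel invariant under conjugation.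
  have hN : N.Normal := ⟨fun x hx g => by
    have h1 : g * x * g⁻¹ ∈ φ.toMonoidHom.ker := (MonoidHom.normal_ker _).conj_mem x hx.1 g
    refine ⟨h1, ?_⟩
    have h2 := (b.2 g _ (hk h1)).2
    rw [inv_mul_cancel_right, (b.2 g x (hk hx.1)).1, hx.2, add_zero] at h2
    exact right_eq_add.1 h2⟩
  have hc : IsClosed (N : Set F) := by
    refine IsClosed.inter (s₁ := (φ.toMonoidHom.ker : Set F)) ?_
      (isClosed_singleton.preimage b.1.continuous)
    rw [hφ]
    exact isClosed_closedNormalClosure S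
  have h := closedNormalClosure_le hc (S := S) fun x hx =>
    ⟨hφ ▸ subset_closedNormalClosure S hx, hb x hx⟩
  exact (h (hφ ▸ hr : r ∈ closedNormalClosure S)).2

variable {p n : ℕ} [hp : Fact p.Prime]

/-- The quotient of `F_n` by `n` odd relations in the Frattini subgroup is a weak Schur
`σ`-group. -/
lemma exists_weakSchurSigmaGroup (r : Fin n → FreeProP p n) (hr : ∀ i, coord (r i) = 0)
    (hodd : ∀ i, invAut p n (r i) = (r i)⁻¹) :
    ∃ σ : (FreeProP p n ⧸ closedNormalClosure (Set.range r)) ≃ₜ*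
        (FreeProP p n ⧸ closedNormalClosure (Set.range r)),
      IsWeakSchurSigmaGroup p (FreeProP p n ⧸ closedNormalClosure (Set.range r)) σ := by
  let N := closedNormalClosure (Set.range r)
  have hNc : IsClosed (N : Set (FreeProP p n)) := isClosed_closedNormalClosure _
  have hN : ∀ x ∈ N, invAut p n x ∈ N := fun x hx => by
    refine closedNormalClosure_apply_mem _ ?_ hx
    rintro _ ⟨i, rfl⟩
    rw [hodd]
    exact inv_mem (subset_closedNormalClosure _ ⟨i, rfl⟩)
  obtain ⟨σ, hσ⟩ := exists_quotient_involution (invAut p n) invAut_invAut N hN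
  have hG : IsProPGroup p (FreeProP p n ⧸ N) := isProPGroup_freeProP.quotient N hNc
  have := hG.compactSpace
  have := hG.t2Space
  let φ : FreeProP p n →ₜ* (FreeProP p n ⧸ N) :=
    ⟨QuotientGroup.mk' N, QuotientGroup.continuous_mk⟩
  have hs : Function.Surjective φ := QuotientGroup.mk'_surjective N
  have hφk : φ.toMonoidHom.ker = N := QuotientGroup.ker_mk' N
  have hker : ∀ x, φ x = 1 → coord x = 0 := fun x hx => by
    have hx' : x ∈ N := hφk ▸ hx
    have hle : N ≤ relFrattini p ⊤ := closedNormalClosure_le (isClosed_relFrattini _) (by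
      rintro _ ⟨i, rfl⟩
      exact mem_frattini_iff.2 (hr i))
    exact mem_frattini_iff.1 (hle hx')
  have hφσ : ∀ x, φ (invAut p n x) = σ (φ x) := fun x => (hσ x).symm
  obtain ⟨e⟩ := finrank_cohomFp_one (p := p) hs hker
  have hq := isQuotientMap_tripleMap hs
  -- A class is determined by the values of `b` at the `n` relators. This bounds the rank of `H^2`
  -- by `n`, and it reduces oddness on `H^2` to oddness of the relators.
  have hT0 : ∀ b, kerAdditiveEval φ r b = 0 → transgression (p := p) φ hq b = 0 := fun b hb =>
    transgression_eq_zero_of_ker φ hq b fun x hx => kerAdditive_eq_zero hφk b (by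
      rintro _ ⟨i, rfl⟩
      exact congrFun hb i) hx
  have hTs := transgression_surjective_freeProP φ hq
  refine ⟨σ, hG, ?_, ?_, ?_, ?_, ?_⟩
  · intro x
    obtain ⟨x, rfl⟩ := hs x
    rw [← hφσ, ← hφσ, invAut_invAut]
  · exact Module.Finite.equiv e.symm
  · rw [e.rank_eq]
    simpa using rank_le_of_ker_le _ hTs (kerAdditiveEval φ r) hT0
  · intro c
    obtain ⟨f, rfl⟩ := (homEquivH1 p).surjective c
    rw [← map_neg]
    refine cohomFpAction_homEquivH1 p σ f (-f) fun x => ?_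
    obtain ⟨x, rfl⟩ := hs x
    rw [← hφσ]
    have h1 : f.1.comp ⟨φ, φ.continuous⟩ ∈ contHom p (FreeProP p n) := fun x y => by
      change f.1 (φ (x * y)) = f.1 (φ x) + f.1 (φ y)
      rw [map_mul φ]
      exact f.2 _ _
    have h2 : f.1.comp ⟨fun x => φ (invAut p n x), φ.continuous.comp (invAut p n).continuous⟩ ∈
        contHom p (FreeProP p n) := fun x y => by
      change f.1 (φ (invAut p n (x * y))) = f.1 (φ _) + f.1 (φ _)
      rw [map_mul (invAut p n), map_mul φ]
      exact f.2 _ _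
    have h3 := contHom_ext h2 (neg_mem h1) fun i => by
      change f.1 (φ (invAut p n (freeGen p i))) = - f.1 (φ (freeGen p i))
      rw [invAut_freeGen, map_inv φ, contHom_inv f.2]
    exact DFunLike.congr_fun h3 x
  · intro c
    obtain ⟨b, rfl⟩ := hTs c
    let b' := kerAdditiveComp φ σ (invAut p n) hφσ b
    have h1 := cohomFpAction_transgression φ hq σ (invAut p n) hφσ b b' fun x => rfl
    have h2 := hT0 (b' + b) (funext fun i => by
      change b.1 (invAut p n (r i)) + b.1 (r i) = 0
      have h3 : φ (r i) = 1 := by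
        have : r i ∈ φ.toMonoidHom.ker := by
          rw [hφk]
          exact subset_closedNormalClosure _ ⟨i, rfl⟩
        exact this
      rw [hodd, kerAdditive_inv b.2 h3, neg_add_cancel])
    rw [map_add] at h2
    rw [h1]
    exact eq_neg_of_add_eq_zero_left h2

end Construction

/-! ### Endomorphisms that are trivial modulo the Frattini subgroup -/

section Unipotent

open scoped commutatorElement

variable {p : ℕ} {F : Type*} [Group F] [TopologicalSpace F] [IsTopologicalGroup F]

lemma commutatorElement_mul_mul {Q : Type*} [Group Q] {g w x z : Q} (hw : w * x = x * w)
    (hz : ∀ h, h * z = z * h) : ⁅g * w, x * z⁆ = ⁅g, x⁆ := by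
  calc ⁅g * w, x * z⁆ = g * (w * x) * (z * (g * w)⁻¹) * z⁻¹ * x⁻¹ := by
        rw [commutatorElement_def]
        group
    _ = ⁅g, x⁆ := by
        rw [← hz, hw, commutatorElement_def]
        group

/-- If the commutators with `x` are central of exponent `p` modulo `N`, then `x` commutes modulo
`N` with the Frattini subgroup. -/
lemma commute_mk_of_mem_frattini {N : Subgroup F} [N.Normal] (hN : IsClosed (N : Set F)) {x : F}
    (h1 : ∀ g h : F, ⁅h, ⁅g, x⁆⁆ ∈ N) (h2 : ∀ g : F, ⁅g, x⁆ ^ p ∈ N) {w : F}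
    (hw : w ∈ relFrattini p (⊤ : Subgroup F)) : ⁅w, x⁆ ∈ N := by
  let q : F →* F ⧸ N := QuotientGroup.mk' N
  have hq : ∀ y, q y = 1 ↔ y ∈ N := fun y => QuotientGroup.eq_one_iff y
  have hcen : ∀ g : F, q ⁅g, x⁆ ∈ Subgroup.center (F ⧸ N) := fun g => by
    refine Subgroup.mem_center_iff.2 fun h => ?_
    obtain ⟨h, rfl⟩ := QuotientGroup.mk'_surjective N h
    have := (hq _).2 (h1 g h)
    rw [map_commutatorElement] at this
    exact commutatorElement_eq_one_iff_mul_comm.1 this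
  -- As all `⁅g, x⁆` are central modulo `N`, they depend multiplicatively on `g`. The target is
  -- abelian and the values have exponent `p`, so the closed kernel contains the Frattini subgroup.
  let f : F →* Subgroup.center (F ⧸ N) :=
    { toFun := fun g => ⟨q ⁅g, x⁆, hcen g⟩
      map_one' := Subtype.ext (by simp)
      map_mul' := fun a b => Subtype.ext (by
        change q ⁅a * b, x⁆ = q ⁅a, x⁆ * q ⁅b, x⁆
        have e : ⁅a * b, x⁆ = a * ⁅b, x⁆ * a⁻¹ * ⁅a, x⁆ := by
          simp only [commutatorElement_def]
          group
        have hc := Subgroup.mem_center_iff.1 (hcen b)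
        rw [e, map_mul, map_mul, map_mul, map_inv, hc (q a), mul_inv_cancel_right,
          hc (q ⁅a, x⁆)]) }
  have hf : ∀ w, f w = 1 ↔ ⁅w, x⁆ ∈ N := fun w => by
    rw [← hq]
    exact Subtype.ext_iff
  have hcl : IsClosed (f.ker : Set F) := by
    have : (f.ker : Set F) = (fun w => ⁅w, x⁆) ⁻¹' (N : Set F) := Set.ext hf
    rw [this]
    refine hN.preimage ?_
    simp only [commutatorElement_def]
    fun_prop
  have hle : relFrattini p (⊤ : Subgroup F) ≤ f.ker := relFrattini_le hcl
    (fun g _ => by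
      refine f.mem_ker.2 (Subtype.ext ?_)
      rw [map_pow]
      change q ⁅g, x⁆ ^ p = 1
      rw [← map_pow]
      exact (hq _).2 (h2 g))
    (fun g h _ => by
      rw [f.mem_ker, map_commutatorElement]
      exact commutatorElement_eq_one_iff_mul_comm.2
        (Subtype.ext (Subgroup.mem_center_iff.1 (f h).2 _)))
  exact (hf w).1 (hle hw)

/-- An endomorphism that is trivial modulo the Frattini subgroup and from `A` to `A / A^*` is
trivial from `A^*` to `A^* / A^**`. -/
lemma inv_mul_apply_mem_relFrattini {A : Subgroup F} [A.Normal]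
    (u : F →* F) (hu : Continuous u)
    (hu0 : ∀ x, x⁻¹ * u x ∈ relFrattini p (⊤ : Subgroup F))
    (hA : ∀ x ∈ A, x⁻¹ * u x ∈ relFrattini p A) {x : F} (hx : x ∈ relFrattini p A) :
    x⁻¹ * u x ∈ relFrattini p (relFrattini p A) := by
  let B := relFrattini p A
  let C := relFrattini p B
  let q : F →* F ⧸ C := QuotientGroup.mk' C
  have hq : ∀ y, q y = 1 ↔ y ∈ C := fun y => QuotientGroup.eq_one_iff y
  have hC : IsClosed (C : Set F) := isClosed_relFrattini _
  have hcomm : ∀ g : F, ∀ z ∈ B, q g * q z = q z * q g := fun g z hz => by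
    have := (hq _).2 (commutator_mem_relFrattini g hz)
    rw [map_commutatorElement] at this
    exact commutatorElement_eq_one_iff_mul_comm.1 this
  have hpow : ∀ z ∈ B, q z ^ p = 1 := fun z hz => by
    rw [← map_pow]
    exact (hq _).2 (pow_mem_relFrattini hz)
  have hset : ∀ x, x ∈ (q.comp u).eqLocus q ↔ x⁻¹ * u x ∈ C := fun x => by
    rw [← hq, map_mul, map_inv, inv_mul_eq_one]
    exact eq_comm
  have hcl : IsClosed ((q.comp u).eqLocus q : Set F) := by
    have : ((q.comp u).eqLocus q : Set F) = (fun x => x⁻¹ * u x) ⁻¹' (C : Set F) := Set.ext hset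
    rw [this]
    exact hC.preimage (by fun_prop)
  have key : ∀ x ∈ A, q (u x) = q x * q (x⁻¹ * u x) := fun x _ => by
    rw [← map_mul, mul_inv_cancel_left]
  -- The elements fixed by `u` modulo `C` form a closed subgroup, so it suffices to treat the
  -- generators of `A^*`.
  refine (hset x).1 (relFrattini_le hcl (fun x hx => ?_) (fun g x hx => ?_) hx)
  · change q (u (x ^ p)) = q (x ^ p)
    rw [map_pow, map_pow, map_pow, key x hx, Commute.mul_pow (hcomm x _ (hA x hx)),
      hpow _ (hA x hx), mul_one]
  · change q (u ⁅g, x⁆) = q ⁅g, x⁆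
    -- The error term `g⁻¹ * u g` need not be central modulo `C`, but being in the Frattini subgroup
    -- it commutes with `x ∈ A`.
    have hw : q ⁅g⁻¹ * u g, x⁆ = 1 := (hq _).2 <| commute_mk_of_mem_frattini hC
      (fun g h => commutator_mem_relFrattini h (commutator_mem_relFrattini g hx))
      (fun g => pow_mem_relFrattini (commutator_mem_relFrattini g hx)) (hu0 g)
    have hg : q (u g) = q g * q (g⁻¹ * u g) := by rw [← map_mul, mul_inv_cancel_left]
    rw [map_commutatorElement] at hw
    have hw' : q (g⁻¹ * u g) * q x = q x * q (g⁻¹ * u g) :=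
      commutatorElement_eq_one_iff_mul_comm.1 hw
    rw [map_commutatorElement, map_commutatorElement, map_commutatorElement, key x hx, hg]
    refine commutatorElement_mul_mul hw' fun h => ?_
    obtain ⟨h, rfl⟩ := QuotientGroup.mk'_surjective C h
    exact hcomm h _ (hA x hx)

lemma isClosed_lowerPCentral : ∀ j, IsClosed (lowerPCentral p F j : Set F)
  | 0 => isClosed_univ
  | _ + 1 => isClosed_relFrattini _

/-- An endomorphism that is trivial modulo the Frattini subgroup does not invert any element modulo
an open normal subgroup, apart from the trivial one. -/
lemma mem_of_apply_mul_mem [hp : Fact p.Prime] (h2 : p ≠ 2) (hF : IsProPGroup p F) {N : Subgroup F}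
    [N.Normal] (hN : IsOpen (N : Set F)) (u : F →* F) (hu : Continuous u)
    (hu0 : ∀ x, x⁻¹ * u x ∈ relFrattini p (⊤ : Subgroup F)) (huN : ∀ x ∈ N, u x ∈ N) {x : F}
    (hx : u x * x ∈ N) : x ∈ N := by
  have := hF.compactSpace
  have := hF.t2Space
  have hnorm : ∀ j, (lowerPCentral p F j).Normal := fun j =>
    (isTopCharacteristic_lowerPCentral j).normal
  have hstep : ∀ j, ∀ y ∈ lowerPCentral p F j, y⁻¹ * u y ∈ lowerPCentral p F (j + 1) := by
    intro j
    induction j with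
    | zero => exact fun y _ => hu0 y
    | succ j ih => exact fun y hy => inv_mul_apply_mem_relFrattini u hu hu0 ih hy
  -- On each layer of the series `u` is the identity, while by hypothesis it inverts `x` modulo `N`.
  -- So the class of `x` has square and `p`-th power equal to `1`, and it is trivial for odd `p`.
  have hmem : ∀ j, x ∈ lowerPCentral p F j ⊔ N := by
    intro j
    induction j with
    | zero => exact Subgroup.mem_sup_left (Subgroup.mem_top x)
    | succ j ih =>
      let S := lowerPCentral p F (j + 1) ⊔ N
      have hS : S.Normal := inferInstance
      let q : F →* F ⧸ S := QuotientGroup.mk' S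
      have hq : ∀ y, q y = 1 ↔ y ∈ S := fun y => QuotientGroup.eq_one_iff y
      obtain ⟨y, hy, z, hz, rfl⟩ := Subgroup.mem_sup_of_normal_right.1 ih
      have e1 : ∀ z ∈ N, q z = 1 := fun z hz => (hq z).2 (Subgroup.mem_sup_right hz)
      have e2 : q (u y) = q y := by
        have := (hq _).2 (Subgroup.mem_sup_left (hstep j y hy))
        rwa [map_mul, map_inv, inv_mul_eq_one, eq_comm] at this
      have e3 : q y ^ 2 = 1 := by
        have := e1 _ hx
        rwa [map_mul, map_mul, map_mul, map_mul, e1 _ (huN z hz), e1 z hz, e2, mul_one,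
          ← sq] at this
      have e4 : q y ^ p = 1 := by
        rw [← map_pow]
        exact (hq _).2 (Subgroup.mem_sup_left (pow_mem_relFrattini hy))
      refine (hq _).1 ?_
      rw [map_mul, e1 z hz, mul_one]
      have := pow_gcd_eq_one.2 ⟨e3, e4⟩
      rwa [(Nat.coprime_primes Nat.prime_two hp.out).2 h2.symm, pow_one] at this
  suffices h : ∃ j, lowerPCentral p F j ≤ N by
    obtain ⟨j, hj⟩ := h
    have := hmem j
    rwa [sup_eq_right.2 hj] at this
  by_contra! hne
  have := N.quotient_finite_of_isOpen hN
  have hfin : N.FiniteIndex := Subgroup.finiteIndex_of_finite_quotient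
  -- If the chain were stationary at some `j`, the Nakayama lemma would give `P_j ≤ N`. A strictly
  -- descending chain contradicts the finite index of `N`.
  have hlt : ∀ j, lowerPCentral p F (j + 1) ⊔ N < lowerPCentral p F j ⊔ N := fun j => by
    have hle : lowerPCentral p F (j + 1) ≤ lowerPCentral p F j :=
      relFrattini_le_self (isClosed_lowerPCentral j)
    refine lt_of_le_of_ne (sup_le_sup_right hle N) fun h => hne j ?_
    refine hF.le_of_le_sup_relFrattini hN ?_
    rw [sup_comm]
    exact le_sup_left.trans h.ge
  have hmono : StrictMono fun j => (lowerPCentral p F j ⊔ N).index :=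
    strictMono_nat_of_lt_succ fun j => by
      have : (lowerPCentral p F (j + 1) ⊔ N).FiniteIndex :=
        Subgroup.finiteIndex_of_le le_sup_right
      exact Subgroup.index_strictAnti (hlt j)
  have h3 := hmono.id_le (N.index + 1)
  have h4 : (lowerPCentral p F (N.index + 1) ⊔ N).index ≤ N.index :=
    Nat.le_of_dvd (Nat.pos_of_ne_zero hfin.index_ne_zero) (Subgroup.index_dvd_of_le le_sup_right)
  exact absurd (h3.trans h4) (by simp)

end Unipotent

/-! ### The dimensions of the criterion as indices in `F_n` -/

section Dimensions

variable {p n : ℕ}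

lemma map_relFrattini_equiv {F : Type*} [Group F] [TopologicalSpace F] [IsTopologicalGroup F]
    [CompactSpace F] [T2Space F] (α : F ≃ₜ* F) (M : Subgroup F) :
    relFrattini p (M.map (α : F →* F)) = (relFrattini p M).map (α : F →* F) :=
  (map_relFrattini (α : F →* F) α.continuous α.surjective M).symm

lemma relFrattini_apply_mem {F : Type*} [Group F] [TopologicalSpace F] [IsTopologicalGroup F]
    [CompactSpace F] [T2Space F] (α : F ≃ₜ* F) {M M' : Subgroup F} (h : ∀ x ∈ M, α x ∈ M') {x : F}
    (hx : x ∈ relFrattini p M) : α x ∈ relFrattini p M' := by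
  have h1 : M.map (α : F →* F) ≤ M' := by
    rintro _ ⟨x, hx, rfl⟩
    exact h x hx
  exact relFrattini_mono h1 (map_relFrattini_equiv α M ▸ ⟨x, hx, rfl⟩)

lemma relIndex_map_equiv {F : Type*} [Group F] [TopologicalSpace F] (α : F ≃ₜ* F)
    (A B : Subgroup F) :
    (A.map (α : F →* F)).relIndex (B.map (α : F →* F)) = A.relIndex B :=
  Subgroup.relIndex_map_map_of_injective A B α.injective

variable [hp : Fact p.Prime]

lemma exists_hasQuotientDim_of_isOpen {A L M : Subgroup (FreeProP p n)}
    (hA : IsOpen (A : Set (FreeProP p n))) (hAL : A ≤ L) (hLM : L ≤ M)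
    (h : relFrattini p M ≤ A) : ∃ d, HasQuotientDim p L A d := by
  refine exists_hasQuotientDim hAL (fun x hx => h (pow_mem_relFrattini (hLM hx)))
    (fun g _ x hx => h (commutator_mem_relFrattini g (hLM hx))) ?_
  have := A.quotient_finite_of_isOpen hA
  have hf : A.FiniteIndex := Subgroup.finiteIndex_of_finite_quotient
  exact fun h0 => hf.index_ne_zero (Nat.eq_zero_of_zero_dvd
    (h0 ▸ Subgroup.relIndex_dvd_index_of_le hAL))

variable {H : Type*} [Group H] [TopologicalSpace H] [IsTopologicalGroup H]

/-- The chosen relation subgroup is the image of the kernel of `ρ` under an automorphism of `F_n`,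
which respects stars and indices; so the chosen presentation can be replaced by `ρ`. -/
lemma hasMultiplicatorRank_iff (hH : IsProPGroup p H) {ρ : FreeProP p n →ₜ* H}
    (hs : Function.Surjective ρ) (hker : ∀ x, ρ x = 1 → coord x = 0) {m : ℕ} :
    HasMultiplicatorRank p n H m ↔
      (relFrattini p ρ.toMonoidHom.ker).relIndex ρ.toMonoidHom.ker = p ^ m := by
  have := hH.t2Space
  obtain ⟨α, -, hα⟩ := exists_automorphism_relSubgroup hH hs hker
  rw [← relIndex_map_equiv α, ← map_relFrattini_equiv, ← hα]
  have hcl : IsClosed (relSubgroup p n H : Set (FreeProP p n)) := by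
    rw [hα]
    exact α.toHomeomorph.isClosed_image.2 (isClosed_singleton.preimage ρ.continuous)
  exact ⟨HasQuotientDim.relIndex_eq, hasQuotientDim_of_relIndex (relFrattini_le_self hcl)
    (fun x hx => pow_mem_relFrattini hx) fun g _ x hx => commutator_mem_relFrattini g hx⟩

lemma HasRelRank.relIndex_eq (hH : IsProPGroup p H) {ρ : FreeProP p n →ₜ* H}
    (hs : Function.Surjective ρ) (hker : ∀ x, ρ x = 1 → coord x = 0) {r : ℕ}
    {D : Subgroup (FreeProP p n)} (hD : IsTopCharacteristic D) (h : HasRelRank H D r) :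
    (D ⊔ relFrattini p ρ.toMonoidHom.ker).relIndex ρ.toMonoidHom.ker = p ^ r := by
  have := hH.t2Space
  obtain ⟨α, -, hα⟩ := exists_automorphism_relSubgroup hH hs hker
  rw [← relIndex_map_equiv α, Subgroup.map_sup, hD α, ← map_relFrattini_equiv, ← hα]
  exact HasQuotientDim.relIndex_eq h

-- The projection to the `p`-cover has its kernel in the Frattini subgroup, so it can serve as the
-- presentation.
variable (H) in
omit [IsTopologicalGroup H] in
lemma map_eq_charSubgroup_pCover {E : Subgroup (FreeProP p n)} (hE : IsTopCharacteristic E) :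
    charSubgroup (PCover p n H) E =
      E.map (QuotientGroup.mk' (relFrattini p (relSubgroup p n H))) := by
  let φ : FreeProP p n →ₜ* PCover p n H :=
    ⟨QuotientGroup.mk' (relFrattini p (relSubgroup p n H)), QuotientGroup.continuous_mk⟩
  have hφs : Function.Surjective φ := QuotientGroup.mk'_surjective _
  have hcl : IsClosed (relFrattini p (relSubgroup p n H) : Set (FreeProP p n)) :=
    isClosed_relFrattini _
  refine charSubgroup_eq (isProPGroup_freeProP.quotient _ hcl) (φ := φ) hφs (fun x hx => ?_) hE
  have hx' : x ∈ relFrattini p (relSubgroup p n H) := (QuotientGroup.eq_one_iff x).1 hx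
  exact mem_frattini_iff.1 (relFrattini_mono le_top hx')

lemma hasDim_charSubgroup_pCover_iff (hH : IsProPGroup p H) {ρ : FreeProP p n →ₜ* H}
    (hs : Function.Surjective ρ) (hker : ∀ x, ρ x = 1 → coord x = 0)
    {E : Subgroup (FreeProP p n)} (hE : IsTopCharacteristic E) (hEM : E ≤ ρ.toMonoidHom.ker)
    {e : ℕ} : HasDim p (charSubgroup (PCover p n H) E) e ↔
      (relFrattini p ρ.toMonoidHom.ker).relIndex E = p ^ e := by
  have := hH.t2Space
  rw [map_eq_charSubgroup_pCover H hE]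
  obtain ⟨α, -, hα⟩ := exists_automorphism_relSubgroup hH hs hker
  let S := relFrattini p (relSubgroup p n H)
  have h1 : (relFrattini p ρ.toMonoidHom.ker).relIndex E =
      (⊥ : Subgroup (PCover p n H)).relIndex (E.map (QuotientGroup.mk' S)) := by
    rw [← Subgroup.relIndex_comap, MonoidHom.comap_bot, QuotientGroup.ker_mk',
      ← relIndex_map_equiv α, hE α, ← map_relFrattini_equiv, ← hα]
  have hER : E ≤ relSubgroup p n H := by
    rw [hα, ← hE α]
    exact Subgroup.map_mono hEM
  rw [h1]
  refine ⟨HasQuotientDim.relIndex_eq, hasQuotientDim_of_relIndex bot_le ?_ ?_⟩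
  · rintro _ ⟨x, hx, rfl⟩
    rw [← map_pow]
    exact (QuotientGroup.eq_one_iff _).2 (pow_mem_relFrattini (hER hx))
  · rintro _ ⟨g, -, rfl⟩ _ ⟨x, hx, rfl⟩
    rw [← map_commutatorElement]
    exact (QuotientGroup.eq_one_iff _).2 (commutator_mem_relFrattini g (hER hx))

omit [TopologicalSpace H] [IsTopologicalGroup H] in
lemma hasDim_ker_iff {K : Type*} [Group K] [TopologicalSpace K] {θ : FreeProP p n →ₜ* K}
    (hs : Function.Surjective θ) (π : K →* H)
    (h : relFrattini p (π.comp θ.toMonoidHom).ker ≤ θ.toMonoidHom.ker) {k : ℕ} :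
    HasDim p π.ker k ↔ θ.toMonoidHom.ker.relIndex (π.comp θ.toMonoidHom).ker = p ^ k := by
  have h1 : π.ker = (π.comp θ.toMonoidHom).ker.map θ.toMonoidHom := by
    rw [← MonoidHom.comap_ker, Subgroup.map_comap_eq_self_of_surjective hs]
  have h2 : θ.toMonoidHom.ker.relIndex (π.comp θ.toMonoidHom).ker =
      (⊥ : Subgroup K).relIndex π.ker := by
    rw [h1, ← Subgroup.relIndex_comap, MonoidHom.comap_bot]
  rw [h2]
  refine ⟨HasQuotientDim.relIndex_eq, hasQuotientDim_of_relIndex bot_le ?_ ?_⟩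
  · intro y hy
    obtain ⟨x, rfl⟩ := hs y
    have := h (pow_mem_relFrattini hy)
    exact (map_pow θ x p).symm.trans this
  · intro g _ y hy
    obtain ⟨x, rfl⟩ := hs y
    obtain ⟨g, rfl⟩ := hs g
    have := h (commutator_mem_relFrattini g hy)
    exact (map_commutatorElement θ.toMonoidHom g x).symm.trans this

end Dimensions

/-! ### Relations of Schur quotients: number and sign -/

section Criterion

variable {p n : ℕ}

lemma ker_comp_eq_sup {K H : Type*} [Group K] [Group H] (θ : FreeProP p n →* K) {π : K →* H}
    {D : Subgroup (FreeProP p n)} (h : π.ker = D.map θ) : (π.comp θ).ker = D ⊔ θ.ker := by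
  rw [← MonoidHom.comap_ker, h, Subgroup.comap_map_eq]

/-- Second isomorphism theorem: `L` together with `D M^*` generates `M`, so `L` maps onto `M / D
M^*`. -/
lemma relIndex_sup_relFrattini {F : Type*} [Group F] [TopologicalSpace F] [IsTopologicalGroup F]
    {D L M : Subgroup F} [D.Normal] [M.Normal] (hM : M = D ⊔ L) (h : relFrattini p M ≤ M) :
    (D ⊔ relFrattini p M).relIndex L = (D ⊔ relFrattini p M).relIndex M := by
  have h1 : L ⊔ (D ⊔ relFrattini p M) = M := by
    refine le_antisymm (sup_le (hM ▸ le_sup_right) (sup_le (hM ▸ le_sup_left) h)) ?_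
    nth_rewrite 1 [hM]
    exact sup_le (le_sup_left.trans le_sup_right) le_sup_left
  rw [← Subgroup.relIndex_sup_right (H := L), h1]

variable [hp : Fact p.Prime]

lemma exists_induced_involution {K : Type*} [Group K] {θ : FreeProP p n →* K}
    (hs : Function.Surjective θ) (h : ∀ x, θ x = 1 → θ (invAut p n x) = 1) :
    ∃ σ : K ≃* K, ∀ x, θ (invAut p n x) = σ (θ x) := by
  let f : FreeProP p n →* K := θ.comp (invAut p n : FreeProP p n →* FreeProP p n)
  let s : K →* K := θ.liftOfSurjective hs ⟨f, h⟩
  have hsx : ∀ x, s (θ x) = θ (invAut p n x) := fun x =>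
    θ.liftOfRightInverse_comp_apply _ (Function.rightInverse_surjInv hs) ⟨f, h⟩ x
  have hss : s.comp s = MonoidHom.id K := MonoidHom.ext fun y => by
    obtain ⟨x, rfl⟩ := hs y
    change s (s (θ x)) = θ x
    rw [hsx, hsx, invAut_invAut]
  exact ⟨s.toMulEquiv s hss hss, fun x => (hsx x).symm⟩

/-- The relations of a quotient of a weak Schur `σ`-group: the count. -/
lemma IsWeakSchurSigmaGroup.relIndex_eq {G : Type} [Group G] [TopologicalSpace G]
    [IsTopologicalGroup G] {σ : G ≃ₜ* G} (hG : IsWeakSchurSigmaGroup p G σ)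
    {φ : FreeProP p n →ₜ* G} (hs : Function.Surjective φ) (hker : ∀ x, φ x = 1 → coord x = 0)
    {D E L M : Subgroup (FreeProP p n)} [D.Normal] [L.Normal] [M.Normal]
    (hE : IsOpen (E : Set (FreeProP p n))) (hED : E ≤ D)
    (hL : L = E ⊔ φ.toMonoidHom.ker) (hM : M = D ⊔ L) (hML : relFrattini p M ≤ L)
    (h : (D ⊔ relFrattini p M).relIndex M = p ^ n) : (E ⊔ relFrattini p M).relIndex L = p ^ n := by
  have := hG.isProPGroup.compactSpace
  have := hG.isProPGroup.t2Space
  have hLM : L ≤ M := hM ▸ le_sup_right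
  have hA : IsOpen ((E ⊔ relFrattini p M : Subgroup (FreeProP p n)) : Set (FreeProP p n)) :=
    Subgroup.isOpen_mono le_sup_left hE
  have hAL : E ⊔ relFrattini p M ≤ L := sup_le (hL ▸ le_sup_left) hML
  obtain ⟨d, hd⟩ := exists_hasQuotientDim_of_isOpen hA hAL hLM le_sup_right
  have h1 := le_rank_cohomFp_two hs hker hA hd ((relFrattini_mono hLM).trans le_sup_right)
    le_sup_left hL
  obtain ⟨e⟩ := finrank_cohomFp_one (p := p) hs hker
  have h2 := hG.rank_H2_le
  rw [e.rank_eq, rank_fin_fun] at h2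
  have hdn : d ≤ n := by exact_mod_cast h1.trans h2
  -- After the upper bound from `H^2`, the lower bound: `L / E M^*` maps onto `M / D M^*`, which has
  -- order `p ^ n`.
  have h3 : (D ⊔ relFrattini p M).relIndex L = p ^ n :=
    (relIndex_sup_relFrattini hM (hML.trans hLM)).trans h
  have h4 : p ^ n ∣ p ^ d := by
    rw [← h3, ← hd.relIndex_eq]
    exact Subgroup.relIndex_dvd_of_le_left L (sup_le_sup_right hED _)
  rw [hd.relIndex_eq, le_antisymm hdn ((Nat.pow_dvd_pow_iff_le_right hp.out.one_lt).1 h4)]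

/-- In the situation of a Schur `D`-quotient, the inversion automorphism acts by `-1` on the
relations. -/
lemma IsWeakSchurSigmaGroup.invAut_mul_mem_sup (h2 : p ≠ 2) {G : Type} [Group G]
    [TopologicalSpace G] [IsTopologicalGroup G] {σ : G ≃ₜ* G} (hG : IsWeakSchurSigmaGroup p G σ)
    {φ : FreeProP p n →ₜ* G} (hs : Function.Surjective φ) (hker : ∀ x, φ x = 1 → coord x = 0)
    (hσ : ∀ x, φ (invAut p n x) = σ (φ x)) {D M : Subgroup (FreeProP p n)}
    (hD : IsTopCharacteristic D) (hDo : IsOpen (D : Set (FreeProP p n)))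
    (α : FreeProP p n ≃ₜ* FreeProP p n) (hM : ∀ x, α x ∈ M ↔ x ∈ D ⊔ φ.toMonoidHom.ker)
    (hMinv : ∀ x ∈ M, invAut p n x ∈ M) {m : FreeProP p n} (hm : m ∈ M) :
    invAut p n m * m ∈ D ⊔ relFrattini p M := by
  let M₁ := D ⊔ φ.toMonoidHom.ker
  let N₁ := D ⊔ relFrattini p M₁
  have hDn : D.Normal := hD.normal
  have hM₁n : M₁.Normal := inferInstanceAs (D ⊔ φ.toMonoidHom.ker).Normal
  have hN₁n : N₁.Normal := inferInstanceAs (D ⊔ relFrattini p M₁).Normal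
  have hM₁o : IsOpen (M₁ : Set (FreeProP p n)) := Subgroup.isOpen_mono le_sup_left hDo
  have hN₁o : IsOpen (N₁ : Set (FreeProP p n)) := Subgroup.isOpen_mono le_sup_left hDo
  have hNM₁ : N₁ ≤ M₁ :=
    sup_le le_sup_left (relFrattini_le_self (Subgroup.isClosed_of_isOpen M₁ hM₁o))
  obtain ⟨d, hd⟩ := exists_hasQuotientDim_of_isOpen hN₁o hNM₁ le_rfl le_sup_right
  have hinv : ∀ x ∈ M₁, invAut p n x * x ∈ N₁ := fun x hx =>
    hG.invAut_mul_mem hs hker hσ hD le_sup_left rfl hN₁o hd le_sup_right hx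
  have hsM : ∀ x ∈ M₁, invAut p n x ∈ M₁ := fun x hx => by
    have := M₁.mul_mem (hNM₁ (hinv x hx)) (M₁.inv_mem hx)
    rwa [mul_inv_cancel_right] at this
  -- The inversion transported from the presentation with kernel `M` to the one with kernel `M₁`.
  -- Both involutions are `-1` on coordinates, so their product is trivial modulo the Frattini
  -- subgroup.
  let τ : FreeProP p n ≃ₜ* FreeProP p n := α.trans ((invAut p n).trans α.symm)
  have hτ : ∀ x, α (τ x) = invAut p n (α x) := fun x => α.apply_symm_apply _
  have hsub : ∀ (β : FreeProP p n ≃ₜ* FreeProP p n) (P : Subgroup (FreeProP p n)),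
      (∀ x ∈ M₁, β x ∈ P) → ∀ x ∈ N₁, β x ∈ D ⊔ relFrattini p P := fun β P hβ x hx => by
    obtain ⟨d, hd, r, hr, rfl⟩ := Subgroup.mem_sup_of_normal_left.1 hx
    rw [map_mul β]
    exact Subgroup.mul_mem_sup (hD.apply_mem β hd) (relFrattini_apply_mem β hβ hr)
  have hτM : ∀ x ∈ M₁, τ x ∈ M₁ := fun x hx => by
    rw [← hM, hτ]
    exact hMinv _ ((hM x).2 hx)
  have hcoord : ∀ x, coord (τ x) = - coord x := fun x => by
    have h1 : invAut p n (α x) * α x ∈ relFrattini p (⊤ : Subgroup (FreeProP p n)) :=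
      mem_frattini_iff.2 (by rw [coord_mul, coord_invAut, neg_add_cancel])
    have h3 := relFrattini_apply_mem (M' := ⊤) α.symm (fun _ _ => Subgroup.mem_top _) h1
    have h4 : α.symm (invAut p n (α x) * α x) = τ x * x := by
      rw [map_mul α.symm, α.symm_apply_apply]
      rfl
    rw [h4, mem_frattini_iff, coord_mul] at h3
    exact eq_neg_of_add_eq_zero_left h3
  -- Modulo `N₁` the element `y = τ x * x` is fixed by `τ` and inverted by `invAut`. The product of
  -- the two thus inverts it, which forces `y ∈ N₁` by unipotence.
  have key : ∀ x ∈ M₁, τ x * x ∈ N₁ := fun x hx => by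
    refine mem_of_apply_mul_mem h2 isProPGroup_freeProP hN₁o
      ((τ.trans (invAut p n) : FreeProP p n ≃ₜ* FreeProP p n) : FreeProP p n →* FreeProP p n)
      (τ.trans (invAut p n)).continuous (fun y => ?_) (fun y hy => ?_) ?_
    · refine mem_frattini_iff.2 ?_
      change coord (y⁻¹ * invAut p n (τ y)) = 0
      rw [coord_mul, coord_inv, coord_invAut, hcoord, neg_neg, neg_add_cancel]
    · exact hsub _ M₁ hsM _ (hsub τ M₁ hτM y hy)
    · change invAut p n (τ (τ x * x)) * (τ x * x) ∈ N₁
      have h3 : τ (τ x) = x := α.injective (by rw [hτ, hτ, invAut_invAut])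
      rw [map_mul τ, h3, map_mul (invAut p n)]
      have h4 := hN₁n.conj_mem _ (hinv _ (hτM x hx)) (invAut p n x)
      have h5 := N₁.mul_mem h4 (hinv x hx)
      have h6 : invAut p n x * (invAut p n (τ x) * τ x) * (invAut p n x)⁻¹ * (invAut p n x * x) =
          invAut p n x * invAut p n (τ x) * (τ x * x) := by group
      rwa [h6] at h5
  obtain ⟨m, rfl⟩ := α.surjective m
  have h3 := hsub α M (fun x hx => (hM x).2 hx) _ (key m ((hM m).1 hm))
  rwa [map_mul α, hτ] at h3

end Criterion

/-! ### Lifting the relations to odd elements -/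

section OddRelations

variable {p n : ℕ} [hp : Fact p.Prime]

/-- An additive subgroup of `𝔽_p ^ n` that contains the doubles of the unit vectors is
everything. -/
lemma eq_top_of_double_single_mem (h2 : p ≠ 2) {V : AddSubgroup (Fin n → ZMod p)}
    (hV : ∀ i, (Pi.single i 1 + Pi.single i 1 : Fin n → ZMod p) ∈ V) : V = ⊤ := by
  have h2' : (2 : ZMod p) ≠ 0 := by
    have := (Nat.coprime_primes Nat.prime_two hp.out).2 h2.symm
    simpa using (ZMod.unitOfCoprime 2 this).ne_zero
  have h : AddSubgroup.toZModSubmodule p V = ⊤ := by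
    rw [eq_top_iff, ← span_single_eq_top n, Submodule.span_le]
    rintro _ ⟨i, rfl⟩
    have h1 := (AddSubgroup.toZModSubmodule p V).smul_mem (2 : ZMod p)⁻¹ (hV i)
    rwa [← two_smul (ZMod p), inv_smul_smul₀ h2'] at h1
  refine eq_top_iff.2 fun v _ => ?_
  exact (h ▸ Submodule.mem_top : v ∈ AddSubgroup.toZModSubmodule p V)

/-- If the inversion automorphism acts by `-1` on `L / A` of dimension `n`, then there are `n` odd
elements that generate `L` modulo `A`. -/
lemma exists_odd_relations (h2 : p ≠ 2) {L A : Subgroup (FreeProP p n)} [L.Normal]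
    (hA : IsOpen (A : Set (FreeProP p n))) (hd : HasQuotientDim p L A n)
    (hc : relFrattini p L ≤ A) (hL : ∀ x ∈ L, invAut p n x ∈ L)
    (hodd : ∀ x ∈ L, invAut p n x * x ∈ A) :
    ∃ r : Fin n → FreeProP p n, (∀ i, r i ∈ L) ∧ (∀ i, invAut p n (r i) = (r i)⁻¹) ∧
      L ≤ closedNormalClosure (Set.range r) ⊔ A := by
  obtain ⟨f, hf, hf0, hfs⟩ := hd.exists_functionals hA hc
  have hmul : ∀ x ∈ L, ∀ y ∈ L, f (x * y) = f x + f y := fun x hx y hy =>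
    funext fun i => (hf i).map_mul x hx y hy
  have hinv : ∀ x ∈ L, f x⁻¹ = - f x := fun x hx => by
    have h := hmul _ (inv_mem hx) x hx
    rw [inv_mul_cancel, (hf0 1 L.one_mem).2 A.one_mem] at h
    exact eq_neg_of_add_eq_zero_left h.symm
  choose l hl hfl using fun i => hfs (Pi.single i 1)
  -- These elements are odd by construction. Since the inversion acts by `-1` on `L / A`, they map
  -- to twice the basis vectors, still a basis for odd `p`.
  let r : Fin n → FreeProP p n := fun i => l i * (invAut p n (l i))⁻¹
  have hrL : ∀ i, r i ∈ L := fun i => L.mul_mem (hl i) (inv_mem (hL _ (hl i)))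
  have hfr : ∀ i, f (r i) = Pi.single i 1 + Pi.single i 1 := fun i => by
    have h := hmul _ (hL _ (hl i)) _ (hl i)
    rw [(hf0 _ (L.mul_mem (hL _ (hl i)) (hl i))).2 (hodd _ (hl i))] at h
    rw [hmul _ (hl i) _ (inv_mem (hL _ (hl i))), hinv _ (hL _ (hl i)),
      eq_neg_of_add_eq_zero_left h.symm, neg_neg, hfl]
  have hLc : IsClosed (L : Set (FreeProP p n)) :=
    Subgroup.isClosed_of_isOpen L (Subgroup.isOpen_mono hd.1 hA)
  have hN : closedNormalClosure (Set.range r) ≤ L := closedNormalClosure_le hLc (by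
    rintro _ ⟨i, rfl⟩
    exact hrL i)
  refine ⟨r, hrL, fun i => ?_, fun x hx => ?_⟩
  · simp only [r, map_mul (invAut p n), map_inv (invAut p n), invAut_invAut, mul_inv_rev, inv_inv]
  · let V : AddSubgroup (Fin n → ZMod p) :=
      { carrier := f '' closedNormalClosure (Set.range r)
        zero_mem' := ⟨1, one_mem _, (hf0 1 L.one_mem).2 A.one_mem⟩
        add_mem' := by
          rintro _ _ ⟨x, hx, rfl⟩ ⟨y, hy, rfl⟩
          exact ⟨x * y, mul_mem hx hy, hmul x (hN hx) y (hN hy)⟩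
        neg_mem' := by
          rintro _ ⟨x, hx, rfl⟩
          exact ⟨x⁻¹, inv_mem hx, hinv x (hN hx)⟩ }
    have hV : V = ⊤ := eq_top_of_double_single_mem h2 fun i =>
      ⟨r i, subset_closedNormalClosure _ ⟨i, rfl⟩, hfr i⟩
    obtain ⟨y, hy, hyx⟩ : f x ∈ V := hV ▸ AddSubgroup.mem_top _
    have h1 : y⁻¹ * x ∈ A := by
      refine (hf0 _ (L.mul_mem (inv_mem (hN hy)) hx)).1 ?_
      rw [hmul _ (inv_mem (hN hy)) x hx, hinv y (hN hy), hyx, neg_add_cancel]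
    have := Subgroup.mul_mem_sup hy h1
    rwa [mul_inv_cancel_left] at this

/-- If the intersections of `A ≤ B` with `L` have the same finite index, they are equal. -/
lemma mem_of_relIndex_eq {F : Type*} [Group F] {A B L : Subgroup F} (hAB : A ≤ B) (hAL : A ≤ L)
    (h : A.relIndex L = B.relIndex L) (h0 : A.relIndex L ≠ 0) {x : F} (hx : x ∈ L) (hxB : x ∈ B) :
    x ∈ A := by
  have h1 := Subgroup.relIndex_mul_relIndex _ _ _ (le_inf hAB hAL) (inf_le_right : B ⊓ L ≤ L)
  rw [Subgroup.inf_relIndex_right, ← h] at h1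
  have h3 : A.relIndex (B ⊓ L) = 1 := (mul_eq_right₀ h0).1 h1
  exact Subgroup.relIndex_eq_one.1 h3 ⟨hxB, hx⟩

/-- The construction of a weak Schur `σ`-group with a given quotient. -/
lemma isSchurQuotient_of_relIndex (h2 : p ≠ 2) {K : Type*} [Group K] [TopologicalSpace K]
    [IsTopologicalGroup K] {θ : FreeProP p n →ₜ* K} (hs : Function.Surjective θ)
    {D E M : Subgroup (FreeProP p n)} [D.Normal] [M.Normal]
    (hker : ∀ x, θ x = 1 → coord x = 0)
    (hE : IsTopCharacteristic E) (hEo : IsOpen (E : Set (FreeProP p n)))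
    (hED : E ≤ D) (hDE : relFrattini p D ≤ E) (hEL : E ≤ θ.toMonoidHom.ker)
    (hL : ∀ x ∈ θ.toMonoidHom.ker, invAut p n x ∈ θ.toMonoidHom.ker)
    (hM : M = D ⊔ θ.toMonoidHom.ker) (hML : relFrattini p M ≤ θ.toMonoidHom.ker)
    (hodd : ∀ x ∈ M, invAut p n x * x ∈ D ⊔ relFrattini p M)
    (hDM : (D ⊔ relFrattini p M).relIndex M = p ^ n)
    (hEL' : (E ⊔ relFrattini p M).relIndex θ.toMonoidHom.ker = p ^ n) : IsSchurQuotient E K := by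
  have hEn : E.Normal := hE.normal
  let L := θ.toMonoidHom.ker
  let A := E ⊔ relFrattini p M
  have hLM : L ≤ M := hM ▸ le_sup_right
  have hA : IsOpen (A : Set (FreeProP p n)) := Subgroup.isOpen_mono le_sup_left hEo
  have hLo : IsOpen (L : Set (FreeProP p n)) := Subgroup.isOpen_mono hEL hEo
  have hAL : A ≤ L := sup_le hEL hML
  -- The surjection `L / A → M / D M^*` is between groups of order `p ^ n`, hence injective, so
  -- oddness passes from `M / D M^*` to `L / A`.
  have hAo : ∀ x ∈ L, invAut p n x * x ∈ A := fun x hx =>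
    mem_of_relIndex_eq (sup_le_sup_right hED _) hAL
      (hEL'.trans ((relIndex_sup_relFrattini hM (hML.trans hLM)).trans hDM).symm)
      (by rw [hEL']; exact pow_ne_zero n hp.out.ne_zero) (L.mul_mem (hL x hx) hx)
      (hodd x (hLM hx))
  have hd : HasQuotientDim p L A n := hasQuotientDim_of_relIndex hAL
    (fun x hx => le_sup_right (a := E) (pow_mem_relFrattini (hLM hx)))
    (fun g _ x hx => le_sup_right (a := E) (commutator_mem_relFrattini g (hLM hx))) hEL'
  obtain ⟨r, hrL, hrodd, hr⟩ := exists_odd_relations h2 hA hd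
    ((relFrattini_mono hLM).trans le_sup_right) hL hAo
  let N := closedNormalClosure (Set.range r)
  have hNL : N ≤ L := closedNormalClosure_le (Subgroup.isClosed_of_isOpen L hLo) (by
    rintro _ ⟨i, rfl⟩
    exact hrL i)
  have hNEo : IsOpen ((N ⊔ E : Subgroup (FreeProP p n)) : Set (FreeProP p n)) :=
    Subgroup.isOpen_mono le_sup_right hEo
  have hNDo : IsOpen ((N ⊔ D : Subgroup (FreeProP p n)) : Set (FreeProP p n)) :=
    Subgroup.isOpen_mono (hED.trans le_sup_right) hEo
  -- The odd relations generate `L` only modulo `E M^*`. As `M = D L` and `E ≤ D`, this gives `M ≤ N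
  -- D M^*`, and Nakayama removes `M^*`. Then `M^* ≤ N D^* ≤ N E`, which yields `L = N E`.
  have hMN : M ≤ N ⊔ D := by
    refine isProPGroup_freeProP.le_of_le_sup_relFrattini hNDo ?_
    nth_rewrite 1 [hM]
    refine sup_le (le_sup_right.trans le_sup_left) (hr.trans (sup_le ?_ (sup_le ?_ le_sup_right)))
    · exact le_sup_left.trans le_sup_left
    · exact hED.trans (le_sup_right.trans le_sup_left)
  have hMNE : relFrattini p M ≤ N ⊔ E :=
    relFrattini_le_of_le_sup (D := D) (Subgroup.isClosed_of_isOpen _ hNEo)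
      (hMN.trans (sup_le_sup_right le_sup_left D)) (hDE.trans le_sup_right)
  have hLeq : L = N ⊔ E :=
    le_antisymm (hr.trans (sup_le le_sup_left (sup_le le_sup_right hMNE))) (sup_le hNL hEL)
  obtain ⟨σ, hσ⟩ := exists_weakSchurSigmaGroup r (fun i => hker _ (hrL i)) hrodd
  have hG := hσ.isProPGroup
  have := hG.t2Space
  let φ : FreeProP p n →ₜ* (FreeProP p n ⧸ N) :=
    ⟨QuotientGroup.mk' N, QuotientGroup.continuous_mk⟩
  have hφs : Function.Surjective φ := QuotientGroup.mk'_surjective N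
  have hφk : ∀ x, φ x = 1 → coord x = 0 := fun x hx =>
    hker x (hNL ((QuotientGroup.eq_one_iff x).1 hx))
  refine ⟨FreeProP p n ⧸ N, inferInstance, inferInstance, inferInstance, σ, hσ,
    le_antisymm (genRank_le hφs) (le_genRank hφs hφk),
    QuotientGroup.lift N θ.toMonoidHom hNL, QuotientGroup.lift_surjective_of_surjective N _ hs hNL,
    ?_⟩
  rw [charSubgroup_eq hG hφs hφk hE, QuotientGroup.ker_lift]
  change L.map (QuotientGroup.mk' N) = E.map (QuotientGroup.mk' N)
  rw [hLeq, Subgroup.map_sup, QuotientGroup.map_mk'_self, bot_sup_eq]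

end OddRelations

/-! ### The criterion -/

section Criterion

variable {p n : ℕ} [hp : Fact p.Prime]
  {H : Type*} [Group H] [Finite H] [TopologicalSpace H] [DiscreteTopology H]
  {K : Type*} [Group K] [TopologicalSpace K] [DiscreteTopology K]

/-- The dimensions that occur in the criterion, in terms of a presentation `θ : F_n → K`. -/
lemma dimensions_of_presentation (hH : IsPGroup p H) (hK : IsProPGroup p K) {π : K →* H}
    (hπ : Function.Surjective π) {θ : FreeProP p n →ₜ* K} (hs : Function.Surjective θ)
    (hker : ∀ x, θ x = 1 → coord x = 0) {D E : Subgroup (FreeProP p n)}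
    (hD : IsTopCharacteristic D) (hDo : IsOpen (D : Set (FreeProP p n)))
    (hDc : ∀ x ∈ D, coord x = 0) (hE : IsTopCharacteristic E)
    (hED : E ≤ D) (hDE : relFrattini p D ≤ E) (hrel : HasRelRank H D n)
    (hπk : π.ker = charSubgroup K D) {M : Subgroup (FreeProP p n)}
    (hM : M = D ⊔ θ.toMonoidHom.ker) :
    (π.comp θ.toMonoidHom).ker = M ∧ (∃ m, HasMultiplicatorRank p n H m) ∧
      (∃ e, HasDim p (charSubgroup (PCover p n H) E) e) ∧
      (D ⊔ relFrattini p M).relIndex M = p ^ n ∧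
      (E ≤ θ.toMonoidHom.ker → relFrattini p M ≤ θ.toMonoidHom.ker ∧ (∃ k, HasDim p π.ker k) ∧
        ((∃ m k e, HasMultiplicatorRank p n H m ∧ HasDim p π.ker k ∧
          HasDim p (charSubgroup (PCover p n H) E) e ∧ m = k + n + e) ↔
        (E ⊔ relFrattini p M).relIndex θ.toMonoidHom.ker = p ^ n)) := by
  have hDn : D.Normal := hD.normal
  have hH' := isProPGroup_of_finite hH
  rw [charSubgroup_eq hK hs hker hD] at hπk
  have hρM : (π.comp θ.toMonoidHom).ker = M := (ker_comp_eq_sup θ.toMonoidHom hπk).trans hM.symm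
  let ρ : FreeProP p n →ₜ* H := ⟨π.comp θ.toMonoidHom,
    (continuous_of_discreteTopology (f := π)).comp θ.continuous⟩
  have hρs : Function.Surjective ρ := hπ.comp hs
  have hρk : ρ.toMonoidHom.ker = M := hρM
  have hMn : M.Normal := hρk ▸ MonoidHom.normal_ker _
  have hρc : ∀ x, ρ x = 1 → coord x = 0 := fun x hx => by
    have hx' : x ∈ M := hρk ▸ hx
    rw [hM] at hx'
    obtain ⟨d, hd, l, hl, rfl⟩ := Subgroup.mem_sup_of_normal_left.1 hx'
    rw [coord_mul, hDc d hd, hker l hl, add_zero]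
  have hMo : IsOpen (M : Set (FreeProP p n)) := hM ▸ Subgroup.isOpen_mono le_sup_left hDo
  have hMso := isOpen_relFrattini_freeProP hMo
  have hMs : relFrattini p M ≤ M := relFrattini_le_self (Subgroup.isClosed_of_isOpen M hMo)
  have hEM : E ≤ M := hED.trans (hM ▸ le_sup_left)
  have hm := fun m => hasMultiplicatorRank_iff (m := m) hH' hρs hρc
  have he := fun e => hasDim_charSubgroup_pCover_iff (e := e) hH' hρs hρc hE (hρk ▸ hEM)
  simp only [hρk] at hm he
  obtain ⟨m, hm0⟩ := exists_hasQuotientDim_of_isOpen hMso hMs le_rfl le_rfl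
  have hAM : E ⊔ relFrattini p M ≤ M := sup_le hEM hMs
  obtain ⟨e, he0⟩ := exists_hasQuotientDim_of_isOpen hMso
    (le_sup_right : relFrattini p M ≤ E ⊔ relFrattini p M) hAM le_rfl
  have hm1 := hm0.relIndex_eq
  have he1 := he0.relIndex_eq
  rw [Subgroup.relIndex_sup_right] at he1
  refine ⟨hρM, ⟨m, (hm m).2 hm1⟩, ⟨e, (he e).2 he1⟩, ?_, fun hEL => ?_⟩
  · have := hrel.relIndex_eq hH' hρs hρc hD
    rwa [hρk] at this
  have hLc : IsClosed (θ.toMonoidHom.ker : Set (FreeProP p n)) :=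
    isClosed_singleton.preimage θ.continuous
  have hLo : IsOpen (θ.toMonoidHom.ker : Set (FreeProP p n)) :=
    (isOpen_discrete {1}).preimage θ.continuous
  have hML : relFrattini p M ≤ θ.toMonoidHom.ker :=
    relFrattini_le_of_le_sup hLc (hM.trans (sup_comm _ _)).le (hDE.trans hEL)
  have hLM : θ.toMonoidHom.ker ≤ M := hM ▸ le_sup_right
  have hk := fun k => hasDim_ker_iff (k := k) hs π (hρM ▸ hML)
  simp only [hρM] at hk
  obtain ⟨k, hk0⟩ := exists_hasQuotientDim_of_isOpen hLo hLM le_rfl hML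
  have hk1 := hk0.relIndex_eq
  have hp1 := hp.out.one_lt
  -- Indices along the chain `M^* ≤ E M^* ≤ L ≤ M`; the first one equals the index of `M^*` relative
  -- to `E`.
  have hprod : p ^ e * (E ⊔ relFrattini p M).relIndex θ.toMonoidHom.ker * p ^ k = p ^ m := by
    rw [← hm1, ← hk1, ← he1, ← Subgroup.relIndex_sup_right (H := E),
      Subgroup.relIndex_mul_relIndex _ _ _ le_sup_right (sup_le hEL hML),
      Subgroup.relIndex_mul_relIndex _ _ _ hML hLM]
  refine ⟨hML, ⟨k, (hk k).2 hk1⟩, ?_, fun h => ⟨m, k, e, (hm m).2 hm1, (hk k).2 hk1,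
    (he e).2 he1, ?_⟩⟩
  · rintro ⟨m', k', e', hm', hk', he', rfl⟩
    have hm2 := ((hm _).1 hm').symm.trans hm1
    have hk2 := ((hk _).1 hk').symm.trans hk1
    have he2 := ((he _).1 he').symm.trans he1
    rw [← hm2, ← hk2, ← he2, pow_add, pow_add] at hprod
    have hpos : 0 < p ^ e' * p ^ k' := Nat.mul_pos (pow_pos hp.out.pos _) (pow_pos hp.out.pos _)
    refine Nat.eq_of_mul_eq_mul_left hpos ?_
    linarith
  · rw [h, ← pow_add, ← pow_add] at hprod
    have := Nat.pow_right_injective hp1 hprod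
    omega

/-- A Schur `E`-quotient is trivial on `E`, generated by odd elements, and has `n` relations. -/
lemma IsSchurQuotient.relations (h2 : p ≠ 2) {D E : Subgroup (FreeProP p n)}
    (hD : IsTopCharacteristic D) (hE : IsTopCharacteristic E)
    (hEo : IsOpen (E : Set (FreeProP p n))) (hED : E ≤ D) (h : IsSchurQuotient E K) :
    HasOddGeneration K ∧ ∃ θ : FreeProP p n →ₜ* K, Function.Surjective θ ∧
      E ≤ θ.toMonoidHom.ker ∧ ∀ M : Subgroup (FreeProP p n), M.Normal →
        M = D ⊔ θ.toMonoidHom.ker → relFrattini p M ≤ θ.toMonoidHom.ker →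
        (D ⊔ relFrattini p M).relIndex M = p ^ n →
        (E ⊔ relFrattini p M).relIndex θ.toMonoidHom.ker = p ^ n := by
  have hDn : D.Normal := hD.normal
  obtain ⟨G, _, _, _, σ, hG, hGn, π, hπ, hπk⟩ := h
  obtain ⟨φ, hφs, hφk, hφσ⟩ := hG.exists_equivariant_presentation h2 hGn
  rw [charSubgroup_eq hG.isProPGroup hφs hφk hE] at hπk
  have hθk : (π.comp φ.toMonoidHom).ker = E ⊔ φ.toMonoidHom.ker :=
    ker_comp_eq_sup φ.toMonoidHom hπk
  have hθo : IsOpen ((π.comp φ.toMonoidHom).ker : Set (FreeProP p n)) :=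
    hθk ▸ Subgroup.isOpen_mono le_sup_left hEo
  let θ : FreeProP p n →ₜ* K :=
    ⟨π.comp φ.toMonoidHom, continuous_of_isOpen_ker _ hθo⟩
  have hθs : Function.Surjective θ := hπ.comp hφs
  have hinv : ∀ x, θ x = 1 → θ (invAut p n x) = 1 := fun x hx => by
    have hx' : x ∈ E ⊔ φ.toMonoidHom.ker := hθk ▸ hx
    obtain ⟨e, he, r, hr, rfl⟩ := Subgroup.mem_sup_of_normal_right.1 hx'
    have h1 : invAut p n (e * r) ∈ E ⊔ φ.toMonoidHom.ker := by
      rw [map_mul (invAut p n)]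
      refine Subgroup.mul_mem_sup (hE.apply_mem _ he) ?_
      change φ (invAut p n r) = 1
      rw [hφσ, show φ r = 1 from hr, map_one σ]
    exact (hθk ▸ h1 : invAut p n (e * r) ∈ (π.comp φ.toMonoidHom).ker)
  obtain ⟨τ, hτ⟩ := exists_induced_involution (θ := θ.toMonoidHom) hθs hinv
  refine ⟨hasOddGeneration_of_equivariant hθs τ hτ, θ, hθs, hθk ▸ le_sup_left,
    fun M _ hM hML h => ?_⟩
  exact hG.relIndex_eq hφs hφk hEo hED hθk hM hML h

/-- The criterion for Schur quotients. -/
lemma schurQuotient_criterion [Finite K] (h2 : p ≠ 2) (hH : IsPGroup p H) (hK : IsPGroup p K)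
    (hKn : genRank K = n) {π : K →* H} (hπ : Function.Surjective π)
    {D E : Subgroup (FreeProP p n)} (hD : IsTopCharacteristic D)
    (hDo : IsOpen (D : Set (FreeProP p n))) (hDc : ∀ x ∈ D, coord x = 0)
    (hE : IsTopCharacteristic E) (hEo : IsOpen (E : Set (FreeProP p n)))
    (hED : E ≤ D) (hDE : relFrattini p D ≤ E) (hDH : IsSchurQuotient D H)
    (hrel : HasRelRank H D n) (hπk : π.ker = charSubgroup K D) :
    (∃ m, HasMultiplicatorRank p n H m) ∧
      (∃ e, HasDim p (charSubgroup (PCover p n H) E) e) ∧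
      (charSubgroup K E = ⊥ → ∃ k, HasDim p π.ker k) ∧
      (IsSchurQuotient E K ↔ charSubgroup K E = ⊥ ∧ HasOddGeneration K ∧
        ∃ m k e, HasMultiplicatorRank p n H m ∧ HasDim p π.ker k ∧
          HasDim p (charSubgroup (PCover p n H) E) e ∧ m = k + n + e) := by
  have hDn : D.Normal := hD.normal
  have hK' := isProPGroup_of_finite hK
  have hbot : ∀ θ : FreeProP p n →ₜ* K, Function.Surjective θ →
      (charSubgroup K E = ⊥ ↔ E ≤ θ.toMonoidHom.ker) := fun θ hs => by
    rw [charSubgroup_eq hK' hs (fun x hx => coord_eq_zero_of_genRank hK' hs hKn hx) hE,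
      Subgroup.map_eq_bot_iff]
  have hdim := fun (θ : FreeProP p n →ₜ* K) (hs : Function.Surjective θ) =>
    dimensions_of_presentation hH hK' hπ hs
      (fun x hx => coord_eq_zero_of_genRank hK' hs hKn hx) hD hDo hDc hE hED hDE hrel hπk rfl
  obtain ⟨θ₀, hθ₀⟩ := exists_surjective_of_genRank hK' hKn
  obtain ⟨-, hm, he, -, hk⟩ := hdim θ₀ hθ₀
  refine ⟨hm, he, fun h => (hk ((hbot θ₀ hθ₀).1 h)).2.1, fun h => ?_, ?_⟩
  · obtain ⟨hodd, θ, hθ, hEθ, hθr⟩ := h.relations h2 hD hE hEo hED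
    obtain ⟨-, -, -, hDM, hd⟩ := hdim θ hθ
    obtain ⟨hML, -, hiff⟩ := hd hEθ
    exact ⟨(hbot θ hθ).2 hEθ, hodd, hiff.2 (hθr _ inferInstance rfl hML hDM)⟩
  · rintro ⟨hE0, hodd, hc⟩
    obtain ⟨σ, θ, hθ, hθk, hθσ⟩ := hodd.exists_equivariant_presentation h2 hK hKn
    obtain ⟨hker, -, -, hDM, hd⟩ := hdim θ hθ
    have hEθ := (hbot θ hθ).1 hE0
    obtain ⟨hML, -, hiff⟩ := hd hEθ
    have hL : ∀ x ∈ θ.toMonoidHom.ker, invAut p n x ∈ θ.toMonoidHom.ker := fun x hx => by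
      change θ (invAut p n x) = 1
      rw [hθσ, show θ x = 1 from hx, map_one σ]
    have hMinv : ∀ x ∈ D ⊔ θ.toMonoidHom.ker, invAut p n x ∈ D ⊔ θ.toMonoidHom.ker :=
      fun x hx => by
        obtain ⟨d, hd, l, hl, rfl⟩ := Subgroup.mem_sup_of_normal_left.1 hx
        rw [map_mul (invAut p n)]
        exact Subgroup.mul_mem_sup (hD.apply_mem _ hd) (hL l hl)
    obtain ⟨G, _, _, _, τ, hG, hGn, πG, hπG, hπGk⟩ := hDH
    obtain ⟨φ, hφs, hφk, hφσ⟩ := hG.exists_equivariant_presentation h2 hGn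
    rw [charSubgroup_eq hG.isProPGroup hφs hφk hD] at hπGk
    have hφk' : (πG.comp φ.toMonoidHom).ker = D ⊔ φ.toMonoidHom.ker :=
      ker_comp_eq_sup φ.toMonoidHom hπGk
    have hsup : ∀ {A : Subgroup (FreeProP p n)}, (∀ x ∈ A, coord x = 0) →
        ∀ x ∈ D ⊔ A, coord x = 0 := fun hA x hx => by
      obtain ⟨d, hd, a, ha, rfl⟩ := Subgroup.mem_sup_of_normal_left.1 hx
      rw [coord_mul, hDc d hd, hA a ha, add_zero]
    let ρ₁ : FreeProP p n →ₜ* H := ⟨πG.comp φ.toMonoidHom,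
      continuous_of_isOpen_ker _ (hφk' ▸ Subgroup.isOpen_mono le_sup_left hDo)⟩
    let ρ₂ : FreeProP p n →ₜ* H := ⟨π.comp θ.toMonoidHom,
      (continuous_of_discreteTopology (f := π)).comp θ.continuous⟩
    -- The presentation of `H` through the weak Schur group and the one through `K` are both
    -- equivariant for the inversion, but they may induce different involutions on `H`, so `α` need
    -- not commute with the inversion.
    obtain ⟨α, hα⟩ := exists_automorphism (isProPGroup_of_finite hH) (φ := ρ₁) (ψ := ρ₂)
      (hπG.comp hφs) (hπ.comp hθ) (fun x hx => hsup (A := φ.toMonoidHom.ker) hφk x (hφk'.le hx))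
      (fun x hx => hsup (A := θ.toMonoidHom.ker) hθk x (hker.le hx))
    have hαM : ∀ x, α x ∈ D ⊔ θ.toMonoidHom.ker ↔ x ∈ D ⊔ φ.toMonoidHom.ker := fun x => by
      rw [← hker, ← hφk']
      change ρ₂ (α x) = 1 ↔ ρ₁ x = 1
      rw [hα]
    exact isSchurQuotient_of_relIndex h2 hθ hθk hE hEo hED hDE hEθ hL rfl hML
      (fun m hm => hG.invAut_mul_mem_sup h2 hφs hφk hφσ hD hDo α hαM hMinv hm) hDM (hiff.1 hc)

end Criterion

theorem mainTheorem7 (p : ℕ) [Fact p.Prime] (hp : p ≠ 2) (n : ℕ)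
    (H : Type*) [Group H] [Finite H] [TopologicalSpace H] [DiscreteTopology H] (hH : IsPGroup p H)
    (K : Type*) [Group K] [Finite K] [TopologicalSpace K] [DiscreteTopology K] (hK : IsPGroup p K)
    (hKn : genRank K = n) (π : K →* H) (hπ : Function.Surjective π) :
    -- the general case
    (∀ D E : Subgroup (FreeProP p n),
      IsOpen (D : Set (FreeProP p n)) → IsTopCharacteristic D → D ≠ ⊤ →
      IsOpen (E : Set (FreeProP p n)) → IsTopCharacteristic E → E ≠ ⊤ →
      E ≤ D → relFrattini p D ≤ E →
      IsSchurQuotient D H → HasRelRank H D n → π.ker = charSubgroup K D →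
        -- the dimensions in the condition are defined and finite
        (∃ m, HasMultiplicatorRank p n H m) ∧
        (∃ e, HasDim p (charSubgroup (PCover p n H) E) e) ∧
        (charSubgroup K E = ⊥ → ∃ k, HasDim p π.ker k) ∧
        -- the criterion
        (IsSchurQuotient E K ↔
          charSubgroup K E = ⊥ ∧ HasOddGeneration K ∧
          ∃ m k e, HasMultiplicatorRank p n H m ∧ HasDim p π.ker k ∧
            HasDim p (charSubgroup (PCover p n H) E) e ∧ m = k + n + e)) ∧
    -- the special case of the lower `p`-central series
    (∀ j : ℕ, 1 ≤ j →
      IsSchurQuotient (lowerPCentral p (FreeProP p n) j) H →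
      HasRelRank H (lowerPCentral p (FreeProP p n) j) n → π.ker = lowerPCentral p K j →
        (∃ m, HasMultiplicatorRank p n H m) ∧
        charSubgroup (PCover p n H) (lowerPCentral p (FreeProP p n) (j + 1)) = ⊥ ∧
        (lowerPCentral p K (j + 1) = ⊥ → ∃ k, HasDim p π.ker k) ∧
        (IsSchurQuotient (lowerPCentral p (FreeProP p n) (j + 1)) K ↔
          lowerPCentral p K (j + 1) = ⊥ ∧ HasOddGeneration K ∧
          ∃ m k, HasMultiplicatorRank p n H m ∧ HasDim p π.ker k ∧ m = k + n)) := by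
  refine ⟨fun D E hDo hD hD1 hEo hE _ hED hDE hDH hrel hπk =>
    schurQuotient_criterion hp hH hK hKn hπ hD hDo
      (fun x hx => coord_eq_zero_of_isTopCharacteristic hD hDo hD1 hx) hE hEo hED hDE hDH hrel hπk,
    fun j hj hDH hrel hπk => ?_⟩
  have hK' := isProPGroup_of_finite hK
  obtain ⟨θ, hθ⟩ := exists_surjective_of_genRank hK' hKn
  have hchar : ∀ i, charSubgroup K (lowerPCentral p (FreeProP p n) i) = lowerPCentral p K i :=
    fun i => by
      rw [charSubgroup_eq hK' hθ (fun x hx => coord_eq_zero_of_genRank hK' hθ hKn hx)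
        (isTopCharacteristic_lowerPCentral i)]
      exact map_lowerPCentral θ.toMonoidHom θ.continuous hθ i
  have hclosed := isClosed_lowerPCentral (p := p) (F := FreeProP p n)
  -- For `j ≥ 1` this holds without assuming the subgroup proper, which matters when `n = 0` and
  -- `F_n` is trivial.
  have hDc : ∀ x ∈ lowerPCentral p (FreeProP p n) j, coord x = 0 := fun x hx => by
    obtain ⟨i, rfl⟩ := Nat.exists_eq_add_of_le' hj
    exact mem_frattini_iff.1 (relFrattini_mono le_top hx)
  have hDn : (lowerPCentral p (FreeProP p n) j).Normal :=
    (isTopCharacteristic_lowerPCentral j).normal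
  have hE := isTopCharacteristic_lowerPCentral (p := p) (G := FreeProP p n) (j + 1)
  -- The relation rank hypothesis includes that `P_j` lies in the relation subgroup; applying the
  -- star to both puts `P_{j+1}` in the kernel of the projection to the `p`-cover.
  have hcover : charSubgroup (PCover p n H) (lowerPCentral p (FreeProP p n) (j + 1)) = ⊥ := by
    rw [map_eq_charSubgroup_pCover H hE, Subgroup.map_eq_bot_iff, QuotientGroup.ker_mk']
    exact relFrattini_mono (le_sup_left.trans hrel.1)
  obtain ⟨h1, h2, h3, h4⟩ := schurQuotient_criterion hp hH hK hKn hπ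
    (isTopCharacteristic_lowerPCentral j) (isOpen_lowerPCentral_freeProP j) hDc hE
    (isOpen_lowerPCentral_freeProP (j + 1)) (relFrattini_le_self (hclosed j)) le_rfl hDH hrel
    (hπk.trans (hchar j).symm)
  rw [hchar] at h3 h4
  refine ⟨h1, hcover, h3, h4.trans (and_congr_right fun _ => and_congr_right fun _ => ?_)⟩
  have hdim : HasDim p (⊥ : Subgroup (PCover p n H)) 0 := hasQuotientDim_of_relIndex le_rfl
    (fun x hx => Subgroup.pow_mem _ hx p) (fun g hg x hx => commutator_mem_of_normal g hx)
    (by rw [Subgroup.relIndex_self, pow_zero])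
  rw [hcover]
  constructor
  · rintro ⟨m, k, e, hm, hk, he, rfl⟩
    have he0 : e = 0 := by
      have h5 := he.relIndex_eq
      rw [Subgroup.relIndex_self] at h5
      exact Nat.pow_right_injective (Fact.out : p.Prime).one_lt (h5.symm.trans (pow_zero p).symm)
    exact ⟨_, k, hm, hk, by rw [he0, add_zero]⟩
  · rintro ⟨m, k, hm, hk, rfl⟩
    exact ⟨_, k, 0, hm, hk, hdim, rfl⟩
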